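/- Let $n\ge 2$ and let $H^2_n$ be the Drury--Arveson space, i.e. the Hilbert space of analytic functions on the unit ball of $\mathbb C^n$ in which the monomials $z^k$ $(k\in\mathbb N_0^n)$ are orthogonal and total with $\|z^k\|^2=k!/|k|!$. Let $G\subset U(n)$ be a closed subgroup and let $0\ne v\in\mathbb C^n$ be such that the orbit $M=G\cdot[v]\subset\mathbb{CP}^{n-1}$ is a coadjoint orbit of $G$ in its natural projective embedding, meaning that $M$ is a connected complex submanifold of $\mathbb{CP}^{n-1}$ which is not contained in any hyperplane. Let $d:=\dim_{\mathbb C}M$. Let $\mathcal H\subset H^2_n$ be the associated graded quotient module, that is, the orthogonal complement in $H^2_n$ of the homogeneous ideal of all polynomials in $\mathbb C[z_1,\dots,z_n]$ that vanish on (the cone over) $M$. Let $S_\alpha$ be the compression to $\mathcal H$ of the operator of multiplication by $z_\alpha$ on $H^2_n$ $(\alpha=1,\dots,n)$. Then for all $\alpha,\beta\in\{1,\dots,n\}$ and all real $p>0$, $$[S_\alpha^*,S_\beta]=S_\alpha^*S_\beta-S_\beta S_\alpha^*\in\mathcal L^p\iff p>d+1,$$ where $\mathcal L^p$ denotes the Schatten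 class of bounded operators $T$ on $\mathcal H$ with $\operatorname{Tr}|T|^p<\infty$. -/

import Mathlib

open scoped Matrix

noncomputable section

namespace DruryArveson

/-! ### The Drury–Arveson space

In `H²_n`, the monomials `z^k` are orthogonal with `‖z^k‖² = k! / |k|!`. We realise `H²_n` as
`ℓ²(ℕ^n)`, a vector `f` standing for the analytic function `∑ f(k) z^k / ‖z^k‖` on the unit ball.
-/

/-- The Drury–Arveson space `H²_n` (the symmetric Fock space over `ℂ^n`), written in the
orthonormal basis of normalised monomials. -/
abbrev Space (n : ℕ) : Type := lp (fun _ : Fin n →₀ ℕ => ℂ) 2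

/-- The squared norm `k! / |k|!` of the monomial `z^k` in `H²_n`. -/
def monomialNormSq {n : ℕ} (k : Fin n →₀ ℕ) : ℝ :=
  ((∏ i, (k i).factorial : ℕ) : ℝ) / ((k.degree.factorial : ℕ) : ℝ)

/-- A polynomial, regarded as an element of `H²_n`. -/
def ofPoly {n : ℕ} (q : MvPolynomial (Fin n) ℂ) : Space n :=
  ⟨fun k => (Real.sqrt (monomialNormSq k) : ℂ) * q.coeff k, by
    apply memℓp_gen
    refine summable_of_ne_finset_zero (s := q.support) fun k hk => ?_
    simp [MvPolynomial.notMem_support_iff.mp hk]⟩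

/-- The coefficients of `z_α f`, in the basis of normalised monomials. -/
def shiftFun {n : ℕ} (α : Fin n) (f : (Fin n →₀ ℕ) → ℂ) (k : Fin n →₀ ℕ) : ℂ :=
  if k α = 0 then 0
  else (Real.sqrt ((k α : ℝ) / (k.degree : ℝ)) : ℂ) * f (k - Finsupp.single α 1)

lemma norm_shiftFun_le {n : ℕ} (α : Fin n) (f : (Fin n →₀ ℕ) → ℂ) (k : Fin n →₀ ℕ) :
    ‖shiftFun α f k‖ ^ 2 ≤
      Function.extend (fun l : Fin n →₀ ℕ => l + Finsupp.single α 1)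
        (fun l => ‖f l‖ ^ 2) 0 k := by
  have hinj : Function.Injective (fun l : Fin n →₀ ℕ => l + Finsupp.single α 1) :=
    add_left_injective _
  unfold shiftFun
  split_ifs with h
  · rw [norm_zero, zero_pow two_ne_zero]
    by_cases hk : ∃ l : Fin n →₀ ℕ, l + Finsupp.single α 1 = k
    · obtain ⟨l, rfl⟩ := hk
      simp at h
    · rw [Function.extend_apply' _ _ _ hk]
      exact le_rfl
  · have hk : k - Finsupp.single α 1 + Finsupp.single α 1 = k := by
      apply tsub_add_cancel_of_le
      rw [Finsupp.single_le_iff]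
      omega
    have e := hinj.extend_apply (fun l => ‖f l‖ ^ 2) 0 (k - Finsupp.single α 1)
    simp only [hk] at e
    rw [e, norm_mul, Complex.norm_real, Real.norm_of_nonneg (Real.sqrt_nonneg _), mul_pow,
      Real.sq_sqrt (by positivity)]
    have hle : (k α : ℝ) / (k.degree : ℝ) ≤ 1 := by
      apply div_le_one_of_le₀ _ (Nat.cast_nonneg _)
      exact_mod_cast Finsupp.le_degree α k
    exact mul_le_of_le_one_left (by positivity) hle

lemma summable_shiftFun {n : ℕ} (α : Fin n) (f : Space n) :
    Summable (fun k => ‖shiftFun α f k‖ ^ 2) ∧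
      ∑' k, ‖shiftFun α f k‖ ^ 2 ≤ ∑' k, ‖f k‖ ^ 2 := by
  have hinj : Function.Injective (fun l : Fin n →₀ ℕ => l + Finsupp.single α 1) :=
    add_left_injective _
  have hf : Summable (fun k => ‖f k‖ ^ 2) := by
    simpa using (lp.memℓp f).summable (by norm_num)
  have hE := (hasSum_extend_zero hinj).2 hf.hasSum
  have hs := Summable.of_nonneg_of_le (fun _ => by positivity) (norm_shiftFun_le α f) hE.summable
  refine ⟨hs, ?_⟩
  rw [← hE.tsum_eq]
  exact hs.tsum_le_tsum (norm_shiftFun_le α f) hE.summable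

/-- The `α`-th Drury–Arveson shift: multiplication by the coordinate function `z_α` on `H²_n`. -/
def shift {n : ℕ} (α : Fin n) : Space n →L[ℂ] Space n :=
  LinearMap.mkContinuous
    { toFun := fun f => ⟨shiftFun α f, memℓp_gen (by simpa using (summable_shiftFun α f).1)⟩
      map_add' := fun f g => by
        ext k
        simp only [shiftFun, lp.coeFn_add, Pi.add_apply]
        split_ifs <;> ring
      map_smul' := fun c f => by
        ext k
        simp only [shiftFun, lp.coeFn_smul, Pi.smul_apply, smul_eq_mul, RingHom.id_apply]
        split_ifs <;> ring }
    1 (fun f => by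
      rw [one_mul]
      refine (sq_le_sq₀ (norm_nonneg _) (norm_nonneg _)).1 ?_
      have h1 := lp.norm_rpow_eq_tsum (p := 2) (by norm_num) f
      have h2 := lp.norm_rpow_eq_tsum (p := 2) (by norm_num)
        (⟨shiftFun α f, memℓp_gen (by simpa using (summable_shiftFun α f).1)⟩ : Space n)
      simp only [ENNReal.toReal_ofNat, Real.rpow_ofNat] at h1 h2
      have h3 := (summable_shiftFun α f).2
      rw [← h1] at h3
      exact h2.trans_le h3)

/-- On polynomials the shift is multiplication by the coordinate function. -/
lemma shift_ofPoly {n : ℕ} (α : Fin n) (q : MvPolynomial (Fin n) ℂ) :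
    shift α (ofPoly q) = ofPoly (MvPolynomial.X α * q) := by
  ext k
  change shiftFun α (fun k => (Real.sqrt (monomialNormSq k) : ℂ) * q.coeff k) k =
    (Real.sqrt (monomialNormSq k) : ℂ) * (MvPolynomial.X α * q).coeff k
  rw [MvPolynomial.coeff_X_mul']
  unfold shiftFun
  by_cases h : k α = 0
  · simp [h]
  · have hk : k - Finsupp.single α 1 + Finsupp.single α 1 = k := by
      apply tsub_add_cancel_of_le
      rw [Finsupp.single_le_iff]
      omega
    obtain ⟨l, rfl⟩ : ∃ l, k = l + Finsupp.single α 1 := ⟨_, hk.symm⟩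
    have hs : α ∈ (l + Finsupp.single α 1).support := by simp
    rw [if_neg h, if_pos hs, add_tsub_cancel_right, ← mul_assoc, ← Complex.ofReal_mul,
      ← Real.sqrt_mul (by positivity)]
    congr 3
    have hprod : ∏ i, ((l + Finsupp.single α 1 : Fin n →₀ ℕ) i).factorial
        = (l α + 1) * ∏ i, (l i).factorial := by
      rw [← Finset.mul_prod_erase Finset.univ _ (Finset.mem_univ α),
        ← Finset.mul_prod_erase Finset.univ (fun i => (l i).factorial) (Finset.mem_univ α),
        ← mul_assoc]
      congr 1
      · simp [Nat.factorial_succ]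
      · refine Finset.prod_congr rfl fun i hi => ?_
        have : α ≠ i := fun e => (Finset.mem_erase.1 hi).1 e.symm
        simp [this]
    have hdeg : (l + Finsupp.single α 1).degree = l.degree + 1 := by
      simp
    unfold monomialNormSq
    rw [hprod, hdeg, Nat.factorial_succ]
    simp only [Finsupp.add_apply, Finsupp.single_eq_same]
    push_cast
    have : ((l.degree.factorial : ℕ) : ℝ) ≠ 0 := by positivity
    field_simp

/-! ### Graded quotient modules and compressed shifts -/

/-- The polynomials vanishing on a subset of `ℂ^n`. When `C` is the punctured cone over
`M ⊆ ℂP^{n-1}` this is the homogeneous ideal of `M`. -/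
def vanishingPolys {n : ℕ} (C : Set (Fin n → ℂ)) : Set (MvPolynomial (Fin n) ℂ) :=
  {q | ∀ w ∈ C, MvPolynomial.eval w q = 0}

/-- The quotient module of `H²_n` given by the cone `C`: the orthogonal complement in `H²_n` of
the polynomials that vanish on `C`. (It is the completion of the coordinate ring
`ℂ[z_1, …, z_n] / I(C)` in the quotient norm.) -/
abbrev quotientModule {n : ℕ} (C : Set (Fin n → ℂ)) : Submodule ℂ (Space n) :=
  (Submodule.span ℂ (ofPoly '' vanishingPolys C))ᗮ

/-- The compression `S_α` of the `α`-th shift to the quotient module. -/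
def compressedShift {n : ℕ} (C : Set (Fin n → ℂ)) (α : Fin n) :
    quotientModule C →L[ℂ] quotientModule C :=
  (quotientModule C).orthogonalProjectionOnto ∘L shift α ∘L (quotientModule C).subtypeL

/-- The commutator `[S_α^*, S_β]`. -/
def crossCommutator {n : ℕ} (C : Set (Fin n → ℂ)) (α β : Fin n) :
    quotientModule C →L[ℂ] quotientModule C :=
  (ContinuousLinearMap.adjoint (compressedShift C α)) ∘L compressedShift C β -
    compressedShift C β ∘L (ContinuousLinearMap.adjoint (compressedShift C α))

end DruryArveson

/-- For `0 < p < ∞`, the operator `T` is in the Schatten class `L^p` if `Tr |T|^p < ∞`, the trace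
being computed in some (equivalently, every) orthonormal basis; here `A.reApplyInnerSelf x = Re ⟪A x, x⟫`. -/
def IsSchatten {H : Type*} [NormedAddCommGroup H] [InnerProductSpace ℂ H] [CompleteSpace H]
    (p : ℝ) (T : H →L[ℂ] H) : Prop :=
  ∃ (s : Set H) (b : HilbertBasis s ℂ H),
    Summable fun i : s => ((CFC.abs T) ^ p : H →L[ℂ] H).reApplyInnerSelf (b i)

/-- The punctured cone over the orbit `G · [v] ⊆ ℂP^{n-1}`, that is, the set of all nonzero vectors
of `ℂ^n` whose line lies in that orbit. -/
def orbitCone {n : ℕ} (G : Subgroup (Matrix.unitaryGroup (Fin n) ℂ)) (v : Fin n → ℂ) :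
    Set (Fin n → ℂ) :=
  {w | ∃ g ∈ G, ∃ c : ℂ, c ≠ 0 ∧ w = c • ((g : Matrix (Fin n) (Fin n) ℂ) *ᵥ v)}

/-- `X` is a complex submanifold of `ℂ^n` of complex dimension `k`: around each of its points there
is a biholomorphic change of coordinates that straightens `X` to a `k`-dimensional complex linear
subspace. -/
def IsComplexSubmanifold {n : ℕ} (k : ℕ) (X : Set (Fin n → ℂ)) : Prop :=
  ∀ x ∈ X, ∃ (e : OpenPartialHomeomorph (Fin n → ℂ) (Fin n → ℂ)) (L : Submodule ℂ (Fin n → ℂ)),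
    x ∈ e.source ∧ DifferentiableOn ℂ e e.source ∧ DifferentiableOn ℂ e.symm e.target ∧
    Module.finrank ℂ L = k ∧ ∀ y ∈ e.source, y ∈ X ↔ e y ∈ L

/-- The orbit `M = G · [v] ⊆ ℂP^{n-1}` of a compact matrix group `G` is a coadjoint orbit, of
complex dimension `d`, embedded in the projective space of its degree-one coordinate functions:
`M` is a connected complex submanifold of `ℂP^{n-1}` of dimension `d` (equivalently, the punctured
cone over `M` is a connected complex submanifold of `ℂ^n` of dimension `d + 1`), and
`M` does not lie in a hyperplane (the coordinates `Z_1, …, Z_n` are linearly independent). -/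
structure IsCoadjointOrbit {n : ℕ} (G : Subgroup (Matrix.unitaryGroup (Fin n) ℂ))
    (v : Fin n → ℂ) (d : ℕ) : Prop where
  isClosed : IsClosed (G : Set (Matrix.unitaryGroup (Fin n) ℂ))
  ne_zero : v ≠ 0
  isConnected : IsConnected (orbitCone G v)
  isComplexSubmanifold : IsComplexSubmanifold (d + 1) (orbitCone G v)
  span_eq_top : Submodule.span ℂ (orbitCone G v) = ⊤

end

/-! Let `X` be the cone over the orbit, `v` a unit vector in it, `T` the tangent space of `X` at
`v`, and `t(g) = |⟨v, gv⟩|²`. The quotient module is graded, and its degree-`m` part `H_m` is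
spanned by the kernels `K_m(x)`, `x ∈ X`, with `⟨K_m x, K_m y⟩ = ⟨y, x⟩^m`. Haar averages of these
kernels differ from a multiple of `⟨y, x⟩^m` by a function that is holomorphic in `x`,
antiholomorphic in `y`, and zero on the diagonal by invariance. Polarization kills it
(`IsKahlerOrbit.integral_inner_pow`). So the kernels form a tight frame of `H_m` with constant `a_m
= ∫ t^m`, and `dim H_m = 1 / a_m`.

Growth of the dimension: differentiating the reproducing identity along `T` gives `∫ t^m ‖P_T gv‖² =
a_{m+1} (d + 1 + m) / (m + 1)`, while the normal part of `gv` is `O(1 - t)`, because `X` leaves its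
tangent space to second order. The resulting recursion for `a_m` is collected in `IsMomentSequence`.
Together with log-convexity and the absence of exponential decay it forces `a_m` to be of order
`m^{-d}`.

Upper bound: up to a factor `a_m²` and an error `(a_m - a_{m+1})²`, the commutator on `H_m` is an
integral operator whose kernel is bounded by a multiple of `t^j (1 - t)`. A Schur test makes its
norm `O(1/m)` (`exists_norm_mulCommutator_le`).

Lower bound: the diagonal matrix element at `K_m(gv)` is `σ(g) / (m + 1) + O(1/m²)`, where the
symbol `σ(g)` compares the projections of the two coordinate vectors to the tangent space and to the
line at `gv`. If `σ` is not identically zero, the squared Hilbert–Schmidt norm on `H_m` is at least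
of order `dim H_m / m²` (`exists_le_sum_norm_mulCommutator_sq`).

The symbol does not vanish identically: polarizing `σ = 0` at a point where `|⟨p, x⟩| / ‖x‖` is
maximal on `X` shows that `q` spans the line of that point. This is impossible for `p ⟂ q`, and for
`p = q` it would put the whole cone in one line.

An operator of size `1/m` in these two senses on spaces of dimension about `m^d` has `Tr |T|^p`
comparable with `∑ m^{d-p}` when `p ≥ 2`, while for `p ≤ 2` the trace diverges because `d ≥ 1`
(`isSchatten_iff_of_graded`). -/

open Metric Set

/-! ### Holomorphic maps in several variables: Cauchy estimates, smoothness, polarization. -/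

/-- Cauchy's estimate on the complex line through `y` in direction `h`. The circle of radius `ρ /
(2‖h‖)` stays inside the open ball, which is the source of the factor 2. -/
theorem norm_fderiv_le_of_ball {E F : Type*} [NormedAddCommGroup E] [NormedSpace ℂ E]
    [NormedAddCommGroup F] [NormedSpace ℂ F] {f : E → F} {y : E} {ρ M : ℝ} (hρ : 0 < ρ)
    (hf : DifferentiableOn ℂ f (ball y ρ)) (hM : ∀ x ∈ ball y ρ, ‖f x‖ ≤ M) :
    ‖fderiv ℂ f y‖ ≤ 2 * M / ρ := by
  have hM0 : 0 ≤ M := (norm_nonneg _).trans (hM y (mem_ball_self hρ))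
  refine ContinuousLinearMap.opNorm_le_bound _ (by positivity) fun h => ?_
  rcases eq_or_ne h 0 with rfl | hh
  · simp
  have hh' : 0 < ‖h‖ := norm_pos_iff.2 hh
  have hR : 0 < ρ / (2 * ‖h‖) := by positivity
  have hmem : ∀ z ∈ closedBall (0 : ℂ) (ρ / (2 * ‖h‖)), y + z • h ∈ ball y ρ := by
    intro z hz
    rw [mem_closedBall_zero_iff] at hz
    rw [mem_ball_iff_norm, add_sub_cancel_left, norm_smul]
    calc ‖z‖ * ‖h‖ ≤ ρ / (2 * ‖h‖) * ‖h‖ := by gcongr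
      _ = ρ / 2 := by field_simp
      _ < ρ := by linarith
  have hline : ∀ z : ℂ, HasDerivAt (fun z : ℂ => y + z • h) h z := fun z => by
    simpa using ((hasDerivAt_id z).smul_const h).const_add y
  have hd : DifferentiableOn ℂ (fun z : ℂ => f (y + z • h)) (closedBall 0 (ρ / (2 * ‖h‖))) := by
    intro z hz
    exact ((hf.differentiableAt (isOpen_ball.mem_nhds (hmem z hz))).comp z
      (hline z).differentiableAt).differentiableWithinAt
  have h1 := Complex.norm_deriv_le_of_forall_mem_sphere_norm_le hR
    (hd.diffContOnCl_ball subset_rfl) (fun z hz => hM _ (hmem z (sphere_subset_closedBall hz)))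
  have h2 : HasDerivAt (fun z : ℂ => f (y + z • h)) (fderiv ℂ f y h) 0 := by
    have := (hf.differentiableAt (isOpen_ball.mem_nhds (mem_ball_self hρ))).hasFDerivAt
    have h3 : HasFDerivAt f (fderiv ℂ f y) (y + (0 : ℂ) • h) := by simpa using this
    exact h3.comp_hasDerivAt 0 (hline 0)
  rw [h2.deriv] at h1
  refine h1.trans (le_of_eq ?_)
  field_simp

/-- Cauchy's formula writes the directional derivative as an integral of `f (x + z • h) / z²` over
the unit circle, and `x` enters it holomorphically, so one differentiates under the integral sign.
The bound on `h` keeps the circle inside the ball for all `x` near `x₀`. -/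
theorem differentiableAt_fderiv_apply_of_ball {E F : Type*} [NormedAddCommGroup E]
    [NormedSpace ℂ E] [FiniteDimensional ℂ E] [NormedAddCommGroup F] [NormedSpace ℂ F]
    [FiniteDimensional ℂ F] {f : E → F} {x₀ : E} {R : ℝ} (hR : 0 < R)
    (hf : DifferentiableOn ℂ f (ball x₀ R)) {h : E} (hh : ‖h‖ < R / 4) :
    DifferentiableAt ℂ (fun x => fderiv ℂ f x h) x₀ := by
  have : CompleteSpace E := FiniteDimensional.complete ℂ E
  have : CompleteSpace F := FiniteDimensional.complete ℂ F
  have : ProperSpace E := FiniteDimensional.proper ℂ E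
  have : ProperSpace (E →L[ℂ] F) := FiniteDimensional.proper ℂ _
  have hsub : ∀ x ∈ ball x₀ (R / 4), ∀ z : ℂ, ‖z‖ ≤ 1 → x + z • h ∈ ball x₀ (R / 2) := by
    intro x hx z hz
    rw [mem_ball_iff_norm] at hx ⊢
    calc ‖x + z • h - x₀‖ = ‖(x - x₀) + z • h‖ := by congr 1; abel
      _ ≤ ‖x - x₀‖ + ‖z • h‖ := norm_add_le _ _
      _ ≤ ‖x - x₀‖ + 1 * ‖h‖ := by rw [norm_smul]; gcongr
      _ < R / 2 := by linarith
  have hbb : ball x₀ (R / 2) ⊆ ball x₀ R := ball_subset_ball (by linarith)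
  obtain ⟨M, hM⟩ : ∃ M, ∀ x ∈ closedBall x₀ (3 * R / 4), ‖f x‖ ≤ M := by
    refine (isCompact_closedBall x₀ (3 * R / 4)).exists_bound_of_continuousOn ?_
    exact hf.continuousOn.mono (closedBall_subset_ball (by linarith))
  -- The dominating constant: balls of radius `R / 4` around these points lie in the compact ball of
  -- radius `3R / 4`, where `f` is bounded.
  have hD : ∀ y ∈ ball x₀ (R / 2), ‖fderiv ℂ f y‖ ≤ 2 * M / (R / 4) := by
    intro y hy
    have hy' : ball y (R / 4) ⊆ closedBall x₀ (3 * R / 4) :=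
      (ball_subset_ball' (by rw [mem_ball] at hy; linarith)).trans ball_subset_closedBall
    refine norm_fderiv_le_of_ball (by linarith)
      (hf.mono (hy'.trans (closedBall_subset_ball (by linarith)))) fun x hx => hM x (hy' hx)
  have hline : ∀ x, ∀ z : ℂ, HasDerivAt (fun z : ℂ => x + z • h) h z := fun x z => by
    simpa using ((hasDerivAt_id z).smul_const h).const_add x
  have hfd : ∀ y ∈ ball x₀ (R / 2), HasFDerivAt f (fderiv ℂ f y) y := fun y hy =>
    (hf.differentiableAt (isOpen_ball.mem_nhds (hbb hy))).hasFDerivAt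
  have hform : ∀ x ∈ ball x₀ (R / 4), fderiv ℂ f x h =
      (2 * Real.pi * Complex.I : ℂ)⁻¹ • ∮ z in C(0, 1), (1 / (z - 0) ^ 2) • f (x + z • h) := by
    intro x hx
    have hd : DifferentiableOn ℂ (fun z : ℂ => f (x + z • h)) (closedBall 0 1) := by
      intro z hz
      rw [mem_closedBall_zero_iff] at hz
      exact ((hfd _ (hsub x hx z hz)).differentiableAt.comp z
        (hline x z).differentiableAt).differentiableWithinAt
    have h2 : HasDerivAt (fun z : ℂ => f (x + z • h)) (fderiv ℂ f x h) 0 := by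
      have h3 : HasFDerivAt f (fderiv ℂ f x) (x + (0 : ℂ) • h) := by
        simpa using hfd _ (by simpa using hsub x hx 0 (by simp))
      exact h3.comp_hasDerivAt 0 (hline x 0)
    rw [← h2.deriv, hd.deriv_eq_smul_circleIntegral one_pos, smul_smul, inv_mul_cancel₀, one_smul]
    simp [Real.pi_ne_zero]
  have hev : (fun x => fderiv ℂ f x h) =ᶠ[nhds x₀] fun x =>
      (2 * Real.pi * Complex.I : ℂ)⁻¹ • ∮ z in C(0, 1), (1 / (z - 0) ^ 2) • f (x + z • h) :=
    Filter.eventuallyEq_of_mem (ball_mem_nhds x₀ (by linarith)) hform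
  refine DifferentiableAt.congr_of_eventuallyEq ?_ hev
  refine DifferentiableAt.const_smul ?_ _
  unfold circleIntegral
  have hc : ∀ θ : ℝ, ‖circleMap 0 1 θ‖ ≤ 1 := fun θ => by simp
  let _ : MeasurableSpace E := borel E
  have : BorelSpace E := ⟨rfl⟩
  have hker : Continuous fun θ : ℝ =>
      deriv (circleMap 0 1) θ • (1 / (circleMap 0 1 θ - 0) ^ 2) := by
    simp only [deriv_circleMap]
    refine Continuous.smul ((continuous_circleMap 0 1).mul continuous_const) ?_
    refine Continuous.div continuous_const (((continuous_circleMap 0 1).sub continuous_const).pow 2)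
      fun θ => ?_
    simp
  have hcont : ∀ x ∈ ball x₀ (R / 4), Continuous fun θ : ℝ =>
      deriv (circleMap 0 1) θ • ((1 / (circleMap 0 1 θ - 0) ^ 2) • f (x + circleMap 0 1 θ • h)) := by
    intro x hx
    simp only [smul_smul]
    simp only [smul_eq_mul] at hker
    refine hker.smul ?_
    refine hf.continuousOn.comp_continuous (by fun_prop) fun θ => hbb (hsub x hx _ (hc θ))
  refine (intervalIntegral.hasFDerivAt_integral_of_dominated_of_fderiv_le (𝕜 := ℂ) (s := ball x₀ (R / 4))
    (bound := fun _ => 2 * M / (R / 4)) (F' := fun x θ => deriv (circleMap 0 1) θ •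
      ((1 / (circleMap 0 1 θ - 0) ^ 2) • fderiv ℂ f (x + circleMap 0 1 θ • h)))
    (ball_mem_nhds x₀ (by linarith)) ?_ ?_ ?_ ?_ ?_ ?_).differentiableAt
  · filter_upwards [ball_mem_nhds x₀ (show 0 < R / 4 by linarith)] with x hx
    exact (hcont x hx).aestronglyMeasurable
  · exact (hcont x₀ (mem_ball_self (by linarith))).intervalIntegrable _ _
  · simp only [smul_smul]
    refine MeasureTheory.AEStronglyMeasurable.smul hker.aestronglyMeasurable ?_
    let _ : MeasurableSpace (E →L[ℂ] F) := borel _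
    have : BorelSpace (E →L[ℂ] F) := ⟨rfl⟩
    refine Measurable.aestronglyMeasurable ?_
    exact (measurable_fderiv ℂ f).comp (Continuous.measurable (by fun_prop))
  · refine Filter.Eventually.of_forall fun θ _ x hx => ?_
    rw [norm_smul, norm_smul]
    simpa using hD _ (hsub x hx _ (hc θ))
  · exact intervalIntegrable_const
  · refine Filter.Eventually.of_forall fun θ _ x hx => ?_
    refine HasFDerivAt.const_smul (HasFDerivAt.const_smul ?_ _) _
    have h4 : HasFDerivAt (fun x : E => x + circleMap 0 1 θ • h) (ContinuousLinearMap.id ℂ E) x :=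
      (hasFDerivAt_id x).add_const _
    have h5 := (hfd _ (hsub x hx _ (hc θ))).comp x h4
    rwa [ContinuousLinearMap.comp_id] at h5

/-- Holomorphic maps between finite-dimensional spaces are smooth. -/
theorem DifferentiableOn.contDiffOn_of_finiteDimensional {E F : Type*} [NormedAddCommGroup E]
    [NormedSpace ℂ E] [FiniteDimensional ℂ E] [NormedAddCommGroup F] [NormedSpace ℂ F]
    [FiniteDimensional ℂ F] {U : Set E} (hU : IsOpen U) (k : ℕ) :
    ∀ {f : E → F}, DifferentiableOn ℂ f U → ContDiffOn ℂ k f U := by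
  induction k with
  | zero => exact fun hf => by simpa using hf.continuousOn
  | succ k ih =>
    intro f hf
    rw [Nat.cast_succ, contDiffOn_succ_iff_fderiv_of_isOpen hU]
    refine ⟨hf, by simp, contDiffOn_clm_apply.2 fun h => ih fun x hx => ?_⟩
    obtain ⟨R, hR, hRU⟩ := Metric.isOpen_iff.1 hU x hx
    -- The derivative is linear in the direction, so `h` may be rescaled to meet the size
    -- restriction; `c⁻¹` undoes this afterwards.
    obtain ⟨c, hc, hch⟩ : ∃ c : ℂ, c ≠ 0 ∧ ‖c • h‖ < R / 4 := by
      refine ⟨((R / (8 * (‖h‖ + 1)) : ℝ) : ℂ), by norm_cast; positivity, ?_⟩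
      rw [norm_smul, Complex.norm_real, Real.norm_of_nonneg (by positivity)]
      have h1 : ‖h‖ / (‖h‖ + 1) < 1 := by rw [div_lt_one (by positivity)]; linarith
      calc R / (8 * (‖h‖ + 1)) * ‖h‖ = R / 8 * (‖h‖ / (‖h‖ + 1)) := by field_simp
        _ < R / 4 := by nlinarith
    have h2 := (differentiableAt_fderiv_apply_of_ball hR (hf.mono hRU) hch).const_smul c⁻¹
    refine DifferentiableAt.differentiableWithinAt ?_
    convert h2 using 1
    ext x
    simp [hc]

/-- A function of `(s, t)` that is holomorphic in both variables and vanishes for `t = conj s`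
vanishes identically. -/
theorem eq_zero_of_eq_zero_on_conj {G : ℂ × ℂ → ℂ} {r : ℝ}
    (hG : DifferentiableOn ℂ G (ball 0 r ×ˢ ball 0 r))
    (h0 : ∀ s ∈ ball (0 : ℂ) r, G (s, (starRingEnd ℂ) s) = 0) :
    ∀ s ∈ ball (0 : ℂ) (r / 2), ∀ t ∈ ball (0 : ℂ) (r / 2), G (s, t) = 0 := by
  intro s hs t ht
  simp only [mem_ball_zero_iff] at hs ht
  have hr : 0 < r := by linarith [norm_nonneg s]
  -- In the coordinates `s = p + iq`, `t = p - iq` the set `t = conj s` is the real plane. Vanishing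
  -- for real `p, q` spreads first to complex `q`, then to complex `p`, by the one-variable identity
  -- theorem.
  have hmem : ∀ p ∈ ball (0 : ℂ) (r / 2), ∀ q ∈ ball (0 : ℂ) (r / 2),
      (p + q * Complex.I, p - q * Complex.I) ∈ ball (0 : ℂ) r ×ˢ ball (0 : ℂ) r := by
    intro p hp q hq
    simp only [mem_ball_zero_iff] at hp hq
    simp only [mem_prod, mem_ball_zero_iff]
    have := norm_add_le p (q * Complex.I)
    have := norm_sub_le p (q * Complex.I)
    simp only [norm_mul, Complex.norm_I, mul_one] at *
    constructor <;> linarith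
  have hopen : IsOpen (ball (0 : ℂ) r ×ˢ ball (0 : ℂ) r) := isOpen_ball.prod isOpen_ball
  have hd : ∀ p ∈ ball (0 : ℂ) (r / 2), ∀ q ∈ ball (0 : ℂ) (r / 2),
      DifferentiableAt ℂ G (p + q * Complex.I, p - q * Complex.I) := fun p hp q hq =>
    hG.differentiableAt (hopen.mem_nhds (hmem p hp q hq))
  have key : ∀ F : ℂ → ℂ, DifferentiableOn ℂ F (ball 0 (r / 2)) →
      (∀ x : ℝ, |x| < r / 2 → F x = 0) → ∀ z ∈ ball (0 : ℂ) (r / 2), F z = 0 := by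
    intro F hF hF0 z hz
    have han := hF.analyticOnNhd isOpen_ball
    refine han.eqOn_zero_of_preconnected_of_frequently_eq_zero
      (convex_ball 0 (r / 2)).isPreconnected (mem_ball_self (half_pos hr)) ?_ hz
    have hcast : Filter.Tendsto (fun x : ℝ => (x : ℂ)) (nhdsWithin 0 {0}ᶜ) (nhdsWithin 0 {0}ᶜ) := by
      refine tendsto_nhdsWithin_iff.2 ⟨?_, ?_⟩
      · exact (Complex.continuous_ofReal.tendsto' 0 0 (by simp)).mono_left nhdsWithin_le_nhds
      · filter_upwards [self_mem_nhdsWithin] with x hx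
        simpa using hx
    refine hcast.frequently (Filter.Eventually.frequently ?_)
    have : ∀ᶠ x : ℝ in nhds 0, |x| < r / 2 := by
      have := Metric.ball_mem_nhds (0 : ℝ) (half_pos hr)
      filter_upwards [this] with x hx
      simpa using hx
    filter_upwards [nhdsWithin_le_nhds this] with x hx using hF0 x hx
  have hreal : ∀ x : ℝ, |x| < r / 2 → (x : ℂ) ∈ ball (0 : ℂ) (r / 2) := fun x hx => by
    simpa using hx
  have step1 : ∀ x : ℝ, |x| < r / 2 → ∀ q ∈ ball (0 : ℂ) (r / 2),
      G (x + q * Complex.I, x - q * Complex.I) = 0 := by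
    intro x hx
    refine key (fun q => G (x + q * Complex.I, x - q * Complex.I)) (fun q hq => ?_) fun y hy => ?_
    · refine DifferentiableAt.differentiableWithinAt ?_
      exact (hd x (hreal x hx) q hq).comp q
        (f := fun q : ℂ => ((x : ℂ) + q * Complex.I, (x : ℂ) - q * Complex.I)) (by fun_prop)
    · have := h0 (x + y * Complex.I) (hmem x (hreal x hx) y (hreal y hy)).1
      simpa [sub_eq_add_neg] using this
  have step2 : ∀ q ∈ ball (0 : ℂ) (r / 2), ∀ p ∈ ball (0 : ℂ) (r / 2),
      G (p + q * Complex.I, p - q * Complex.I) = 0 := by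
    intro q hq
    refine key (fun p => G (p + q * Complex.I, p - q * Complex.I)) (fun p hp => ?_)
      fun y hy => step1 y hy q hq
    refine DifferentiableAt.differentiableWithinAt ?_
    exact (hd p hp q hq).comp p
      (f := fun p : ℂ => (p + q * Complex.I, p - q * Complex.I)) (by fun_prop)
  have hq : ‖(s - t) / (2 * Complex.I)‖ < r / 2 := by
    have := norm_sub_le s t
    simp only [norm_div, norm_mul, Complex.norm_I, mul_one, Complex.norm_ofNat]
    linarith
  have hp : ‖(s + t) / 2‖ < r / 2 := by
    have := norm_add_le s t
    simp only [norm_div, Complex.norm_ofNat]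
    linarith
  have := step2 ((s - t) / (2 * Complex.I)) (by simpa using hq) ((s + t) / 2) (by simpa using hp)
  convert this using 3
  · field_simp; ring
  · field_simp; ring

/-! ### Holomorphic local retractions onto a complex submanifold. -/

open Metric Set Filter Topology

/-- `φ` is a holomorphic retraction of the ball of radius `r` around `v` to `X`, along the
orthogonal complement of the tangent space `T` of `X` at `v`. -/
structure IsLocalRetraction {E : Type*} [NormedAddCommGroup E] [InnerProductSpace ℂ E]
    [FiniteDimensional ℂ E] (X : Set E) (v : E) (T : Submodule ℂ E) (φ : E → E) (r : ℝ) :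
    Prop where
  pos : 0 < r
  contDiffOn : ContDiffOn ℂ 2 φ (ball v r)
  mapsTo : ∀ x ∈ ball v r, φ x ∈ X
  fixes : ∀ x ∈ ball v r, x ∈ X → φ x = x
  proj : ∀ x ∈ ball v r, T.starProjection (φ x) = T.starProjection x
  tangent : ∀ η, fderiv ℂ φ v η ∈ T
  mem : v ∈ T
  mem_set : v ∈ X
  apply_proj : ∀ x, φ (T.starProjection x) = φ x

theorem HasDerivAt.mem_submodule {F : Type*} [NormedAddCommGroup F] [NormedSpace ℂ F]
    [FiniteDimensional ℂ F] {γ : ℂ → F} {γ' : F} {z : ℂ} (L : Submodule ℂ F)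
    (hγ : HasDerivAt γ γ' z) (hL : ∀ᶠ s in 𝓝 z, γ s ∈ L) : γ' ∈ L := by
  have h1 := hasDerivAt_iff_tendsto_slope.1 hγ
  refine L.closed_of_finiteDimensional.mem_of_tendsto h1 ?_
  filter_upwards [nhdsWithin_le_nhds hL] with s hs
  rw [slope_def_module]
  exact L.smul_mem _ (L.sub_mem hs hL.self_of_nhds)

/-- Near `v` the set `X` is a graph over its tangent space. With `T` the image of `L` under the
derivative of the inverse chart, the inverse chart on `L` followed by projection to `T` has
invertible derivative. The inverse function theorem inverts it, and `φ x` is the point of `X` above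
the projection of `x`. -/
theorem exists_isLocalRetraction {E F : Type*} [NormedAddCommGroup E] [InnerProductSpace ℂ E]
    [FiniteDimensional ℂ E] [NormedAddCommGroup F] [NormedSpace ℂ F] [FiniteDimensional ℂ F]
    {X : Set E} {v : E} (hv : v ∈ X) (hcone : ∀ x ∈ X, ∀ c : ℂ, c ≠ 0 → c • x ∈ X)
    (e : OpenPartialHomeomorph E F) (L : Submodule ℂ F) (hve : v ∈ e.source)
    (he : DifferentiableOn ℂ e e.source) (hes : DifferentiableOn ℂ e.symm e.target)
    (hX : ∀ y ∈ e.source, y ∈ X ↔ e y ∈ L) :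
    ∃ (T : Submodule ℂ E) (φ : E → E) (r : ℝ),
      Module.finrank ℂ T = Module.finrank ℂ L ∧ IsLocalRetraction X v T φ r := by
  have : CompleteSpace E := FiniteDimensional.complete ℂ E
  have : CompleteSpace F := FiniteDimensional.complete ℂ F
  have hevt : e v ∈ e.target := e.map_source hve
  have hD' : HasFDerivAt e (fderiv ℂ e v) v :=
    (he.differentiableAt (e.open_source.mem_nhds hve)).hasFDerivAt
  have hD : HasFDerivAt e.symm (fderiv ℂ e.symm (e v)) (e v) :=
    (hes.differentiableAt (e.open_target.mem_nhds hevt)).hasFDerivAt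
  set D' := fderiv ℂ e v
  set D := fderiv ℂ e.symm (e v)
  have hDD' : ∀ x, D (D' x) = x := by
    have h1 : HasFDerivAt (e.symm ∘ e) (D.comp D') v := hD.comp v hD'
    have h2 : HasFDerivAt (e.symm ∘ e) (ContinuousLinearMap.id ℂ E) v := by
      refine (hasFDerivAt_id v).congr_of_eventuallyEq ?_
      filter_upwards [e.open_source.mem_nhds hve] with x hx using e.left_inv hx
    intro x
    exact DFunLike.congr_fun (h1.unique h2) x
  have hD'D : ∀ x, D' (D x) = x := by
    have h1 : HasFDerivAt (e ∘ e.symm) (D'.comp D) (e v) := by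
      refine HasFDerivAt.comp (e v) ?_ hD
      rwa [e.left_inv hve]
    have h2 : HasFDerivAt (e ∘ e.symm) (ContinuousLinearMap.id ℂ F) (e v) := by
      refine (hasFDerivAt_id _).congr_of_eventuallyEq ?_
      filter_upwards [e.open_target.mem_nhds hevt] with x hx using e.right_inv hx
    intro x
    exact DFunLike.congr_fun (h1.unique h2) x
  have hinj : Function.Injective D := Function.LeftInverse.injective hD'D
  set T : Submodule ℂ E := L.map D.toLinearMap with hT
  have hfin : Module.finrank ℂ T = Module.finrank ℂ L :=
    (Submodule.equivMapOfInjective D.toLinearMap hinj L).finrank_eq.symm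
  have hevL : e v ∈ L := (hX v hve).1 hv
  -- The curve `s ↦ s • v` stays in the cone, so its velocity `v` is tangent.
  have hvT : v ∈ T := by
    have h1 : HasDerivAt (fun s : ℂ => e (s • v)) (D' v) 1 := by
      have h2 : HasDerivAt (fun s : ℂ => s • v) v 1 := by
        simpa using (hasDerivAt_id (1 : ℂ)).smul_const v
      have h3 : HasFDerivAt e D' ((1 : ℂ) • v) := by rwa [one_smul]
      exact h3.comp_hasDerivAt 1 h2
    have h2 : D' v ∈ L := by
      refine h1.mem_submodule L ?_
      have h3 : ∀ᶠ s : ℂ in 𝓝 1, s • v ∈ e.source := by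
        have : ContinuousAt (fun s : ℂ => s • v) 1 := by fun_prop
        exact this (e.open_source.mem_nhds (by simpa using hve))
      filter_upwards [h3, isOpen_ne.mem_nhds (one_ne_zero (α := ℂ))] with s hs hs0
      exact (hX _ hs).1 (hcone v hv s hs0)
    exact ⟨D' v, h2, hDD' v⟩
  -- the projection of the chart to the tangent space
  set l₀ : L := ⟨e v, hevL⟩ with hl₀
  set Ψ : L → T := fun l => T.orthogonalProjectionOnto (e.symm (l : F)) with hΨdef
  have hs2 : ContDiffAt ℂ 2 e.symm (e v) :=
    (hes.contDiffOn_of_finiteDimensional e.open_target 2).contDiffAt (e.open_target.mem_nhds hevt)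
  have hΨ2 : ContDiffAt ℂ 2 Ψ l₀ := by
    refine T.orthogonalProjectionOnto.contDiff.contDiffAt.comp l₀ ?_
    exact ContDiffAt.comp l₀ (g := e.symm) (f := fun l : L => (l : F)) hs2
      L.subtypeL.contDiff.contDiffAt
  let A : L →ₗ[ℂ] T := T.orthogonalProjectionOnto.toLinearMap ∘ₗ D.toLinearMap ∘ₗ L.subtype
  have hA : Function.Injective A := by
    intro x y hxy
    have h1 : ∀ z : L, A z = ⟨D z, ⟨z, z.2, rfl⟩⟩ := fun z =>
      T.orthogonalProjectionOnto_mem_subspace_eq_self ⟨D z, ⟨z, z.2, rfl⟩⟩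
    rw [h1, h1] at hxy
    exact Subtype.ext (hinj (congrArg Subtype.val hxy))
  let A' : L ≃L[ℂ] T := (A.linearEquivOfInjective hA hfin.symm).toContinuousLinearEquiv
  have hΨ' : HasFDerivAt Ψ (A' : L →L[ℂ] T) l₀ := by
    have h1 : HasFDerivAt Ψ (T.orthogonalProjectionOnto ∘L D ∘L L.subtypeL) l₀ := by
      refine T.orthogonalProjectionOnto.hasFDerivAt.comp l₀ ?_
      exact HasFDerivAt.comp l₀ (g := e.symm) (f := fun l : L => (l : F)) hD
        L.subtypeL.hasFDerivAt
    exact h1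
  let Θ := hΨ2.toOpenPartialHomeomorph Ψ hΨ' two_ne_zero
  have hΘ : ∀ l, Θ l = Ψ l := fun l => rfl
  have hl₀Θ : l₀ ∈ Θ.source := hΨ2.mem_toOpenPartialHomeomorph_source hΨ' two_ne_zero
  have hΨl₀ : Ψ l₀ = T.orthogonalProjectionOnto v := by
    simp only [hΨdef, hl₀]
    rw [e.left_inv hve]
  have hvΘ : T.orthogonalProjectionOnto v ∈ Θ.target := by
    rw [← hΨl₀]
    exact hΨ2.image_mem_toOpenPartialHomeomorph_target hΨ' two_ne_zero
  have hΘs : Θ.symm (T.orthogonalProjectionOnto v) = l₀ := by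
    rw [← hΨl₀]
    exact Θ.left_inv hl₀Θ
  have hΘ2 : ContDiffAt ℂ 2 Θ.symm (T.orthogonalProjectionOnto v) := by
    have := hΨ2.to_localInverse hΨ' two_ne_zero
    rwa [hΨl₀] at this
  have hκ2 : ContDiffAt ℂ 2 (fun x => Θ.symm (T.orthogonalProjectionOnto x)) v :=
    ContDiffAt.comp v hΘ2 T.orthogonalProjectionOnto.contDiff.contDiffAt
  set φ : E → E := fun x => e.symm (Θ.symm (T.orthogonalProjectionOnto x) : F) with hφ
  have hκF : ContDiffAt ℂ 2 (fun x => (Θ.symm (T.orthogonalProjectionOnto x) : F)) v :=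
    L.subtypeL.contDiff.contDiffAt.comp v hκ2
  have hφ2 : ContDiffAt ℂ 2 φ v := by
    refine ContDiffAt.comp v (g := e.symm) ?_ hκF
    rwa [hΘs]
  have ev1 : ∀ᶠ x in 𝓝 v, ContDiffAt ℂ 2 φ x := hφ2.eventually (by simp)
  have ev2 : ∀ᶠ x in 𝓝 v, T.orthogonalProjectionOnto x ∈ Θ.target :=
    T.orthogonalProjectionOnto.continuous.continuousAt (Θ.open_target.mem_nhds hvΘ)
  have ev3 : ∀ᶠ x in 𝓝 v, (Θ.symm (T.orthogonalProjectionOnto x) : F) ∈ e.target :=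
    hκF.continuousAt (e.open_target.mem_nhds (by simp only [hΘs]; exact hevt))
  have ev4 : ∀ᶠ x in 𝓝 v, x ∈ e.source := e.open_source.mem_nhds hve
  -- Needed for `φ` to fix points of `X`: their chart coordinates must lie where the local inverse
  -- is defined, a condition open in the subspace topology of `L`.
  have ev5 : ∀ᶠ x in 𝓝 v, ∀ h : e x ∈ L, (⟨e x, h⟩ : L) ∈ Θ.source := by
    obtain ⟨O, hO, hOs⟩ := isOpen_induced_iff.1 Θ.open_source
    have h1 : e v ∈ O := by
      have : l₀ ∈ Subtype.val ⁻¹' O := by rw [hOs]; exact hl₀Θ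
      exact this
    filter_upwards [(e.continuousAt hve) (hO.mem_nhds h1)] with x hx h
    rw [← hOs]
    exact hx
  obtain ⟨r, hr, hball⟩ := Metric.eventually_nhds_iff_ball.1
    (ev1.and (ev2.and (ev3.and (ev4.and ev5))))
  refine ⟨T, φ, r, hfin, ⟨hr, fun x hx => (hball x hx).1.contDiffWithinAt, fun x hx => ?_,
    fun x hx hxX => ?_, fun x hx => ?_, fun η => ?_, hvT, hv, fun x => ?_⟩⟩
  · obtain ⟨-, -, h3, -⟩ := hball x hx
    rw [hX _ (e.map_target h3)]
    rw [e.right_inv h3]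
    exact Submodule.coe_mem _
  · obtain ⟨-, -, -, h4, h5⟩ := hball x hx
    have h6 : e x ∈ L := (hX x h4).1 hxX
    have h7 : T.orthogonalProjectionOnto x = Θ ⟨e x, h6⟩ := by
      rw [hΘ]
      simp only [hΨdef]
      rw [e.left_inv h4]
    change e.symm (Θ.symm (T.orthogonalProjectionOnto x) : F) = x
    rw [h7, Θ.left_inv (h5 h6)]
    exact e.left_inv h4
  · obtain ⟨-, h2, -⟩ := hball x hx
    rw [Submodule.starProjection_apply, Submodule.starProjection_apply]
    exact congrArg Subtype.val (Θ.right_inv h2)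
  · have h1 : HasFDerivAt φ (D ∘L L.subtypeL ∘L
        fderiv ℂ (fun x => Θ.symm (T.orthogonalProjectionOnto x)) v) v := by
      refine HasFDerivAt.comp v (g := e.symm) ?_ (L.subtypeL.hasFDerivAt.comp v
        (hκ2.differentiableAt two_ne_zero).hasFDerivAt)
      simpa [hΘs] using hD
    rw [h1.fderiv]
    exact ⟨_, Submodule.coe_mem _, rfl⟩
  · have h1 : T.orthogonalProjectionOnto (T.starProjection x) = T.orthogonalProjectionOnto x :=
      T.orthogonalProjectionOnto_mem_subspace_eq_self _
    simp only [hφ, h1]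

namespace IsLocalRetraction

variable {E : Type*} [NormedAddCommGroup E] [InnerProductSpace ℂ E]
    [FiniteDimensional ℂ E] {X : Set E} {v : E} {T : Submodule ℂ E} {φ : E → E} {r : ℝ}

theorem apply_self (h : IsLocalRetraction X v T φ r) : φ v = v :=
  h.fixes v (mem_ball_self h.pos) h.mem_set

theorem contDiffAt (h : IsLocalRetraction X v T φ r) {x : E} (hx : x ∈ ball v r) :
    ContDiffAt ℂ 2 φ x :=
  h.contDiffOn.contDiffAt (isOpen_ball.mem_nhds hx)

theorem hasFDerivAt (h : IsLocalRetraction X v T φ r) {x : E} (hx : x ∈ ball v r) :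
    HasFDerivAt φ (fderiv ℂ φ x) x :=
  ((h.contDiffAt hx).differentiableAt two_ne_zero).hasFDerivAt

theorem starProjection_fderiv (h : IsLocalRetraction X v T φ r) {x : E} (hx : x ∈ ball v r)
    (η : E) : T.starProjection (fderiv ℂ φ x η) = T.starProjection η := by
  have h1 := T.starProjection.hasFDerivAt.comp x (h.hasFDerivAt hx)
  have h2 : HasFDerivAt (T.starProjection ∘ φ) T.starProjection x := by
    refine T.starProjection.hasFDerivAt.congr_of_eventuallyEq ?_
    filter_upwards [isOpen_ball.mem_nhds hx] with y hy using h.proj y hy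
  exact DFunLike.congr_fun (h1.unique h2) η

theorem fderiv_self (h : IsLocalRetraction X v T φ r) {η : E} (hη : η ∈ T) :
    fderiv ℂ φ v η = η := by
  have h1 := h.starProjection_fderiv (mem_ball_self h.pos) η
  rwa [Submodule.starProjection_eq_self_iff.2 hη,
    Submodule.starProjection_eq_self_iff.2 (h.tangent η)] at h1

/-- The deviation of `X` from its tangent space is quadratic. -/
theorem exists_norm_sub_le (h : IsLocalRetraction X v T φ r) :
    ∃ C ε : ℝ, 0 < ε ∧ ∀ x ∈ ball v ε, x ∈ X →
      ‖x - T.starProjection x‖ ≤ C * ‖x - v‖ ^ 2 := by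
  -- The normal component of `φ` has zero derivative at `v`. Being `C²`, it has a derivative that is
  -- Lipschitz near `v`, and the mean value inequality on the segment from `v` to `x` yields the
  -- square.
  set f : E → E := fun x => φ x - T.starProjection (φ x) with hf
  have hd : ∀ x ∈ ball v r, HasFDerivAt f
      (fderiv ℂ φ x - T.starProjection ∘L fderiv ℂ φ x) x := fun x hx =>
    (h.hasFDerivAt hx).sub (T.starProjection.hasFDerivAt.comp x (h.hasFDerivAt hx))
  have hv0 : fderiv ℂ f v = 0 := by
    rw [(hd v (mem_ball_self h.pos)).fderiv]
    ext η
    simp [Submodule.starProjection_eq_self_iff.2 (h.tangent η)]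
  have hc : ContDiffAt ℂ 2 f v :=
    (h.contDiffAt (mem_ball_self h.pos)).sub
      (T.starProjection.contDiff.contDiffAt.comp v (h.contDiffAt (mem_ball_self h.pos)))
  have hc1 : ContDiffAt ℂ 1 (fderiv ℂ f) v := hc.fderiv_right (by norm_num)
  obtain ⟨K, t, ht, hLip⟩ := hc1.exists_lipschitzOnWith
  obtain ⟨ε, hε, hεt⟩ := Metric.mem_nhds_iff.1 (inter_mem ht (ball_mem_nhds v h.pos))
  refine ⟨K, ε, hε, fun x hx hxX => ?_⟩
  have hseg : segment ℝ v x ⊆ ball v ε ∩ closedBall v ‖x - v‖ := by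
    refine ((convex_ball v ε).inter (convex_closedBall v ‖x - v‖)).segment_subset ?_ ?_
    · exact ⟨mem_ball_self hε, mem_closedBall_self (norm_nonneg _)⟩
    · exact ⟨hx, by rw [mem_closedBall_iff_norm]⟩
  have hmv := (convex_segment v x).norm_image_sub_le_of_norm_fderiv_le (𝕜 := ℂ) (f := f)
    (C := K * ‖x - v‖) (fun y hy => (hd y (hεt (hseg hy).1).2).differentiableAt)
    (fun y hy => ?_) (left_mem_segment ℝ v x) (right_mem_segment ℝ v x)
  · have h1 : f v = 0 := by
      simp [hf, h.apply_self, Submodule.starProjection_eq_self_iff.2 h.mem]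
    have h2 : φ x = x := h.fixes x (hεt hx).2 hxX
    rw [h1, sub_zero] at hmv
    simp only [hf, h2] at hmv
    rw [pow_two, ← mul_assoc]
    exact hmv
  · have h1 := hLip.dist_le_mul y (hεt (hseg hy).1).1 v (hεt (mem_ball_self hε)).1
    rw [hv0, dist_zero_right] at h1
    refine h1.trans ?_
    gcongr
    exact (hseg hy).2

end IsLocalRetraction

open Metric Set Filter Topology MeasureTheory ComplexConjugate
open scoped InnerProductSpace
set_option linter.unusedSectionVars false

/-! ### Identity theorem on convex sets and sesquiholomorphic inner products. -/

section Holomorphic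

variable {E : Type*} [NormedAddCommGroup E] [InnerProductSpace ℂ E] [FiniteDimensional ℂ E]

/-- Restriction to the complex line through `a` and `x`: the part of the line inside `U` is convex,
hence connected, and the one-variable identity theorem applies. -/
theorem eq_zero_of_differentiableOn_convex {F : Type*} [NormedAddCommGroup F] [NormedSpace ℂ F]
    {U : Set F} (hU : IsOpen U) (hconv : Convex ℝ U) {h : F → ℂ}
    (hh : DifferentiableOn ℂ h U) {a : F} (ha : a ∈ U) (h0 : ∀ᶠ x in 𝓝 a, h x = 0) :
    ∀ x ∈ U, h x = 0 := by
  intro x hx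
  let l : ℂ → F := fun t => a + t • (x - a)
  have hl : Continuous l := by fun_prop
  have hld : Differentiable ℂ l := by fun_prop
  have hconv' : Convex ℝ (l ⁻¹' U) := by
    intro s hs t ht p q hp hq hpq
    have : l (p • s + q • t) = p • l s + q • l t := by
      simp only [l]
      have e1 : a = p • a + q • a := by rw [← add_smul, hpq, one_smul]
      rw [add_smul, smul_add, smul_add, smul_assoc, smul_assoc]
      nth_rewrite 1 [e1]
      abel
    change l _ ∈ U
    rw [this]
    exact hconv hs ht hp hq hpq
  have han : AnalyticOnNhd ℂ (h ∘ l) (l ⁻¹' U) :=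
    (hh.comp hld.differentiableOn (mapsTo_preimage l U)).analyticOnNhd (hU.preimage hl)
  have h1 : (0 : ℂ) ∈ l ⁻¹' U := by simpa [l] using ha
  have h2 : (1 : ℂ) ∈ l ⁻¹' U := by simpa [l] using hx
  have h3 : h ∘ l =ᶠ[𝓝 0] 0 := by
    have : Tendsto l (𝓝 0) (𝓝 a) := hl.tendsto' 0 a (by simp [l])
    exact this.eventually h0
  have := han.eqOn_zero_of_preconnected_of_eventuallyEq_zero hconv'.isPreconnected h1 h3 h2
  simpa [l] using this

/-- In an orthonormal basis the antilinear slot becomes a sum of functions `conj ∘ g ∘ conj` with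
`g` holomorphic, and these are holomorphic again. -/
theorem differentiableOn_inner_conj {U V : Set ℂ} {γ δ : ℂ → E}
    (hγ : DifferentiableOn ℂ γ U) (hδ : ∀ t ∈ V, DifferentiableAt ℂ δ (conj t)) :
    DifferentiableOn ℂ (fun p : ℂ × ℂ => ⟪δ (conj p.2), γ p.1⟫_ℂ) (U ×ˢ V) := by
  let b := stdOrthonormalBasis ℂ E
  have h1 : (fun p : ℂ × ℂ => ⟪δ (conj p.2), γ p.1⟫_ℂ) = fun p : ℂ × ℂ =>
      ∑ i, (conj ∘ (fun t => ⟪b i, δ t⟫_ℂ) ∘ conj) p.2 * ⟪b i, γ p.1⟫_ℂ := by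
    ext p
    rw [← b.sum_inner_mul_inner]
    simp
  rw [h1]
  refine DifferentiableOn.fun_sum fun i _ => ?_
  refine DifferentiableOn.mul (fun p hp => ?_) ?_
  · have h2 : DifferentiableAt ℂ (fun t => ⟪b i, δ t⟫_ℂ) (conj p.2) :=
      (innerSL ℂ (b i)).differentiableAt.comp _ (hδ p.2 hp.2)
    have h3 := h2.conj_conj
    rw [Complex.conj_conj] at h3
    exact (h3.comp p differentiableAt_snd).differentiableWithinAt
  · refine (innerSL ℂ (b i)).differentiable.comp_differentiableOn ?_
    exact hγ.comp differentiableOn_fst fun p hp => hp.1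

end Holomorphic

/-! ### Cones over orbits of a unitary representation. -/

section Orbit

variable {Γ E : Type*} [Group Γ] [NormedAddCommGroup E] [InnerProductSpace ℂ E]

/-- The punctured cone over the orbit of the line through `v`. -/
def orbitConeOf (ρ : Γ →* (E ≃ₗᵢ[ℂ] E)) (v : E) : Set E :=
  {x | ∃ g : Γ, ∃ c : ℂ, c ≠ 0 ∧ x = c • ρ g v}

variable {ρ : Γ →* (E ≃ₗᵢ[ℂ] E)} {v : E}

theorem apply_mem_orbitConeOf (g : Γ) : ρ g v ∈ orbitConeOf ρ v :=
  ⟨g, 1, one_ne_zero, by simp⟩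

theorem map_mem_orbitConeOf (g : Γ) {x : E} (hx : x ∈ orbitConeOf ρ v) :
    ρ g x ∈ orbitConeOf ρ v := by
  obtain ⟨h, c, hc, rfl⟩ := hx
  exact ⟨g * h, c, hc, by simp⟩

theorem smul_mem_orbitConeOf {c : ℂ} (hc : c ≠ 0) {x : E} (hx : x ∈ orbitConeOf ρ v) :
    c • x ∈ orbitConeOf ρ v := by
  obtain ⟨h, c', hc', rfl⟩ := hx
  exact ⟨h, c * c', mul_ne_zero hc hc', by simp [smul_smul]⟩

theorem self_mem_orbitConeOf : v ∈ orbitConeOf ρ v := ⟨1, 1, one_ne_zero, by simp⟩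

theorem inv_apply_apply (g : Γ) (x : E) : ρ g⁻¹ (ρ g x) = x := by
  rw [map_inv]
  exact (ρ g).symm_apply_apply x

theorem apply_inv_apply (g : Γ) (x : E) : ρ g (ρ g⁻¹ x) = x := by
  rw [map_inv]
  exact (ρ g).apply_symm_apply x

theorem inner_apply_left (g : Γ) (x y : E) : ⟪ρ g x, y⟫_ℂ = ⟪x, ρ g⁻¹ y⟫_ℂ := by
  rw [← (ρ g).inner_map_map x, apply_inv_apply]

theorem inner_apply_right (g : Γ) (x y : E) : ⟪x, ρ g y⟫_ℂ = ⟪ρ g⁻¹ x, y⟫_ℂ := by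
  rw [← (ρ g).inner_map_map (ρ g⁻¹ x), apply_inv_apply]

variable [FiniteDimensional ℂ E]

/-- The orbit of the line through the unit vector `v` under a continuous unitary representation is
a connected complex submanifold of the projective space which spans it. -/
structure IsKahlerOrbit [TopologicalSpace Γ] (ρ : Γ →* (E ≃ₗᵢ[ℂ] E)) (v : E)
    (T : Submodule ℂ E) (φ : E → E) (r : ℝ) : Prop where
  continuous : ∀ x, Continuous fun g => ρ g x
  norm_eq : ‖v‖ = 1
  retraction : IsLocalRetraction (orbitConeOf ρ v) v T φ r
  preconnected : IsPreconnected (orbitConeOf ρ v)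
  span_eq : Submodule.span ℂ (orbitConeOf ρ v) = ⊤

namespace IsKahlerOrbit

variable [TopologicalSpace Γ] {T : Submodule ℂ E} {φ : E → E} {r : ℝ}

/-- Identity theorem on the cone over the orbit. -/
theorem eq_zero_of_eventually (h : IsKahlerOrbit ρ v T φ r) {f : E → ℂ}
    (hf : Differentiable ℂ f) {x₀ : E} (hx₀ : x₀ ∈ orbitConeOf ρ v)
    (h0 : ∀ᶠ x in 𝓝 x₀, x ∈ orbitConeOf ρ v → f x = 0) :
    ∀ x ∈ orbitConeOf ρ v, f x = 0 := by
  set X := orbitConeOf ρ v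
  have hX : PreconnectedSpace X := isPreconnected_iff_preconnectedSpace.1 h.preconnected
  -- By connectedness it is enough that `Z` is closed. At a point `x` of its closure, the symmetry
  -- `A` of the cone carries `v` to `x`. Then `f ∘ A ∘ φ` is holomorphic on a whole ball around `v`
  -- and vanishes near one of its points, hence everywhere on the ball.
  let Z : Set X := {x | ∀ᶠ y in 𝓝 (x : E), y ∈ X → f y = 0}
  have hZo : IsOpen Z := by
    refine isOpen_iff_mem_nhds.2 fun x hx => ?_
    have h1 : ∀ᶠ y in 𝓝 (x : E), ∀ᶠ z in 𝓝 y, z ∈ X → f z = 0 := eventually_eventually_nhds.2 hx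
    exact continuous_subtype_val.continuousAt.eventually h1
  have hZc : IsClosed Z := by
    refine isClosed_of_closure_subset fun x hx => ?_
    obtain ⟨g, c, hc, hxe⟩ := x.2
    let A : E → E := fun y => c • ρ g y
    let A' : E → E := fun y => ρ g⁻¹ (c⁻¹ • y)
    have hAA' : ∀ y, A (A' y) = y := fun y => by
      simp only [A, A', apply_inv_apply, smul_smul, mul_inv_cancel₀ hc, one_smul]
    have hA'A : ∀ y, A' (A y) = y := fun y => by
      simp only [A, A', smul_smul, inv_mul_cancel₀ hc, one_smul, inv_apply_apply]
    have hAX : ∀ y ∈ X, A y ∈ X := fun y hy => smul_mem_orbitConeOf hc (map_mem_orbitConeOf g hy)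
    have hA'X : ∀ y ∈ X, A' y ∈ X := fun y hy =>
      map_mem_orbitConeOf _ (smul_mem_orbitConeOf (inv_ne_zero hc) hy)
    have hAc : Continuous A := (ρ g).continuous.const_smul c
    have hA'c : Continuous A' := (ρ g⁻¹).continuous.comp (continuous_const_smul c⁻¹)
    have hAd : Differentiable ℂ A :=
      ((ρ g).toContinuousLinearEquiv.differentiable).const_smul c
    have hA'x : A' x = v := by rw [hxe]; exact hA'A v
    have hnb : A' ⁻¹' ball v r ∈ 𝓝 (x : E) :=
      hA'c.continuousAt (by rw [hA'x]; exact ball_mem_nhds v h.retraction.pos)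
    obtain ⟨z, hz1, hz2⟩ := mem_closure_iff_nhds.1 hx _
      (continuous_subtype_val.continuousAt.preimage_mem_nhds hnb)
    have hz' : A' z ∈ ball v r := hz1
    have hφz : φ (A' z) = A' z := h.retraction.fixes _ hz' (hA'X _ z.2)
    have hd : DifferentiableOn ℂ (fun y => f (A (φ y))) (ball v r) := fun y hy =>
      ((hf.comp hAd).differentiableAt.comp y
        (h.retraction.hasFDerivAt hy).differentiableAt).differentiableWithinAt
    have hz0 : ∀ᶠ y in 𝓝 (A' z), f (A (φ y)) = 0 := by
      have hct : ContinuousAt (fun y => A (φ y)) (A' z) :=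
        hAc.continuousAt.comp (h.retraction.hasFDerivAt hz').continuousAt
      have h2 : A (φ (A' z)) = z := by rw [hφz, hAA']
      have hz2' : ∀ᶠ y in 𝓝 (A (φ (A' z))), y ∈ X → f y = 0 := by rw [h2]; exact hz2
      filter_upwards [hct.eventually hz2', isOpen_ball.mem_nhds hz'] with y hy hyb
      exact hy (hAX _ (h.retraction.mapsTo y hyb))
    have hall := eq_zero_of_differentiableOn_convex isOpen_ball (convex_ball v r) hd hz' hz0
    change ∀ᶠ y in 𝓝 (x : E), y ∈ X → f y = 0
    filter_upwards [hnb] with y hy hyX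
    have h3 := hall _ hy
    rwa [h.retraction.fixes _ hy (hA'X _ hyX), hAA'] at h3
  have hZu : Z = univ := IsClopen.eq_univ ⟨hZc, hZo⟩ ⟨⟨x₀, hx₀⟩, h0⟩
  intro x hx
  have : (⟨x, hx⟩ : X) ∈ Z := by rw [hZu]; trivial
  exact this.self_of_nhds hx

end IsKahlerOrbit

end Orbit

/-! ### The reproducing identity obtained by averaging over the group. -/

section Reproducing

variable {Γ E : Type*} [Group Γ] [NormedAddCommGroup E] [InnerProductSpace ℂ E]
  [TopologicalSpace Γ] [CompactSpace Γ] [MeasurableSpace Γ] [BorelSpace Γ]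

/-- Integration against a probability measure, as a functional on continuous functions. -/
noncomputable def integralFunctional (μ : Measure Γ) [IsProbabilityMeasure μ] :
    C(Γ, ℂ) →L[ℂ] ℂ :=
  LinearMap.mkContinuous
    { toFun := fun f => ∫ g, f g ∂μ
      map_add' := fun f g => integral_add
        (f.continuous.integrable_of_hasCompactSupport (HasCompactSupport.of_compactSpace _))
        (g.continuous.integrable_of_hasCompactSupport (HasCompactSupport.of_compactSpace _))
      map_smul' := fun c f => integral_const_mul c _ } 1 fun f => by
    rw [one_mul]
    refine (norm_integral_le_of_norm_le_const
      (Eventually.of_forall fun g => f.norm_coe_le_norm g)).trans (by simp)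

/-- The matrix coefficients of the vector `ρ g v`. -/
noncomputable def coeffFunctional {ρ : Γ →* (E ≃ₗᵢ[ℂ] E)} (hρ : ∀ x, Continuous fun g => ρ g x)
    (v : E) : E →L[ℂ] C(Γ, ℂ) :=
  LinearMap.mkContinuous
    { toFun := fun x => ⟨fun g => ⟪ρ g v, x⟫_ℂ, (hρ v).inner continuous_const⟩
      map_add' := fun x y => by ext g; simp
      map_smul' := fun c x => by ext g; simp } ‖v‖ fun x => by
    refine (ContinuousMap.norm_le _ (by positivity)).2 fun g => ?_
    exact (norm_inner_le_norm _ _).trans (by simp)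

@[simp]
theorem coeffFunctional_apply {ρ : Γ →* (E ≃ₗᵢ[ℂ] E)} (hρ : ∀ x, Continuous fun g => ρ g x)
    (v x : E) (g : Γ) : coeffFunctional hρ v x g = ⟪ρ g v, x⟫_ℂ := rfl

@[simp]
theorem integralFunctional_apply (μ : Measure Γ) [IsProbabilityMeasure μ] (f : C(Γ, ℂ)) :
    integralFunctional μ f = ∫ g, f g ∂μ := rfl

/-- The `m`-th moment of the transition probability `|⟨v, ρ g v⟩|²`. -/
noncomputable def moment (ρ : Γ →* (E ≃ₗᵢ[ℂ] E)) (v : E) (μ : Measure Γ) (m : ℕ) : ℝ :=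
  ∫ g, (‖⟪v, ρ g v⟫_ℂ‖ ^ 2) ^ m ∂μ

variable [FiniteDimensional ℂ E] {ρ : Γ →* (E ≃ₗᵢ[ℂ] E)} {v : E} {T : Submodule ℂ E} {φ : E → E}
  {r : ℝ} {μ : Measure Γ} [IsProbabilityMeasure μ]

theorem integral_inner_pow_invariant [IsTopologicalGroup Γ] [μ.IsMulLeftInvariant]
    (m : ℕ) (h : Γ) (x y : E) :
    ∫ g, ⟪ρ g v, ρ h x⟫_ℂ ^ m * ⟪ρ h y, ρ g v⟫_ℂ ^ m ∂μ =
      ∫ g, ⟪ρ g v, x⟫_ℂ ^ m * ⟪y, ρ g v⟫_ℂ ^ m ∂μ := by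
  rw [← integral_mul_left_eq_self _ h]
  simp

theorem integral_inner_pow_smul (m : ℕ) (c d : ℂ) (x y : E) :
    ∫ g, ⟪ρ g v, c • x⟫_ℂ ^ m * ⟪d • y, ρ g v⟫_ℂ ^ m ∂μ =
      c ^ m * (conj d) ^ m * ∫ g, ⟪ρ g v, x⟫_ℂ ^ m * ⟪y, ρ g v⟫_ℂ ^ m ∂μ := by
  rw [← integral_const_mul]
  congr 1
  ext g
  rw [inner_smul_right, inner_smul_left, mul_pow, mul_pow]
  ring

theorem integral_inner_pow_self (m : ℕ) :
    ∫ g, ⟪ρ g v, v⟫_ℂ ^ m * ⟪v, ρ g v⟫_ℂ ^ m ∂μ = moment ρ v μ m := by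
  rw [moment, ← integral_complex_ofReal]
  congr 1
  ext g
  rw [← mul_pow, ← inner_conj_symm, ← Complex.normSq_eq_conj_mul_self, Complex.normSq_eq_norm_sq]
  push_cast
  rfl

namespace IsKahlerOrbit

/-- The reproducing property of the kernels `⟨x, y⟩ ^ m` on the orbit. -/
theorem integral_inner_pow [IsTopologicalGroup Γ] [μ.IsMulLeftInvariant]
    (h : IsKahlerOrbit ρ v T φ r) (m : ℕ) {x y : E} (hx : x ∈ orbitConeOf ρ v)
    (hy : y ∈ orbitConeOf ρ v) :
    ∫ g, ⟪ρ g v, x⟫_ℂ ^ m * ⟪y, ρ g v⟫_ℂ ^ m ∂μ = moment ρ v μ m * ⟪y, x⟫_ℂ ^ m := by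
  set X := orbitConeOf ρ v
  let ℓ := coeffFunctional h.continuous v
  -- The defect of the identity is invariant under the diagonal action and homogeneous in each
  -- variable. It vanishes at `(v, v)` by the definition of the moment, hence on the whole diagonal
  -- of the cone.
  let D : E → E → ℂ := fun x y =>
    integralFunctional μ (ℓ x ^ m * star (ℓ y) ^ m) - moment ρ v μ m * ⟪y, x⟫_ℂ ^ m
  have hD : ∀ x y, D x y = (∫ g, ⟪ρ g v, x⟫_ℂ ^ m * ⟪y, ρ g v⟫_ℂ ^ m ∂μ)
      - moment ρ v μ m * ⟪y, x⟫_ℂ ^ m := fun x y => by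
    simp [D, ℓ]
  have hDρ : ∀ g x y, D (ρ g x) (ρ g y) = D x y := fun g x y => by
    rw [hD, hD, integral_inner_pow_invariant, LinearIsometryEquiv.inner_map_map]
  have hDs : ∀ c d x y, D (c • x) (d • y) = c ^ m * (conj d) ^ m * D x y := fun c d x y => by
    rw [hD, hD, integral_inner_pow_smul, inner_smul_right, inner_smul_left, mul_pow, mul_pow]
    ring
  have hDd : ∀ x ∈ X, D x x = 0 := by
    rintro x ⟨g, c, hc, rfl⟩
    rw [hDs, hDρ, hD, integral_inner_pow_self, inner_self_eq_norm_sq_to_K, h.norm_eq]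
    simp
  have hnear : ∀ᶠ x in 𝓝 v, x ∈ X → D x v = 0 := by
    filter_upwards [ball_mem_nhds v (show 0 < r / 4 by linarith [h.retraction.pos])] with x hxb hxX
    rw [mem_ball_iff_norm] at hxb
    -- The factor 4 lets `x` sit at parameter `1/4`, inside the half-radius disc to which
    -- polarization applies, while the unit disc of parameters stays in `ball v r`.
    let η := (4 : ℂ) • (x - v)
    have hη : ‖η‖ < r := by
      simp only [η, norm_smul, Complex.norm_ofNat]
      linarith
    let γ : ℂ → E := fun s => φ (v + s • η)
    have hin : ∀ s : ℂ, ‖s‖ ≤ 1 → v + s • η ∈ ball v r := fun s hs => by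
      rw [mem_ball_iff_norm, add_sub_cancel_left, norm_smul]
      nlinarith [norm_nonneg η]
    have hγd : ∀ s : ℂ, ‖s‖ ≤ 1 → DifferentiableAt ℂ γ s := fun s hs =>
      (h.retraction.hasFDerivAt (hin s hs)).differentiableAt.comp s
        (f := fun s : ℂ => v + s • η) (by fun_prop)
    have hγX : ∀ s : ℂ, ‖s‖ ≤ 1 → γ s ∈ X := fun s hs => h.retraction.mapsTo _ (hin s hs)
    have hle : ∀ s ∈ ball (0 : ℂ) 1, ‖s‖ ≤ 1 := fun s hs => (by simpa using hs : ‖s‖ < 1).le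
    have hG : DifferentiableOn ℂ (fun p : ℂ × ℂ => D (γ p.1) (γ (conj p.2)))
        (ball 0 1 ×ˢ ball 0 1) := by
      refine DifferentiableOn.sub ?_ ?_
      · refine (integralFunctional μ).differentiable.comp_differentiableOn ?_
        refine DifferentiableOn.mul (DifferentiableOn.pow ?_ m) (DifferentiableOn.pow ?_ m)
        · refine ℓ.differentiable.comp_differentiableOn fun p hp => ?_
          exact ((hγd _ (hle _ hp.1)).comp p differentiableAt_fst).differentiableWithinAt
        · intro p hp
          have h1 : DifferentiableAt ℂ (fun t => ℓ (γ t)) (conj p.2) :=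
            ℓ.differentiableAt.comp _ (hγd _ (by simpa using hle _ hp.2))
          have h2 := h1.star_conj
          rw [Complex.conj_conj] at h2
          exact (h2.comp p differentiableAt_snd).differentiableWithinAt
      · refine DifferentiableOn.const_mul (DifferentiableOn.pow ?_ m) _
        refine differentiableOn_inner_conj (fun s hs => (hγd s (hle s hs)).differentiableWithinAt)
          fun t ht => hγd _ (by simpa using hle t ht)
    have hzero := eq_zero_of_eq_zero_on_conj hG (fun s hs => by
      simpa using hDd _ (hγX s (hle s hs))) 4⁻¹ (by simp; norm_num) 0 (by simp)
    have e1 : γ 4⁻¹ = x := by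
      simp only [γ, η, smul_smul]
      norm_num
      refine h.retraction.fixes x ?_ hxX
      rw [mem_ball_iff_norm]; linarith [h.retraction.pos]
    have e2 : γ 0 = v := by
      simp [γ, h.retraction.apply_self]
    simpa [e1, e2] using hzero
  -- Holomorphy in `x` alone extends the vanishing from a neighbourhood of `v` to the connected
  -- cone; invariance and homogeneity then move the second point away from `v`.
  have hDv : ∀ x ∈ X, D x v = 0 := by
    refine h.eq_zero_of_eventually ?_ self_mem_orbitConeOf hnear
    refine Differentiable.sub ?_ ?_
    · refine (integralFunctional μ).differentiable.comp ?_
      exact (ℓ.differentiable.pow m).mul (differentiable_const _)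
    · exact ((innerSL ℂ v).differentiable.pow m).const_mul _
  obtain ⟨g, d, hd, rfl⟩ := hy
  have h1 : D x (d • ρ g v) = 0 := by
    have h2 := hDs 1 d x (ρ g v)
    rw [one_smul] at h2
    have h3 := hDρ g (ρ g⁻¹ x) v
    rw [apply_inv_apply] at h3
    rw [h2, h3, hDv _ (map_mem_orbitConeOf _ hx), mul_zero]
  rw [hD] at h1
  exact sub_eq_zero.1 h1

end IsKahlerOrbit

end Reproducing

theorem inner_self_eq_ofReal {E : Type*} [NormedAddCommGroup E] [InnerProductSpace ℂ E] (x : E) :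
    ⟪x, x⟫_ℂ = ((‖x‖ ^ 2 : ℝ) : ℂ) := by
  rw [inner_self_eq_norm_sq_to_K]
  simp

/-! ### Graded Hilbert spaces of functions on a cone. -/

section Fock

variable {E H : Type*} [NormedAddCommGroup E] [InnerProductSpace ℂ E]
  [NormedAddCommGroup H] [InnerProductSpace ℂ H] [CompleteSpace H]

/-- A graded Hilbert space of functions on the cone `X`, with the homogeneous components `K m x` of
the reproducing kernels and the operators `S q` of multiplication by the functionals `⟨q, ·⟩`. -/
structure IsFockSystem (X : Set E) (K : ℕ → E → H) (S : E → H →L[ℂ] H) : Prop where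
  inner_kernel : ∀ m m', ∀ x ∈ X, ∀ y ∈ X,
    ⟪K m x, K m' y⟫_ℂ = if m = m' then ⟪y, x⟫_ℂ ^ m else 0
  total : ∀ f, (∀ m, ∀ x ∈ X, ⟪K m x, f⟫_ℂ = 0) → f = 0
  inner_succ : ∀ m, ∀ x ∈ X, ∀ q f, ⟪K (m + 1) x, S q f⟫_ℂ = ⟪q, x⟫_ℂ * ⟪K m x, f⟫_ℂ
  inner_zero : ∀ x ∈ X, ∀ q f, ⟪K 0 x, S q f⟫_ℂ = 0
  finite : ∀ m, FiniteDimensional ℂ (Submodule.span ℂ (K m '' X))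

/-- The homogeneous component of degree `m`. -/
def level (X : Set E) (K : ℕ → E → H) (m : ℕ) : Submodule ℂ H := Submodule.span ℂ (K m '' X)

/-- The cross-commutator of two multiplication operators. -/
noncomputable def mulCommutator (S : E → H →L[ℂ] H) (p q : E) : H →L[ℂ] H :=
  (S p).adjoint ∘L S q - S q ∘L (S p).adjoint

namespace IsFockSystem

variable {X : Set E} {K : ℕ → E → H} {S : E → H →L[ℂ] H}

theorem kernel_mem (m : ℕ) {x : E} (hx : x ∈ X) : K m x ∈ level X K m :=
  Submodule.subset_span ⟨x, hx, rfl⟩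

theorem finiteDimensional (h : IsFockSystem X K S) (m : ℕ) :
    FiniteDimensional ℂ (level X K m) := h.finite m

theorem inner_same (h : IsFockSystem X K S) (m : ℕ) {x y : E} (hx : x ∈ X) (hy : y ∈ X) :
    ⟪K m x, K m y⟫_ℂ = ⟪y, x⟫_ℂ ^ m := by
  simp [h.inner_kernel m m x hx y hy]

theorem inner_of_ne (h : IsFockSystem X K S) {m m' : ℕ} (hm : m' ≠ m) {x : E} (hx : x ∈ X) {f : H}
    (hf : f ∈ level X K m) : ⟪K m' x, f⟫_ℂ = 0 := by
  induction hf using Submodule.span_induction with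
  | mem f hf =>
    obtain ⟨y, hy, rfl⟩ := hf
    simp [h.inner_kernel m' m x hx y hy, hm]
  | zero => simp
  | add f g _ _ hf hg => rw [inner_add_right, hf, hg, add_zero]
  | smul c f _ hf => rw [inner_smul_right, hf, mul_zero]

/-- The part of `f` orthogonal to the level pairs to zero with the kernels of every degree, so
totality removes it. -/
theorem mem_level (h : IsFockSystem X K S) {m : ℕ} {f : H}
    (hf : ∀ m', m' ≠ m → ∀ x ∈ X, ⟪K m' x, f⟫_ℂ = 0) : f ∈ level X K m := by
  have := h.finiteDimensional m
  have h1 : f - (level X K m).starProjection f = 0 := by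
    refine h.total _ fun m' x hx => ?_
    by_cases hm : m' = m
    · subst hm
      exact (Submodule.mem_orthogonal _ _).1
        ((level X K m').sub_starProjection_mem_orthogonal f) _ (kernel_mem m' hx)
    · rw [inner_sub_right, hf m' hm x hx,
        h.inner_of_ne hm hx ((level X K m).starProjection_apply_mem f), sub_zero]
  rw [sub_eq_zero.1 h1]
  exact (level X K m).starProjection_apply_mem f

theorem map_mem_level (h : IsFockSystem X K S) (q : E) {m : ℕ} {f : H} (hf : f ∈ level X K m) :
    S q f ∈ level X K (m + 1) := by
  refine h.mem_level fun m' hm' x hx => ?_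
  rcases m' with _ | m'
  · exact h.inner_zero x hx q f
  · rw [h.inner_succ m' x hx, h.inner_of_ne (by omega) hx hf, mul_zero]

/-- Evaluation functionals turn multiplication into a scalar, so adjoint multiplications act on
kernels as scalars combined with a drop in degree. All later commutator computations rest on this.
-/
theorem adjoint_kernel_succ (h : IsFockSystem X K S) (q : E) (m : ℕ) {x : E} (hx : x ∈ X) :
    (S q).adjoint (K (m + 1) x) = (⟪x, q⟫_ℂ) • K m x := by
  refine ext_inner_right ℂ fun f => ?_
  rw [ContinuousLinearMap.adjoint_inner_left, h.inner_succ m x hx, inner_smul_left, inner_conj_symm]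

theorem adjoint_kernel_zero (h : IsFockSystem X K S) (q : E) {x : E} (hx : x ∈ X) :
    (S q).adjoint (K 0 x) = 0 := by
  refine ext_inner_right ℂ fun f => ?_
  rw [ContinuousLinearMap.adjoint_inner_left, h.inner_zero x hx, inner_zero_left]

theorem adjoint_mem_level (h : IsFockSystem X K S) (q : E) {m : ℕ} {f : H}
    (hf : f ∈ level X K (m + 1)) : (S q).adjoint f ∈ level X K m := by
  induction hf using Submodule.span_induction with
  | mem f hf =>
    obtain ⟨y, hy, rfl⟩ := hf
    rw [h.adjoint_kernel_succ q m hy]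
    exact Submodule.smul_mem _ _ (kernel_mem m hy)
  | zero => simp
  | add f g _ _ hf hg => rw [map_add]; exact Submodule.add_mem _ hf hg
  | smul c f _ hf => rw [map_smul]; exact Submodule.smul_mem _ _ hf

theorem adjoint_level_zero (h : IsFockSystem X K S) (q : E) {f : H}
    (hf : f ∈ level X K 0) : (S q).adjoint f = 0 := by
  induction hf using Submodule.span_induction with
  | mem f hf =>
    obtain ⟨y, hy, rfl⟩ := hf
    exact h.adjoint_kernel_zero q hy
  | zero => simp
  | add f g _ _ hf hg => rw [map_add, hf, hg, add_zero]
  | smul c f _ hf => rw [map_smul, hf, smul_zero]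

theorem mulCommutator_mem_level (h : IsFockSystem X K S) (p q : E) {m : ℕ} {f : H}
    (hf : f ∈ level X K m) : mulCommutator S p q f ∈ level X K m := by
  have h1 : (S p).adjoint (S q f) ∈ level X K m := h.adjoint_mem_level p (h.map_mem_level q hf)
  have h2 : S q ((S p).adjoint f) ∈ level X K m := by
    rcases m with _ | m
    · rw [h.adjoint_level_zero p hf, map_zero]; exact Submodule.zero_mem _
    · exact h.map_mem_level q (h.adjoint_mem_level p hf)
  exact Submodule.sub_mem _ h1 h2

theorem adjoint_mulCommutator (p q : E) : (mulCommutator S p q).adjoint = mulCommutator S q p := by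
  simp [mulCommutator, ContinuousLinearMap.adjoint_comp]

theorem norm_kernel (h : IsFockSystem X K S) (m : ℕ) {x : E} (hx : x ∈ X) (hx1 : ‖x‖ = 1) :
    ‖K m x‖ = 1 := by
  have h1 : ⟪K m x, K m x⟫_ℂ = 1 := by
    rw [h.inner_same m hx hx, inner_self_eq_ofReal, hx1]; simp
  rw [inner_self_eq_ofReal] at h1
  have h2 : ‖K m x‖ ^ 2 = 1 := by exact_mod_cast h1
  nlinarith [norm_nonneg (K m x)]

end IsFockSystem

end Fock

/-! ### Coherent-state resolution of the identity and second moments. -/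

section Orbit

variable {Γ E H : Type*} [Group Γ] [NormedAddCommGroup E] [InnerProductSpace ℂ E]
  [NormedAddCommGroup H] [InnerProductSpace ℂ H] [CompleteSpace H]
  [TopologicalSpace Γ] [IsTopologicalGroup Γ] [CompactSpace Γ] [MeasurableSpace Γ] [BorelSpace Γ]
  [FiniteDimensional ℂ E] {ρ : Γ →* (E ≃ₗᵢ[ℂ] E)} {v : E} {T : Submodule ℂ E} {φ : E → E}
  {r : ℝ} {μ : Measure Γ} [IsProbabilityMeasure μ] [μ.IsMulLeftInvariant]
  {K : ℕ → E → H} {S : E → H →L[ℂ] H}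

theorem Continuous.integrable_of_compactSpace {F : Type*} [NormedAddCommGroup F]
    {f : Γ → F} (hf : Continuous f) (μ : Measure Γ) [IsProbabilityMeasure μ]
    [SecondCountableTopologyEither Γ F] : Integrable f μ :=
  hf.integrable_of_hasCompactSupport (HasCompactSupport.of_compactSpace _)

namespace IsFockSystem

/-- The kernels along the orbit of `v` are unit vectors, so their distances are determined by their
inner products, which are continuous. -/
theorem continuous_kernel (h : IsFockSystem (orbitConeOf ρ v) K S)
    (ho : IsKahlerOrbit ρ v T φ r) (m : ℕ) : Continuous fun g => K m (ρ g v) := by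
  refine continuous_iff_continuousAt.2 fun g₀ => ?_
  rw [ContinuousAt, tendsto_iff_norm_sub_tendsto_zero]
  have h1 : ∀ g, ‖K m (ρ g v) - K m (ρ g₀ v)‖ ^ 2 =
      2 - 2 * (⟪ρ g₀ v, ρ g v⟫_ℂ ^ m).re := by
    intro g
    have hn : ∀ g, ‖K m (ρ g v)‖ = 1 := fun g =>
      h.norm_kernel m (apply_mem_orbitConeOf g) (by simp [ho.norm_eq])
    rw [@norm_sub_sq ℂ, hn, hn, h.inner_same m (apply_mem_orbitConeOf g) (apply_mem_orbitConeOf g₀)]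
    simp only [RCLike.re_to_complex]
    ring
  have h2 : Tendsto (fun g => ‖K m (ρ g v) - K m (ρ g₀ v)‖ ^ 2) (𝓝 g₀) (𝓝 0) := by
    simp_rw [h1]
    have hc : Continuous fun g => 2 - 2 * (⟪ρ g₀ v, ρ g v⟫_ℂ ^ m).re := by
      have := ho.continuous v
      fun_prop
    refine hc.tendsto' _ _ ?_
    rw [inner_self_eq_ofReal]
    simp [ho.norm_eq]
  have h3 := h2.sqrt
  simpa [Real.sqrt_sq (norm_nonneg _)] using h3

/-- Both sides are sesquilinear and the kernels span the level; for two kernels this is the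
reproducing identity on the orbit. -/
theorem integral_inner_mul_inner (h : IsFockSystem (orbitConeOf ρ v) K S)
    (ho : IsKahlerOrbit ρ v T φ r) {m : ℕ} {f f' : H} (hf : f ∈ level (orbitConeOf ρ v) K m)
    (hf' : f' ∈ level (orbitConeOf ρ v) K m) :
    ∫ g, ⟪f, K m (ρ g v)⟫_ℂ * ⟪K m (ρ g v), f'⟫_ℂ ∂μ = moment ρ v μ m * ⟪f, f'⟫_ℂ := by
  have hK := h.continuous_kernel ho m
  have hint : ∀ f f' : H, Integrable (fun g => ⟪f, K m (ρ g v)⟫_ℂ * ⟪K m (ρ g v), f'⟫_ℂ) μ :=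
    fun f f' => Continuous.integrable_of_compactSpace
      ((continuous_const.inner hK).mul (hK.inner continuous_const)) μ
  induction hf using Submodule.span_induction with
  | mem f hf =>
    obtain ⟨x, hx, rfl⟩ := hf
    induction hf' using Submodule.span_induction with
    | mem f' hf' =>
      obtain ⟨y, hy, rfl⟩ := hf'
      rw [h.inner_same m hx hy, ← ho.integral_inner_pow m hx hy]
      congr 1
      ext g
      rw [h.inner_same m hx (apply_mem_orbitConeOf g), h.inner_same m (apply_mem_orbitConeOf g) hy]
    | zero => simp
    | add f g _ _ hf hg =>
      simp only [inner_add_right, mul_add]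
      rw [integral_add (hint _ _) (hint _ _), hf, hg]
    | smul c f _ hf =>
      simp only [inner_smul_right, mul_left_comm _ c]
      rw [integral_const_mul, hf]
  | zero => simp
  | add f g _ _ hf hg =>
    simp only [inner_add_left, add_mul, mul_add]
    rw [integral_add (hint _ _) (hint _ _), hf, hg]
  | smul c f _ hf =>
    simp only [inner_smul_left, mul_assoc]
    rw [integral_const_mul, hf]
    ring

theorem integral_norm_inner_sq (h : IsFockSystem (orbitConeOf ρ v) K S)
    (ho : IsKahlerOrbit ρ v T φ r) {m : ℕ} {f : H} (hf : f ∈ level (orbitConeOf ρ v) K m) :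
    ∫ g, ‖⟪K m (ρ g v), f⟫_ℂ‖ ^ 2 ∂μ = moment ρ v μ m * ‖f‖ ^ 2 := by
  have h1 := h.integral_inner_mul_inner ho hf hf (μ := μ)
  rw [inner_self_eq_ofReal] at h1
  have h2 : ∀ g, ⟪f, K m (ρ g v)⟫_ℂ * ⟪K m (ρ g v), f⟫_ℂ =
      ((‖⟪K m (ρ g v), f⟫_ℂ‖ ^ 2 : ℝ) : ℂ) := fun g => by
    rw [← inner_conj_symm, ← Complex.normSq_eq_conj_mul_self, Complex.normSq_eq_norm_sq]
  simp_rw [h2] at h1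
  rw [integral_complex_ofReal] at h1
  exact_mod_cast h1

/-- The dimension of the homogeneous components. -/
theorem finrank_mul_moment (h : IsFockSystem (orbitConeOf ρ v) K S)
    (ho : IsKahlerOrbit ρ v T φ r) (m : ℕ) :
    Module.finrank ℂ (level (orbitConeOf ρ v) K m) * moment ρ v μ m = 1 := by
  have := h.finiteDimensional m
  let b := stdOrthonormalBasis ℂ (level (orbitConeOf ρ v) K m)
  have hK := h.continuous_kernel ho m
  -- The trace of the resolution of the identity: by Parseval the integrand sums to `‖K m (ρ g v)‖²
  -- = 1`, while each basis vector integrates to the moment.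
  have h1 : ∀ g, ∑ i, ‖⟪K m (ρ g v), (b i : H)⟫_ℂ‖ ^ 2 = 1 := by
    intro g
    have hm : K m (ρ g v) ∈ level (orbitConeOf ρ v) K m := kernel_mem m (apply_mem_orbitConeOf g)
    have h2 := b.sum_sq_norm_inner_left ⟨_, hm⟩
    have h3 : ‖K m (ρ g v)‖ = 1 :=
      h.norm_kernel m (apply_mem_orbitConeOf g) (by simp [ho.norm_eq])
    simpa [h3] using h2
  have h2 : ∫ g, ∑ i, ‖⟪K m (ρ g v), (b i : H)⟫_ℂ‖ ^ 2 ∂μ = 1 := by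
    simp_rw [h1]; simp
  have hint : ∀ i ∈ Finset.univ, Integrable (fun g => ‖⟪K m (ρ g v), (b i : H)⟫_ℂ‖ ^ 2) μ :=
    fun i _ => Continuous.integrable_of_compactSpace ((hK.inner continuous_const).norm.pow 2) μ
  rw [integral_finsetSum _ hint] at h2
  have hb : ∀ i, ‖(b i : H)‖ = 1 := fun i => b.orthonormal.1 i
  simp_rw [h.integral_norm_inner_sq ho (b _).2, hb] at h2
  simpa using h2

end IsFockSystem

theorem moment_pos_of_system (h : IsFockSystem (orbitConeOf ρ v) K S)
    (ho : IsKahlerOrbit ρ v T φ r) (m : ℕ) : 0 < moment ρ v μ m := by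
  have h1 := h.finrank_mul_moment ho m (μ := μ)
  have h2 : 0 ≤ moment ρ v μ m := integral_nonneg fun g => by positivity
  rcases h2.lt_or_eq with h3 | h3
  · exact h3
  · rw [← h3] at h1; simp at h1

namespace IsFockSystem

/-- The transition-probability weighted second moments `∫ |⟨v, z⟩|^{2m} ⟨z, p⟩ ⟨q, z⟩`. -/
noncomputable def secondMoment (ρ : Γ →* (E ≃ₗᵢ[ℂ] E)) (v : E) (μ : Measure Γ) (m : ℕ)
    (p q : E) : ℂ :=
  ∫ g, ⟪ρ g v, v⟫_ℂ ^ m * ⟪v, ρ g v⟫_ℂ ^ m * (⟪ρ g v, p⟫_ℂ * ⟪q, ρ g v⟫_ℂ) ∂μ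

/-- The resolution of the identity in degree `m + 1`, applied to a moving kernel `K (m + 1) x` and
`S q (K m v)`, is differentiated at `x = v` in a tangent direction. Differentiating the power
produces the factor `m + 1` that ends up in the denominator. -/
theorem secondMoment_tangent (h : IsFockSystem (orbitConeOf ρ v) K S)
    (ho : IsKahlerOrbit ρ v T φ r) (m : ℕ) {η : E} (hη : η ∈ T) (q : E) :
    secondMoment ρ v μ m η q =
      moment ρ v μ (m + 1) * ((⟪q, η⟫_ℂ + m * (⟪v, η⟫_ℂ * ⟪q, v⟫_ℂ)) / (m + 1)) := by
  set X := orbitConeOf ρ v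
  let ℓ := coeffFunctional ho.continuous v
  let w : C(Γ, ℂ) := ⟨fun g => ⟪q, ρ g v⟫_ℂ * ⟪v, ρ g v⟫_ℂ ^ m, by
    have := ho.continuous v
    fun_prop⟩
  have hv : ⟪v, v⟫_ℂ = 1 := by rw [inner_self_eq_ofReal, ho.norm_eq]; simp
  have heq : ∀ x ∈ X, integralFunctional μ (ℓ x ^ (m + 1) * w) =
      moment ρ v μ (m + 1) * (⟪q, x⟫_ℂ * ⟪v, x⟫_ℂ ^ m) := by
    intro x hx
    have h1 := h.integral_inner_mul_inner ho (kernel_mem (m + 1) hx)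
      (h.map_mem_level q (kernel_mem m self_mem_orbitConeOf)) (μ := μ)
    rw [h.inner_succ m x hx, h.inner_same m hx self_mem_orbitConeOf] at h1
    rw [← h1, integralFunctional_apply]
    congr 1
    ext g
    rw [h.inner_same _ hx (apply_mem_orbitConeOf g), h.inner_succ m _ (apply_mem_orbitConeOf g),
      h.inner_same m (apply_mem_orbitConeOf g) self_mem_orbitConeOf]
    rfl
  have hφd : HasDerivAt (fun s : ℂ => φ (v + s • η)) η 0 := by
    have h1 : HasDerivAt (fun s : ℂ => v + s • η) η 0 := by
      simpa using ((hasDerivAt_id (0 : ℂ)).smul_const η).const_add v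
    have h2 : HasFDerivAt φ (fderiv ℂ φ v) (v + (0 : ℂ) • η) := by
      simpa using ho.retraction.hasFDerivAt (mem_ball_self ho.retraction.pos)
    have h3 := h2.comp_hasDerivAt 0 h1
    rwa [ho.retraction.fderiv_self hη] at h3
  have hφ0 : φ (v + (0 : ℂ) • η) = v := by simp [ho.retraction.apply_self]
  have hL : HasDerivAt (fun s : ℂ => integralFunctional μ (ℓ (φ (v + s • η)) ^ (m + 1) * w))
      (integralFunctional μ (((m + 1 : ℕ) : C(Γ, ℂ)) * ℓ v ^ m * ℓ η * w)) 0 := by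
    refine (integralFunctional μ).hasFDerivAt.comp_hasDerivAt 0 ?_
    refine HasDerivAt.mul_const ?_ w
    have h1 : HasDerivAt (fun s : ℂ => ℓ (φ (v + s • η))) (ℓ η) 0 :=
      ℓ.hasFDerivAt.comp_hasDerivAt 0 hφd
    have h2 := h1.fun_pow (m + 1)
    simpa [ho.retraction.apply_self] using h2
  have hR : HasDerivAt (fun s : ℂ => (moment ρ v μ (m + 1) : ℂ) *
      (⟪q, φ (v + s • η)⟫_ℂ * ⟪v, φ (v + s • η)⟫_ℂ ^ m))
      (moment ρ v μ (m + 1) * (⟪q, η⟫_ℂ + m * (⟪v, η⟫_ℂ * ⟪q, v⟫_ℂ))) 0 := by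
    refine HasDerivAt.const_mul _ ?_
    have h1 : ∀ u : E, HasDerivAt (fun s : ℂ => ⟪u, φ (v + s • η)⟫_ℂ) ⟪u, η⟫_ℂ 0 := fun u =>
      (innerSL ℂ u).hasFDerivAt.comp_hasDerivAt 0 hφd
    have h2 := (h1 q).fun_mul ((h1 v).fun_pow m)
    convert h2 using 1
    simp only [hφ0, hv, one_pow, mul_one]
    ring
  have hLR : integralFunctional μ (((m + 1 : ℕ) : C(Γ, ℂ)) * ℓ v ^ m * ℓ η * w) =
      moment ρ v μ (m + 1) * (⟪q, η⟫_ℂ + m * (⟪v, η⟫_ℂ * ⟪q, v⟫_ℂ)) := by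
    refine hL.unique (hR.congr_of_eventuallyEq ?_)
    have hct : ContinuousAt (fun s : ℂ => v + s • η) 0 := by fun_prop
    filter_upwards [hct (by simpa using ball_mem_nhds v ho.retraction.pos)] with s hs
    exact heq _ (ho.retraction.mapsTo _ hs)
  have hm : (m + 1 : ℂ) ≠ 0 := by exact_mod_cast Nat.succ_ne_zero m
  rw [← mul_div_assoc, ← hLR, eq_div_iff hm, secondMoment, mul_comm, ← integral_const_mul,
    integralFunctional_apply]
  congr 1
  ext g
  simp [ℓ, w]
  ring

theorem secondMoment_conj (ρ : Γ →* (E ≃ₗᵢ[ℂ] E)) (v : E) (μ : Measure Γ) (m : ℕ) (p q : E) :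
    conj (secondMoment ρ v μ m p q) = secondMoment ρ v μ m q p := by
  rw [secondMoment, ← integral_conj]
  congr 1
  ext g
  simp only [map_mul, map_pow, inner_conj_symm]
  ring

theorem integrable_secondMoment (ho : IsKahlerOrbit ρ v T φ r) (m : ℕ) (p q : E) :
    Integrable (fun g => ⟪ρ g v, v⟫_ℂ ^ m * ⟪v, ρ g v⟫_ℂ ^ m * (⟪ρ g v, p⟫_ℂ * ⟪q, ρ g v⟫_ℂ)) μ :=
  Continuous.integrable_of_compactSpace (by have := ho.continuous v; fun_prop) μ

theorem secondMoment_add_left (ho : IsKahlerOrbit ρ v T φ r) (m : ℕ) (p p' q : E) :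
    secondMoment ρ v μ m (p + p') q =
      secondMoment ρ v μ m p q + secondMoment ρ v μ m p' q := by
  rw [secondMoment, secondMoment, secondMoment, ← integral_add (integrable_secondMoment ho m p q)
    (integrable_secondMoment ho m p' q)]
  congr 1
  ext g
  rw [inner_add_right]
  ring

/-- The tangential part is given exactly by `secondMoment_tangent`. Mixed tangential-normal terms
vanish, since normal vectors are orthogonal to `T` and in particular to `v ∈ T`. Only the
normal-normal term remains, to be estimated as an error. -/
theorem secondMoment_eq (h : IsFockSystem (orbitConeOf ρ v) K S)
    (ho : IsKahlerOrbit ρ v T φ r) (m : ℕ) (p q : E) :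
    secondMoment ρ v μ m p q = moment ρ v μ (m + 1) *
        ((⟪q, T.starProjection p⟫_ℂ + m * (⟪v, p⟫_ℂ * ⟪q, v⟫_ℂ)) / (m + 1)) +
      secondMoment ρ v μ m (p - T.starProjection p) (q - T.starProjection q) := by
  have hvT : ∀ x, ⟪v, T.starProjection x⟫_ℂ = ⟪v, x⟫_ℂ := fun x => by
    rw [← Submodule.inner_starProjection_left_eq_right,
      Submodule.starProjection_eq_self_iff.2 ho.retraction.mem]
  have hTv : ∀ x, ⟪T.starProjection x, v⟫_ℂ = ⟪x, v⟫_ℂ := fun x => by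
    rw [Submodule.inner_starProjection_left_eq_right,
      Submodule.starProjection_eq_self_iff.2 ho.retraction.mem]
  have h1 : secondMoment ρ v μ m p q = secondMoment ρ v μ m (T.starProjection p) q +
      secondMoment ρ v μ m (p - T.starProjection p) q := by
    rw [← secondMoment_add_left ho, add_sub_cancel]
  have h2 : secondMoment ρ v μ m q (p - T.starProjection p) =
      secondMoment ρ v μ m (T.starProjection q) (p - T.starProjection p) +
      secondMoment ρ v μ m (q - T.starProjection q) (p - T.starProjection p) := by
    rw [← secondMoment_add_left ho, add_sub_cancel]
  have h3 : secondMoment ρ v μ m (T.starProjection q) (p - T.starProjection p) = 0 := by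
    rw [h.secondMoment_tangent ho m (T.starProjection_apply_mem q)]
    have e1 : ⟪p - T.starProjection p, T.starProjection q⟫_ℂ = 0 := by
      rw [← inner_conj_symm, (Submodule.mem_orthogonal _ _).1
        (T.sub_starProjection_mem_orthogonal p) _ (T.starProjection_apply_mem q), map_zero]
    have e2 : ⟪p - T.starProjection p, v⟫_ℂ = 0 := by
      rw [inner_sub_left, hTv, sub_self]
    rw [e1, e2]
    simp
  rw [h1, h.secondMoment_tangent ho m (T.starProjection_apply_mem p), hvT]
  congr 1
  rw [← secondMoment_conj, h2, h3, zero_add, secondMoment_conj]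

end IsFockSystem

end Orbit

/-! ### Polynomial decay of moment sequences. -/

/-- Real sequences that behave like the moments of a homogeneous complex manifold of
dimension `d`. -/
structure IsMomentSequence (a : ℕ → ℝ) (d : ℕ) (C : ℝ) : Prop where
  pos : ∀ m, 0 < a m
  nonneg : 0 ≤ C
  le_sub : ∀ m, d * a (m + 1) / (m + 1) ≤ a m - a (m + 1)
  sub_le : ∀ m, a m - a (m + 1) ≤
    d * a (m + 1) / (m + 1) + C * (a m - 2 * a (m + 1) + a (m + 2))
  sq_le : ∀ m, a (m + 1) ^ 2 ≤ a m * a (m + 2)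
  subexp : ∀ s, 0 < s → s < 1 → ∃ c, 0 < c ∧ ∀ m, c * s ^ m ≤ a m

namespace IsMomentSequence

variable {a : ℕ → ℝ} {d : ℕ} {C : ℝ}

/-- The relative decrement of a sequence. -/
noncomputable def decrement (a : ℕ → ℝ) (m : ℕ) : ℝ := (a m - a (m + 1)) / a (m + 1)

theorem decrement_nonneg (h : IsMomentSequence a d C) (m : ℕ) : 0 ≤ decrement a m := by
  have h1 := h.le_sub m
  have h2 := h.pos (m + 1)
  have h3 : 0 ≤ d * a (m + 1) / (m + 1) := by positivity
  exact div_nonneg (h3.trans h1) h2.le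

theorem one_add_decrement (h : IsMomentSequence a d C) (m : ℕ) :
    a m = (1 + decrement a m) * a (m + 1) := by
  have h2 := (h.pos (m + 1)).ne'
  unfold decrement
  field_simp
  ring

/-- This is log-convexity, `sq_le`: the ratios `a m / a (m + 1)` decrease. -/
theorem decrement_antitone (h : IsMomentSequence a d C) : Antitone (decrement a) := by
  refine antitone_nat_of_succ_le fun m => ?_
  have h0 := h.pos (m + 1)
  have h1 := h.pos (m + 2)
  unfold decrement
  rw [div_le_div_iff₀ h1 h0]
  nlinarith [h.sq_le m]

/-- `sub_le` divided by `a (m + 1)`, with the next ratio expanded through `1 / (1 + x) ≤ 1 - x +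
x²`. The term linear in the decrements becomes a telescoping difference. -/
theorem decrement_le (h : IsMomentSequence a d C) (m : ℕ) :
    decrement a m ≤ d / (m + 1) +
      C * (decrement a m - decrement a (m + 1) + decrement a m ^ 2) := by
  have h0 := h.pos (m + 1)
  have h1 := h.pos (m + 2)
  have hq := h.decrement_nonneg (m + 1)
  have hqq := h.decrement_antitone (Nat.le_succ m)
  have e1 : a (m + 2) / a (m + 1) ≤ 1 - decrement a (m + 1) + decrement a (m + 1) ^ 2 := by
    rw [div_le_iff₀ h0, h.one_add_decrement (m + 1)]
    nlinarith [mul_nonneg (pow_nonneg hq 3) h1.le]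
  have e2 : decrement a (m + 1) ^ 2 ≤ decrement a m ^ 2 := pow_le_pow_left₀ hq hqq 2
  have e3 : decrement a m ≤ d / (m + 1) + C * (decrement a m - 1 + a (m + 2) / a (m + 1)) := by
    have := h.sub_le m
    unfold decrement
    rw [div_le_iff₀ h0]
    calc a m - a (m + 1) ≤ _ := this
      _ = _ := by field_simp; ring
  have e4 : decrement a m - 1 + a (m + 2) / a (m + 1) ≤
      decrement a m - decrement a (m + 1) + decrement a m ^ 2 := by linarith
  linarith [mul_le_mul_of_nonneg_left e4 h.nonneg]

/-- Decrements bounded below by `L` would force decay like `(1 + L)^{-m}`, against `subexp` at the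
larger rate `1 / (1 + L / 2)`. -/
theorem exists_decrement_lt (h : IsMomentSequence a d C) {L : ℝ} (hL : 0 < L) :
    ∃ M, decrement a M < L := by
  by_contra! hcon
  obtain ⟨c, hc, hca⟩ := h.subexp (1 / (1 + L / 2)) (by positivity)
    (by rw [div_lt_one (by positivity)]; linarith)
  have h1 : ∀ m, (1 + L) ^ m * a m ≤ a 0 := by
    intro m
    induction m with
    | zero => simp
    | succ m ih =>
      refine le_trans ?_ ih
      rw [pow_succ, mul_assoc]
      gcongr
      rw [h.one_add_decrement m]
      have := h.pos (m + 1)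
      gcongr
      exact hcon m
  have h2 : ∀ m, c * ((1 + L) / (1 + L / 2)) ^ m ≤ a 0 := by
    intro m
    refine le_trans ?_ (h1 m)
    calc c * ((1 + L) / (1 + L / 2)) ^ m = (1 + L) ^ m * (c * (1 / (1 + L / 2)) ^ m) := by
          rw [div_pow, div_pow, one_pow]; ring
      _ ≤ _ := by gcongr; exact hca m
  have h3 : 1 < (1 + L) / (1 + L / 2) := by rw [lt_div_iff₀ (by positivity)]; linarith
  obtain ⟨m, hm⟩ := pow_unbounded_of_one_lt (a 0 / c) h3
  rw [div_lt_iff₀ hc] at hm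
  linarith [h2 m]

/-- Summing `decrement_le` from `M` to `2M - 1` telescopes the differences, and by monotonicity
every summand on the left is at least the decrement at `2M`. -/
theorem double_decrement_le (h : IsMomentSequence a d C) (M : ℕ) (hM : 0 < M) :
    M * decrement a (2 * M) ≤ d + C * decrement a M + C * (M * decrement a M ^ 2) := by
  have h1 : ∀ k, k * decrement a (M + k) ≤ k * (d / M) +
      C * (decrement a M - decrement a (M + k)) + C * (k * decrement a M ^ 2) := by
    have hC := h.nonneg
    have hM' : (0 : ℝ) < M := by exact_mod_cast hM
    intro k
    suffices h2 : ∑ i ∈ Finset.range k, decrement a (M + i) ≤ k * (d / M) +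
        C * (decrement a M - decrement a (M + k)) + C * (k * decrement a M ^ 2) by
      refine le_trans ?_ h2
      calc (k : ℝ) * decrement a (M + k) = ∑ i ∈ Finset.range k, decrement a (M + k) := by simp
        _ ≤ _ := Finset.sum_le_sum fun i hi => h.decrement_antitone
          (by have := Finset.mem_range.1 hi; omega)
    induction k with
    | zero => simp
    | succ k ih =>
      rw [Finset.sum_range_succ]
      have e1 := h.decrement_le (M + k)
      have e2 : decrement a (M + k) ^ 2 ≤ decrement a M ^ 2 :=
        pow_le_pow_left₀ (h.decrement_nonneg _) (h.decrement_antitone (by omega)) 2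
      have e3 : (d : ℝ) / ((M + k : ℕ) + 1) ≤ d / M := by
        gcongr
        push_cast
        linarith [Nat.cast_nonneg (α := ℝ) k]
      have e4 := mul_le_mul_of_nonneg_left e2 hC
      rw [← add_assoc]
      push_cast at *
      nlinarith
  have h2 := h1 M
  have hM' : (M : ℝ) ≠ 0 := by exact_mod_cast hM.ne'
  rw [← two_mul, mul_div_cancel₀ _ hM'] at h2
  have := mul_nonneg h.nonneg (h.decrement_nonneg (2 * M))
  linarith

/-- Bootstrap over doublings: once the decrement at `M` is small against `1 / C`, the quadratic term
in `double_decrement_le` costs only a fraction of the bound assumed at `M`, so the same constant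
survives at `2M`. -/
theorem exists_mul_decrement_le (h : IsMomentSequence a d C) :
    ∃ B, 0 ≤ B ∧ ∀ m : ℕ, (m + 1) * decrement a m ≤ B := by
  have hC := h.nonneg
  obtain ⟨M₀, hM₀⟩ := h.exists_decrement_lt (show 0 < 1 / (4 * (C + 1)) by positivity)
  have hsmall : ∀ M, M₀ ≤ M → 2 * C * decrement a M ≤ 1 / 2 := by
    intro M hM
    have h1 := (h.decrement_antitone hM).trans hM₀.le
    calc 2 * C * decrement a M ≤ 2 * C * (1 / (4 * (C + 1))) := by gcongr
      _ ≤ 1 / 2 := by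
        rw [mul_one_div, div_le_div_iff₀ (by positivity) (by norm_num)]
        linarith
  have h0 := h.decrement_nonneg 0
  have hle0 : ∀ m, decrement a m ≤ decrement a 0 := fun m => h.decrement_antitone (Nat.zero_le m)
  -- The part `4d + 2` absorbs the doubling step through `2d + 1 + B / 2 ≤ B`, the next term pays
  -- for odd indices, and the last covers the initial range `m ≤ 2 * M₀ + 2`.
  set B := 4 * d + 2 + 2 * decrement a 0 + (2 * M₀ + 2) * decrement a 0 with hB
  have hB0 : 0 ≤ B := by positivity
  have key : ∀ m : ℕ, m * decrement a m ≤ B := by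
    intro m
    induction m using Nat.strong_induction_on with
    | _ m ih =>
    by_cases hm : m ≤ 2 * M₀ + 2
    · have h1 : (m : ℝ) ≤ 2 * M₀ + 2 := by exact_mod_cast hm
      have h2 : (m : ℝ) * decrement a m ≤ (2 * M₀ + 2) * decrement a 0 :=
        mul_le_mul h1 (hle0 m) (h.decrement_nonneg m) (by positivity)
      have h3 : (0 : ℝ) ≤ 4 * d + 2 + 2 * decrement a 0 := by positivity
      linarith
    · have hj : ∀ j : ℕ, 0 < j → M₀ ≤ j → j < m →
          (2 * j) * decrement a (2 * j) ≤ 2 * d + 1 + B / 2 := by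
        intro j hj0 hj hjm
        have h1 := h.double_decrement_le j hj0
        have h2 := hsmall j hj
        have h3 := ih j hjm
        have h4 := mul_le_mul h2 h3 (mul_nonneg (Nat.cast_nonneg j) (h.decrement_nonneg j))
          (by norm_num)
        nlinarith
      rcases Nat.even_or_odd' m with ⟨j, rfl | rfl⟩
      · have h1 := hj j (by omega) (by omega) (by omega)
        have h3 : (0 : ℝ) ≤ (2 * M₀ + 2) * decrement a 0 := by positivity
        push_cast
        linarith
      · have h1 := hj j (by omega) (by omega) (by omega)
        have h2 : decrement a (2 * j + 1) ≤ decrement a (2 * j) := h.decrement_antitone (by omega)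
        have h4 := hle0 (2 * j)
        have h5 : ((2 * j + 1 : ℕ) : ℝ) * decrement a (2 * j + 1) ≤
            (2 * j + 1) * decrement a (2 * j) := by push_cast; gcongr
        have h3 : (0 : ℝ) ≤ (2 * M₀ + 2) * decrement a 0 := by positivity
        refine h5.trans ?_
        linarith
  refine ⟨B + decrement a 0, by positivity, fun m => ?_⟩
  linarith [key m, hle0 m]

/-- By `le_sub` the product `a m * (m + 1) ⋯ (m + d)` does not increase, and the product of the `d`
factors is at least `(m + 1) ^ d`. -/
theorem exists_le_div (h : IsMomentSequence a d C) :
    ∃ A, 0 < A ∧ ∀ m : ℕ, a m ≤ A / (m + 1) ^ d := by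
  have h1 : ∀ m, a m * (m + d).descFactorial d ≤ a 0 * d.descFactorial d := by
    intro m
    induction m with
    | zero => simp
    | succ m ih =>
      refine le_trans ?_ ih
      have e1 := Nat.succ_descFactorial (m + d) d
      have e2 : m + d + 1 - d = m + 1 := by omega
      rw [e2] at e1
      have e3 : ((m : ℝ) + 1) * (m + d + 1).descFactorial d =
          (m + d + 1) * (m + d).descFactorial d := by exact_mod_cast e1
      have e4 := h.le_sub m
      have e5 : a (m + 1) * (m + 1 + d) ≤ a m * (m + 1) := by
        have hm : (0 : ℝ) < m + 1 := by positivity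
        rw [div_le_iff₀ hm] at e4
        linarith
      have e6 : m + 1 + d = m + d + 1 := by ring
      rw [e6]
      refine le_of_mul_le_mul_left ?_ (show (0 : ℝ) < m + 1 by positivity)
      calc ((m : ℝ) + 1) * (a (m + 1) * (m + d + 1).descFactorial d)
          = a (m + 1) * (((m : ℝ) + 1) * (m + d + 1).descFactorial d) := by ring
        _ = a (m + 1) * (m + 1 + d) * (m + d).descFactorial d := by rw [e3]; ring
        _ ≤ a m * (m + 1) * (m + d).descFactorial d := by gcongr
        _ = _ := by ring
  refine ⟨a 0 * d.descFactorial d, ?_, fun m => ?_⟩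
  · have := h.pos 0
    have : 0 < d.descFactorial d := by simp [Nat.descFactorial_self, Nat.factorial_pos]
    positivity
  · rw [le_div_iff₀ (by positivity)]
    refine le_trans ?_ (h1 m)
    have := (h.pos m).le
    gcongr
    have e := Nat.pow_sub_le_descFactorial (m + d) d
    have e2 : m + d + 1 - d = m + 1 := by omega
    rw [e2] at e
    exact_mod_cast e

/-- `a 0 / a m` is the product of the factors `1 + decrement`, hence at most the exponential of the
sum of decrements. Summing `decrement_le` gives `d` times a harmonic sum, a telescoping term, and a
convergent series since the decrements are `O(1/m)`; altogether `d log (m + 1) + O(1)`. -/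
theorem exists_div_le (h : IsMomentSequence a d C) :
    ∃ A, 0 < A ∧ ∀ m : ℕ, A / (m + 1) ^ d ≤ a m := by
  obtain ⟨B, hB, hBm⟩ := h.exists_mul_decrement_le
  have hC := h.nonneg
  have hs : Summable fun n : ℕ => (1 : ℝ) / ((n + 1 : ℕ) : ℝ) ^ 2 :=
    (summable_nat_add_iff 1).2 (Real.summable_one_div_nat_pow.2 (by norm_num))
  set Z := ∑' n : ℕ, (1 : ℝ) / ((n + 1 : ℕ) : ℝ) ^ 2
  have hsum : ∀ m : ℕ, ∑ i ∈ Finset.range m, decrement a i ≤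
      d * ∑ i ∈ Finset.range m, ((i : ℝ) + 1)⁻¹ + C * decrement a 0 - C * decrement a m +
      C * B ^ 2 * ∑ i ∈ Finset.range m, (1 : ℝ) / ((i + 1 : ℕ) : ℝ) ^ 2 := by
    intro m
    induction m with
    | zero => simp
    | succ m ih =>
      rw [Finset.sum_range_succ, Finset.sum_range_succ, Finset.sum_range_succ]
      have e1 := h.decrement_le m
      have e2 : decrement a m ^ 2 ≤ B ^ 2 * (1 / ((m + 1 : ℕ) : ℝ) ^ 2) := by
        have : decrement a m ≤ B / (m + 1) := by
          rw [le_div_iff₀ (by positivity), mul_comm]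
          exact hBm m
        calc decrement a m ^ 2 ≤ (B / (m + 1)) ^ 2 :=
              pow_le_pow_left₀ (h.decrement_nonneg m) this 2
          _ = _ := by push_cast; field_simp
      have e3 := mul_le_mul_of_nonneg_left e2 hC
      rw [div_eq_mul_inv] at e1
      nlinarith
  have hsum2 : ∀ m : ℕ, ∑ i ∈ Finset.range m, decrement a i ≤
      d * (1 + Real.log (m + 1)) + (C * decrement a 0 + C * B ^ 2 * Z) := by
    intro m
    have e1 : ∑ i ∈ Finset.range m, ((i : ℝ) + 1)⁻¹ ≤ 1 + Real.log (m + 1) := by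
      have e := harmonic_le_one_add_log m
      simp only [harmonic] at e
      push_cast at e
      refine e.trans ?_
      rcases Nat.eq_zero_or_pos m with rfl | hm
      · simp
      · have : (0 : ℝ) < m := by exact_mod_cast hm
        gcongr
        linarith
    have e2 : ∑ i ∈ Finset.range m, (1 : ℝ) / ((i + 1 : ℕ) : ℝ) ^ 2 ≤ Z :=
      hs.sum_le_tsum _ fun i _ => by positivity
    have e3 := hsum m
    have e4 := mul_nonneg hC (h.decrement_nonneg m)
    have e5 := mul_le_mul_of_nonneg_left e1 (Nat.cast_nonneg (α := ℝ) d)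
    have e6 := mul_le_mul_of_nonneg_left e2 (show 0 ≤ C * B ^ 2 by positivity)
    linarith
  have hprod : ∀ m : ℕ, a 0 ≤ a m * Real.exp (∑ i ∈ Finset.range m, decrement a i) := by
    intro m
    induction m with
    | zero => simp
    | succ m ih =>
      rw [Finset.sum_range_succ, Real.exp_add]
      refine ih.trans ?_
      have e1 : 1 + decrement a m ≤ Real.exp (decrement a m) := by
        linarith [Real.add_one_le_exp (decrement a m)]
      have e2 := h.pos (m + 1)
      rw [h.one_add_decrement m]
      calc (1 + decrement a m) * a (m + 1) * Real.exp (∑ i ∈ Finset.range m, decrement a i)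
          ≤ Real.exp (decrement a m) * a (m + 1) *
            Real.exp (∑ i ∈ Finset.range m, decrement a i) := by gcongr
        _ = _ := by ring
  set W := Real.exp (d + (C * decrement a 0 + C * B ^ 2 * Z))
  refine ⟨a 0 / W, div_pos (h.pos 0) (Real.exp_pos _), fun m => ?_⟩
  rw [div_div, div_le_iff₀ (by positivity)]
  refine (hprod m).trans ?_
  have := (h.pos m).le
  gcongr
  calc Real.exp (∑ i ∈ Finset.range m, decrement a i) ≤
        Real.exp (d * (1 + Real.log (m + 1)) + (C * decrement a 0 + C * B ^ 2 * Z)) :=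
        Real.exp_le_exp.2 (hsum2 m)
    _ = W * (m + 1) ^ d := by
      have : ((m : ℝ) + 1) ^ d = Real.exp (d * Real.log (m + 1)) := by
        rw [mul_comm, Real.exp_mul, Real.exp_log (by positivity), Real.rpow_natCast]
      rw [this, ← Real.exp_add]
      congr 1
      ring

/-- The moments decay polynomially, hence are doubling. -/
theorem exists_le_mul (h : IsMomentSequence a d C) (k : ℕ) :
    ∃ D, 0 < D ∧ ∀ m M : ℕ, M + 1 ≤ k * (m + 1) → a m ≤ D * a M := by
  obtain ⟨A, hA, hAm⟩ := h.exists_le_div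
  obtain ⟨A', hA', hAm'⟩ := h.exists_div_le
  refine ⟨A / A' * (k + 1) ^ d, by positivity, fun m M hM => ?_⟩
  have h1 : ((M : ℝ) + 1) ≤ (k + 1) * (m + 1) := by
    have : ((M : ℝ) + 1) ≤ k * (m + 1) := by exact_mod_cast hM
    nlinarith [Nat.cast_nonneg (α := ℝ) m]
  calc a m ≤ A / (m + 1) ^ d := hAm m
    _ = A / A' * (k + 1) ^ d * (A' / ((k + 1) * (m + 1)) ^ d) := by
      rw [mul_pow]; field_simp
    _ ≤ A / A' * (k + 1) ^ d * (A' / (M + 1) ^ d) := by gcongr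
    _ ≤ _ := by gcongr; exact hAm' M

end IsMomentSequence

/-! ### The moments of an orbit form a moment sequence. -/

section Orbit

variable {Γ E H : Type*} [Group Γ] [NormedAddCommGroup E] [InnerProductSpace ℂ E]
  [NormedAddCommGroup H] [InnerProductSpace ℂ H] [CompleteSpace H]
  [TopologicalSpace Γ] [IsTopologicalGroup Γ] [CompactSpace Γ] [MeasurableSpace Γ] [BorelSpace Γ]
  [FiniteDimensional ℂ E] {ρ : Γ →* (E ≃ₗᵢ[ℂ] E)} {v : E} {T : Submodule ℂ E} {φ : E → E}
  {r : ℝ} {μ : Measure Γ} [IsProbabilityMeasure μ] [μ.IsMulLeftInvariant]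
  {K : ℕ → E → H} {S : E → H →L[ℂ] H}

/-- The transition probability between the lines through `v` and `ρ g v`. -/
noncomputable def transition (ρ : Γ →* (E ≃ₗᵢ[ℂ] E)) (v : E) (g : Γ) : ℝ := ‖⟪v, ρ g v⟫_ℂ‖ ^ 2

namespace IsKahlerOrbit

theorem norm_apply (ho : IsKahlerOrbit ρ v T φ r) (g : Γ) : ‖ρ g v‖ = 1 := by
  simp [ho.norm_eq]

theorem continuous_transition (ho : IsKahlerOrbit ρ v T φ r) : Continuous (transition ρ v) :=
  (continuous_const.inner (ho.continuous v)).norm.pow 2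

theorem transition_nonneg (g : Γ) : 0 ≤ transition ρ v g := by unfold transition; positivity

theorem transition_le_one (ho : IsKahlerOrbit ρ v T φ r) (g : Γ) : transition ρ v g ≤ 1 := by
  have h := norm_inner_le_norm (𝕜 := ℂ) v (ρ g v)
  rw [ho.norm_eq, ho.norm_apply, mul_one] at h
  exact pow_le_one₀ (norm_nonneg _) h

theorem transition_one (ho : IsKahlerOrbit ρ v T φ r) : transition ρ v 1 = 1 := by
  simp [transition, ho.norm_eq]

theorem integrable_transition_pow (ho : IsKahlerOrbit ρ v T φ r) (m : ℕ) :
    Integrable (fun g => transition ρ v g ^ m) μ :=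
  Continuous.integrable_of_compactSpace (ho.continuous_transition.pow m) μ

theorem moment_eq (m : ℕ) : moment ρ v μ m = ∫ g, transition ρ v g ^ m ∂μ := rfl

theorem integral_transition_sq (ho : IsKahlerOrbit ρ v T φ r) (m : ℕ) (s : ℝ) :
    ∫ g, transition ρ v g ^ m * (s - transition ρ v g) ^ 2 ∂μ =
      s ^ 2 * moment ρ v μ m - 2 * s * moment ρ v μ (m + 1) + moment ρ v μ (m + 2) := by
  rw [moment_eq, moment_eq, moment_eq, ← integral_const_mul, ← integral_const_mul, ← integral_sub,
    ← integral_add]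
  · congr 1; ext g; ring
  · exact ((ho.integrable_transition_pow m).const_mul _).sub
      ((ho.integrable_transition_pow (m + 1)).const_mul _)
  · exact ho.integrable_transition_pow _
  · exact (ho.integrable_transition_pow m).const_mul _
  · exact (ho.integrable_transition_pow (m + 1)).const_mul _

/-- A phase rotation makes `⟨v, c • gv⟩` positive, and then `‖c • gv - v‖² ≤ 2(1 - t)`. Near `v` the
quadratic tangency of the cone gives a normal part of size `O(1 - t)`. Elsewhere `1 - t` is bounded
below and the normal part is at most 1. -/
theorem exists_norm_sub_starProjection_sq_le (ho : IsKahlerOrbit ρ v T φ r) :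
    ∃ C, 0 ≤ C ∧ ∀ g, ‖ρ g v - T.starProjection (ρ g v)‖ ^ 2 ≤ C * (1 - transition ρ v g) ^ 2 := by
  obtain ⟨C₀, ε, hε, hC₀⟩ := ho.retraction.exists_norm_sub_le
  -- `4 * C₀ ^ 2` serves the points near `v`, `(4 / ε ^ 2) ^ 2` those with `1 - t ≥ ε² / 4`, and the
  -- summand 1 those with `t = 0`, where no phase is available.
  refine ⟨4 * C₀ ^ 2 + ((4 / ε ^ 2) ^ 2 + 1), by positivity, fun g => ?_⟩
  set t := transition ρ v g with ht
  have ht0 : 0 ≤ t := transition_nonneg g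
  have ht1 : t ≤ 1 := ho.transition_le_one g
  have hle1 : ‖ρ g v - T.starProjection (ρ g v)‖ ≤ 1 := by
    have h1 := T.norm_sq_eq_add_norm_sq_starProjection (ρ g v)
    rw [ho.norm_apply, Submodule.starProjection_orthogonal_val] at h1
    nlinarith [sq_nonneg ‖T.starProjection (ρ g v)‖,
      norm_nonneg (ρ g v - T.starProjection (ρ g v))]
  by_cases hcase : ε ^ 2 / 4 ≤ 1 - t ∨ t = 0
  · have h1 : 1 ≤ 4 / ε ^ 2 * (1 - t) ∨ t = 0 := by
      refine hcase.imp_left fun h => ?_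
      rw [div_mul_eq_mul_div, le_div_iff₀ (by positivity)]
      linarith
    have h2 : ‖ρ g v - T.starProjection (ρ g v)‖ ^ 2 ≤ 1 := pow_le_one₀ (norm_nonneg _) hle1
    have h3 : 1 ≤ ((4 / ε ^ 2) ^ 2 + 1) * (1 - t) ^ 2 := by
      rcases h1 with h | h
      · have h4 : 1 ≤ (4 / ε ^ 2) ^ 2 * (1 - t) ^ 2 := by
          rw [← mul_pow]
          exact one_le_pow₀ h
        nlinarith [sq_nonneg (1 - t)]
      · rw [h]
        have : 0 ≤ (4 / ε ^ 2) ^ 2 := by positivity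
        linarith
    refine h2.trans (h3.trans ?_)
    have : 0 ≤ 4 * C₀ ^ 2 := by positivity
    exact mul_le_mul_of_nonneg_right (by linarith) (sq_nonneg _)
  · push Not at hcase
    obtain ⟨hcase, ht⟩ := hcase
    set s := ⟪v, ρ g v⟫_ℂ with hs
    have hs0 : ‖s‖ ≠ 0 := fun h => ht (by simp [t, transition, ← hs, h])
    have hsc : (‖s‖ : ℂ) ≠ 0 := by exact_mod_cast hs0
    have hsne : s ≠ 0 := norm_ne_zero_iff.1 hs0
    set c : ℂ := conj s / ‖s‖ with hc
    have hcn : ‖c‖ = 1 := by simp [hc, hs0]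
    have hcne : c ≠ 0 := by rw [← norm_ne_zero_iff, hcn]; exact one_ne_zero
    have hin : ⟪v, c • ρ g v⟫_ℂ = (‖s‖ : ℂ) := by
      rw [inner_smul_right, ← hs, hc, div_mul_eq_mul_div, ← Complex.normSq_eq_conj_mul_self,
        Complex.normSq_eq_norm_sq]
      push_cast
      field_simp
    have hts : t = ‖s‖ ^ 2 := rfl
    have hs1 : ‖s‖ ≤ 1 := by nlinarith [norm_nonneg s]
    have hd : ‖c • ρ g v - v‖ ^ 2 = 2 - 2 * ‖s‖ := by
      rw [norm_sub_rev, @norm_sub_sq ℂ, hin, norm_smul, hcn, ho.norm_apply, ho.norm_eq]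
      simp only [RCLike.re_to_complex, Complex.ofReal_re]
      ring
    have hd2 : ‖c • ρ g v - v‖ ^ 2 ≤ 2 * (1 - t) := by
      rw [hd, hts]; nlinarith [norm_nonneg s]
    have hball : c • ρ g v ∈ ball v ε := by
      rw [mem_ball_iff_norm]
      refine lt_of_pow_lt_pow_left₀ 2 hε.le ?_
      nlinarith
    have h1 := hC₀ _ hball (smul_mem_orbitConeOf hcne (apply_mem_orbitConeOf g))
    rw [map_smul, ← smul_sub, norm_smul, hcn, one_mul] at h1
    have h2 : ‖ρ g v - T.starProjection (ρ g v)‖ ≤ |C₀| * (2 * (1 - t)) :=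
      h1.trans (mul_le_mul (le_abs_self _) hd2 (sq_nonneg _) (abs_nonneg _))
    have h3 := pow_le_pow_left₀ (norm_nonneg _) h2 2
    rw [mul_pow, sq_abs] at h3
    have h4 : 0 ≤ ((4 / ε ^ 2) ^ 2 + 1) * (1 - t) ^ 2 := by positivity
    nlinarith

/-- The set where the transition probability exceeds `s` is open and contains the identity, so it
has positive measure, which serves as the constant. -/
theorem le_moment_of_lt_one [μ.IsOpenPosMeasure] (ho : IsKahlerOrbit ρ v T φ r) {s : ℝ}
    (hs : 0 < s) (hs1 : s < 1) : ∃ c, 0 < c ∧ ∀ m, c * s ^ m ≤ moment ρ v μ m := by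
  set U : Set Γ := {g | s < transition ρ v g}
  have hU : IsOpen U := isOpen_lt continuous_const ho.continuous_transition
  have hpos : 0 < μ U := hU.measure_pos μ ⟨1, by simp [U, ho.transition_one, hs1]⟩
  refine ⟨μ.real U, ENNReal.toReal_pos hpos.ne' (measure_ne_top _ _), fun m => ?_⟩
  calc μ.real U * s ^ m = ∫ _ in U, s ^ m ∂μ := by simp
    _ ≤ ∫ g in U, transition ρ v g ^ m ∂μ := by
      refine setIntegral_mono_on (integrable_const _) (ho.integrable_transition_pow m).integrableOn
        hU.measurableSet fun g hg => ?_
      exact pow_le_pow_left₀ hs.le (le_of_lt hg) m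
    _ ≤ ∫ g, transition ρ v g ^ m ∂μ := by
      refine setIntegral_le_integral (ho.integrable_transition_pow m) ?_
      exact Eventually.of_forall fun g => pow_nonneg (transition_nonneg g) m


theorem inner_mul_inner_pow (g : Γ) (m : ℕ) :
    ⟪ρ g v, v⟫_ℂ ^ m * ⟪v, ρ g v⟫_ℂ ^ m = ((transition ρ v g ^ m : ℝ) : ℂ) := by
  rw [← mul_pow, ← inner_conj_symm, ← Complex.normSq_eq_conj_mul_self, Complex.normSq_eq_norm_sq]
  push_cast
  simp [transition]

/-- The normal projection is self-adjoint and can be moved onto `gv`. Each of the two factors then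
carries the normal part of `gv`, which together are worth `C (1 - t)²`. -/
theorem norm_secondMoment_normal_le (ho : IsKahlerOrbit ρ v T φ r) {C : ℝ}
    (hC : ∀ g, ‖ρ g v - T.starProjection (ρ g v)‖ ^ 2 ≤ C * (1 - transition ρ v g) ^ 2)
    (m : ℕ) (p q : E) :
    ‖IsFockSystem.secondMoment ρ v μ m (p - T.starProjection p) (q - T.starProjection q)‖ ≤
      C * ‖p‖ * ‖q‖ * (moment ρ v μ m - 2 * moment ρ v μ (m + 1) + moment ρ v μ (m + 2)) := by
  have e1 : moment ρ v μ m - 2 * moment ρ v μ (m + 1) + moment ρ v μ (m + 2) =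
      ∫ g, transition ρ v g ^ m * (1 - transition ρ v g) ^ 2 ∂μ := by
    rw [ho.integral_transition_sq]; ring
  rw [e1, ← integral_const_mul]
  refine norm_integral_le_of_norm_le (Continuous.integrable_of_compactSpace ?_ μ)
    (Eventually.of_forall fun g => ?_)
  · have := ho.continuous_transition
    fun_prop
  have hsym : ∀ x y : E, ⟪x, y - T.starProjection y⟫_ℂ = ⟪x - T.starProjection x, y⟫_ℂ :=
    fun x y => by
      rw [inner_sub_left, inner_sub_right, Submodule.inner_starProjection_left_eq_right]
  rw [inner_mul_inner_pow, norm_mul, Complex.norm_real, Real.norm_of_nonneg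
    (pow_nonneg (transition_nonneg g) m), norm_mul, hsym, ← hsym q]
  have h1 := norm_inner_le_norm (𝕜 := ℂ) (ρ g v - T.starProjection (ρ g v)) p
  have h2 := norm_inner_le_norm (𝕜 := ℂ) q (ρ g v - T.starProjection (ρ g v))
  have h3 := transition_nonneg (ρ := ρ) (v := v) g
  calc _ ≤ transition ρ v g ^ m * ((‖ρ g v - T.starProjection (ρ g v)‖ * ‖p‖) *
        (‖q‖ * ‖ρ g v - T.starProjection (ρ g v)‖)) := by gcongr
    _ = transition ρ v g ^ m * (‖p‖ * ‖q‖ * ‖ρ g v - T.starProjection (ρ g v)‖ ^ 2) := by ring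
    _ ≤ transition ρ v g ^ m * (‖p‖ * ‖q‖ * (C * (1 - transition ρ v g) ^ 2)) := by
      gcongr; exact hC g
    _ = _ := by ring

end IsKahlerOrbit

namespace IsFockSystem

/-- The sum of `secondMoment_tangent` over an orthonormal basis of `T`: the norms contribute `d +
1`, and the components of the unit vector `v ∈ T` contribute `m`. -/
theorem integral_norm_starProjection_sq (h : IsFockSystem (orbitConeOf ρ v) K S)
    (ho : IsKahlerOrbit ρ v T φ r) {d : ℕ} (hd : Module.finrank ℂ T = d + 1) (m : ℕ) :
    ∫ g, transition ρ v g ^ m * ‖T.starProjection (ρ g v)‖ ^ 2 ∂μ =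
      moment ρ v μ (m + 1) * ((d + 1 + m) / (m + 1)) := by
  let b := stdOrthonormalBasis ℂ T
  have hTv : T.starProjection v = v := Submodule.starProjection_eq_self_iff.2 ho.retraction.mem
  have h1 : ∀ g, transition ρ v g ^ m * ‖T.starProjection (ρ g v)‖ ^ 2 =
      ∑ i, transition ρ v g ^ m * ‖⟪(b i : E), ρ g v⟫_ℂ‖ ^ 2 := by
    intro g
    rw [← Finset.mul_sum, Submodule.starProjection_apply, ← Submodule.coe_norm,
      ← b.sum_sq_norm_inner_right]
    congr 2
    ext i
    rw [Submodule.coe_inner, ← Submodule.starProjection_apply,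
      ← Submodule.inner_starProjection_left_eq_right,
      Submodule.starProjection_eq_self_iff.2 (b i).2]
  have h2 : ∀ i, ∫ g, transition ρ v g ^ m * ‖⟪(b i : E), ρ g v⟫_ℂ‖ ^ 2 ∂μ =
      moment ρ v μ (m + 1) * ((1 + m * ‖⟪(b i : E), v⟫_ℂ‖ ^ 2) / (m + 1)) := by
    intro i
    have e1 := h.secondMoment_tangent ho m (b i).2 (b i : E) (μ := μ)
    have e2 : secondMoment ρ v μ m (b i : E) (b i : E) =
        ((∫ g, transition ρ v g ^ m * ‖⟪(b i : E), ρ g v⟫_ℂ‖ ^ 2 ∂μ : ℝ) : ℂ) := by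
      rw [← integral_complex_ofReal, secondMoment]
      congr 1
      ext g
      rw [IsKahlerOrbit.inner_mul_inner_pow, ← inner_conj_symm, ← Complex.normSq_eq_conj_mul_self,
        Complex.normSq_eq_norm_sq]
      push_cast
      rfl
    have hbn : ‖(b i : E)‖ = 1 := b.orthonormal.1 i
    rw [e2, inner_self_eq_ofReal, hbn, ← inner_conj_symm v, ← Complex.normSq_eq_conj_mul_self,
      Complex.normSq_eq_norm_sq, one_pow] at e1
    exact_mod_cast e1
  simp_rw [h1]
  rw [integral_finsetSum]
  · simp_rw [h2]
    rw [← Finset.mul_sum, ← Finset.sum_div, Finset.sum_add_distrib, ← Finset.mul_sum]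
    have e3 : ∑ i, ‖⟪(b i : E), v⟫_ℂ‖ ^ 2 = 1 := by
      have := b.sum_sq_norm_inner_right ⟨v, ho.retraction.mem⟩
      simpa [ho.norm_eq] using this
    rw [e3]
    simp [hd]
  · intro i _
    refine Continuous.integrable_of_compactSpace ?_ μ
    have := ho.continuous_transition
    have := ho.continuous v
    fun_prop

/-- Pythagoras for the unit vector `gv`, integrated against `t^m`: the tangential part is known
exactly, and the normal part is nonnegative and bounded by the second difference `∫ t^m (1 - t)²`.
-/
theorem isMomentSequence [μ.IsOpenPosMeasure] (h : IsFockSystem (orbitConeOf ρ v) K S)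
    (ho : IsKahlerOrbit ρ v T φ r) {d : ℕ} (hd : Module.finrank ℂ T = d + 1) {C : ℝ} (hC0 : 0 ≤ C)
    (hC : ∀ g, ‖ρ g v - T.starProjection (ρ g v)‖ ^ 2 ≤ C * (1 - transition ρ v g) ^ 2) :
    IsMomentSequence (moment ρ v μ) d C := by
  have hpos := fun m => moment_pos_of_system h ho m (μ := μ)
  have hsplit : ∀ m, moment ρ v μ m = moment ρ v μ (m + 1) * ((d + 1 + m) / (m + 1)) +
      ∫ g, transition ρ v g ^ m * ‖ρ g v - T.starProjection (ρ g v)‖ ^ 2 ∂μ := by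
    intro m
    have hc := ho.continuous_transition
    have hcv := ho.continuous v
    rw [← h.integral_norm_starProjection_sq ho hd, ← integral_add, IsKahlerOrbit.moment_eq]
    · congr 1
      ext g
      have h1 := T.norm_sq_eq_add_norm_sq_starProjection (ρ g v)
      rw [ho.norm_apply, Submodule.starProjection_orthogonal_val] at h1
      rw [← mul_add, ← h1]
      simp
    · exact Continuous.integrable_of_compactSpace (by fun_prop) μ
    · exact Continuous.integrable_of_compactSpace (by fun_prop) μ
  have hfrac : ∀ m : ℕ, moment ρ v μ (m + 1) * ((d + 1 + m) / (m + 1)) =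
      moment ρ v μ (m + 1) + d * moment ρ v μ (m + 1) / (m + 1) := fun m => by
    field_simp; ring
  refine ⟨hpos, hC0, fun m => ?_, fun m => ?_, fun m => ?_,
    fun s hs hs1 => ho.le_moment_of_lt_one hs hs1⟩
  · have h1 : 0 ≤ ∫ g, transition ρ v g ^ m * ‖ρ g v - T.starProjection (ρ g v)‖ ^ 2 ∂μ :=
      integral_nonneg fun g => mul_nonneg (pow_nonneg (IsKahlerOrbit.transition_nonneg g) m)
        (sq_nonneg _)
    linarith [hsplit m, hfrac m]
  · have h1 : ∫ g, transition ρ v g ^ m * ‖ρ g v - T.starProjection (ρ g v)‖ ^ 2 ∂μ ≤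
        C * (moment ρ v μ m - 2 * moment ρ v μ (m + 1) + moment ρ v μ (m + 2)) := by
      have e1 : moment ρ v μ m - 2 * moment ρ v μ (m + 1) + moment ρ v μ (m + 2) =
          ∫ g, transition ρ v g ^ m * (1 - transition ρ v g) ^ 2 ∂μ := by
        rw [ho.integral_transition_sq]; ring
      have hc := ho.continuous_transition
      have hcv := ho.continuous v
      rw [e1, ← integral_const_mul]
      refine integral_mono (Continuous.integrable_of_compactSpace (by fun_prop) μ)
        (Continuous.integrable_of_compactSpace (by fun_prop) μ) fun g => ?_
      have h3 := mul_le_mul_of_nonneg_left (hC g)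
        (pow_nonneg (IsKahlerOrbit.transition_nonneg (ρ := ρ) (v := v) g) m)
      simp only
      linarith
    linarith [hsplit m, hfrac m]
  -- Cauchy–Schwarz in disguise: the quadratic `∫ t^m (s - t)²` is taken at its minimum `s = a_{m+1}
  -- / a_m`.
  · have h1 : 0 ≤ ∫ g, transition ρ v g ^ m *
        (moment ρ v μ (m + 1) / moment ρ v μ m - transition ρ v g) ^ 2 ∂μ :=
      integral_nonneg fun g => mul_nonneg (pow_nonneg (IsKahlerOrbit.transition_nonneg g) m)
        (sq_nonneg _)
    rw [ho.integral_transition_sq] at h1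
    have h2 := hpos m
    have h3 := mul_nonneg h1 h2.le
    field_simp at h3
    nlinarith

end IsFockSystem

end Orbit

/-! ### The upper bound: commutators are of order `1 / m`. -/

section Orbit

variable {Γ E H : Type*} [Group Γ] [NormedAddCommGroup E] [InnerProductSpace ℂ E]
  [NormedAddCommGroup H] [InnerProductSpace ℂ H] [CompleteSpace H]
  [TopologicalSpace Γ] [IsTopologicalGroup Γ] [CompactSpace Γ] [MeasurableSpace Γ] [BorelSpace Γ]
  [FiniteDimensional ℂ E] {ρ : Γ →* (E ≃ₗᵢ[ℂ] E)} {v : E} {T : Submodule ℂ E} {φ : E → E}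
  {r : ℝ} {μ : Measure Γ} [IsProbabilityMeasure μ] [μ.IsMulLeftInvariant]
  {K : ℕ → E → H} {S : E → H →L[ℂ] H}

/-- The integral kernel of the deviation of a cross-commutator from a multiple of the product. -/
noncomputable def commutatorKernel (m : ℕ) (p q z w : E) : ℂ :=
  ⟪w, z⟫_ℂ ^ m * (⟪q, z - ⟪w, z⟫_ℂ • w⟫_ℂ * ⟪w - ⟪z, w⟫_ℂ • z, p⟫_ℂ)

theorem norm_sub_inner_smul_sq {z w : E} (hz : ‖z‖ = 1) (hw : ‖w‖ = 1) :
    ‖z - ⟪w, z⟫_ℂ • w‖ ^ 2 = 1 - ‖⟪w, z⟫_ℂ‖ ^ 2 := by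
  rw [@norm_sub_sq ℂ, inner_smul_right, norm_smul, hw, hz, ← inner_conj_symm z w,
    Complex.mul_conj, Complex.normSq_eq_norm_sq]
  simp only [RCLike.re_to_complex, Complex.ofReal_re]
  ring

/-- Each of the two differences is a component orthogonal to the other unit vector, of length `√(1 -
|⟨w, z⟩|²)`; together they supply the factor `1 - t`. -/
theorem norm_commutatorKernel_le {j m : ℕ} (hj : 2 * j ≤ m) (p q : E) {z w : E}
    (hz : ‖z‖ = 1) (hw : ‖w‖ = 1) :
    ‖commutatorKernel m p q z w‖ ≤
      ‖p‖ * ‖q‖ * ((‖⟪w, z⟫_ℂ‖ ^ 2) ^ j * (1 - ‖⟪w, z⟫_ℂ‖ ^ 2)) := by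
  have hc : ‖⟪w, z⟫_ℂ‖ ≤ 1 := by simpa [hz, hw] using norm_inner_le_norm (𝕜 := ℂ) w z
  have h1 := norm_inner_le_norm (𝕜 := ℂ) q (z - ⟪w, z⟫_ℂ • w)
  have h2 := norm_inner_le_norm (𝕜 := ℂ) (w - ⟪z, w⟫_ℂ • z) p
  have h3 := norm_sub_inner_smul_sq hz hw
  have h4 := norm_sub_inner_smul_sq hw hz
  rw [norm_inner_symm z w] at h4
  have h5 : ‖w - ⟪z, w⟫_ℂ • z‖ = ‖z - ⟪w, z⟫_ℂ • w‖ := by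
    rw [← sq_eq_sq₀ (norm_nonneg _) (norm_nonneg _), h3, h4]
  have h6 : ‖⟪w, z⟫_ℂ‖ ^ m ≤ (‖⟪w, z⟫_ℂ‖ ^ 2) ^ j := by
    rw [← pow_mul]
    exact pow_le_pow_of_le_one (norm_nonneg _) hc hj
  rw [h5] at h2
  rw [commutatorKernel, norm_mul, norm_mul, norm_pow, ← h3]
  calc _ ≤ (‖⟪w, z⟫_ℂ‖ ^ 2) ^ j * ((‖q‖ * ‖z - ⟪w, z⟫_ℂ • w‖) * (‖z - ⟪w, z⟫_ℂ • w‖ * ‖p‖)) := by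
        gcongr
    _ = _ := by ring

namespace IsFockSystem

/-- With `a, a'` consecutive moments, the identity says that `a²` times the commutator form equals
`(a - a')² ⟨f, S_p^* S_q f'⟩` minus the double integral. The first term is negligible because `a -
a'` is `O(a' / m)`, and the second has a kernel vanishing on the diagonal. -/
theorem integral_commutatorKernel (h : IsFockSystem (orbitConeOf ρ v) K S)
    (ho : IsKahlerOrbit ρ v T φ r) (k : ℕ) (p q : E) {f f' : H}
    (hf : f ∈ level (orbitConeOf ρ v) K (k + 1)) (hf' : f' ∈ level (orbitConeOf ρ v) K (k + 1)) :
    ∫ x, ∫ y, ⟪f, K (k + 1) (ρ x v)⟫_ℂ * (commutatorKernel k p q (ρ x v) (ρ y v) *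
        ⟪K (k + 1) (ρ y v), f'⟫_ℂ) ∂μ ∂μ =
      moment ρ v μ (k + 1) ^ 2 * ⟪f, S q ((S p).adjoint f')⟫_ℂ +
        (moment ρ v μ (k + 2) ^ 2 - 2 * moment ρ v μ (k + 1) * moment ρ v μ (k + 2)) *
          ⟪f, (S p).adjoint (S q f')⟫_ℂ := by
  set m := k + 1 with hm
  set a := moment ρ v μ m
  set a' := moment ρ v μ (m + 1) with ha'
  have hX : ∀ g : Γ, ρ g v ∈ orbitConeOf ρ v := apply_mem_orbitConeOf
  have hKm := h.continuous_kernel ho m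
  have hKm' := h.continuous_kernel ho (m + 1)
  have hK := ho.continuous v
  have hW : (S p).adjoint (S q f') ∈ level (orbitConeOf ρ v) K m :=
    h.adjoint_mem_level p (h.map_mem_level q hf')
  have hR : S q ((S p).adjoint f') ∈ level (orbitConeOf ρ v) K m :=
    h.map_mem_level q (h.adjoint_mem_level p hf')
  have hint : ∀ {F : Γ → ℂ}, Continuous F → Integrable F μ := fun hF =>
    hF.integrable_of_compactSpace μ
  obtain ⟨w, hw⟩ : ∃ w : Γ → E, ∀ g, ρ g v = w g := ⟨_, fun _ => rfl⟩
  obtain ⟨κ, hκ⟩ : ∃ κ : Γ → H, ∀ g, K m (w g) = κ g := ⟨_, fun _ => rfl⟩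
  have hwc : Continuous w := by simpa only [hw] using hK
  have hκc : Continuous κ := by simpa only [hw, hκ] using hKm
  -- Multiplying out the kernel gives four terms; `e1` to `e4` evaluate their integrals in `y`,
  -- using the resolution of the identity in degree `m` for the first two and `m + 1` for the last
  -- two.
  have e1 : ∀ x, ∫ y, ⟪ρ y v, ρ x v⟫_ℂ ^ k * (⟪q, ρ x v⟫_ℂ * ⟪ρ y v, p⟫_ℂ) *
      ⟪K m (ρ y v), f'⟫_ℂ ∂μ = a * ⟪K m (ρ x v), S q ((S p).adjoint f')⟫_ℂ := by
    intro x
    have h1 : (S p) ((S q).adjoint (K m (ρ x v))) ∈ level (orbitConeOf ρ v) K m :=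
      h.map_mem_level p (h.adjoint_mem_level q (kernel_mem m (hX x)))
    have h2 := h.integral_inner_mul_inner ho h1 hf' (μ := μ)
    rw [← ContinuousLinearMap.adjoint_inner_right, ← ContinuousLinearMap.adjoint_inner_right,
      ContinuousLinearMap.adjoint_adjoint] at h2
    rw [← h2]
    congr 1
    ext y
    congr 1
    rw [← ContinuousLinearMap.adjoint_inner_right, h.adjoint_kernel_succ p k (hX y),
      h.adjoint_kernel_succ q k (hX x), inner_smul_left, inner_smul_right, inner_conj_symm,
      h.inner_same k (hX x) (hX y)]
    ring
  have e2 : ∀ x, ∫ y, ⟪ρ y v, ρ x v⟫_ℂ ^ m * ⟪K m (ρ y v), f'⟫_ℂ ∂μ = a * ⟪K m (ρ x v), f'⟫_ℂ := by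
    intro x
    rw [← h.integral_inner_mul_inner ho (kernel_mem m (hX x)) hf' (μ := μ)]
    congr 1
    ext y
    rw [h.inner_same m (hX x) (hX y)]
  have e3 : ∀ x, ∫ y, ⟪ρ y v, ρ x v⟫_ℂ ^ m * (⟪q, ρ y v⟫_ℂ * ⟪ρ y v, p⟫_ℂ) *
      ⟪K m (ρ y v), f'⟫_ℂ ∂μ = a' * ⟪K m (ρ x v), (S p).adjoint (S q f')⟫_ℂ := by
    intro x
    have h2 := h.integral_inner_mul_inner ho (h.map_mem_level p (kernel_mem m (hX x)))
      (h.map_mem_level q hf') (μ := μ)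
    rw [← ContinuousLinearMap.adjoint_inner_right] at h2
    rw [← h2]
    congr 1
    ext y
    rw [← ContinuousLinearMap.adjoint_inner_right, h.adjoint_kernel_succ p m (hX y),
      inner_smul_right, h.inner_succ m _ (hX y), h.inner_same m (hX x) (hX y)]
    ring
  have e4 : ∀ x, ∫ y, ⟪ρ y v, ρ x v⟫_ℂ ^ (m + 1) * ⟪q, ρ y v⟫_ℂ * ⟪K m (ρ y v), f'⟫_ℂ ∂μ =
      a' * (⟪q, ρ x v⟫_ℂ * ⟪K m (ρ x v), f'⟫_ℂ) := by
    intro x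
    rw [← h.inner_succ m _ (hX x), ← h.integral_inner_mul_inner ho (kernel_mem (m + 1) (hX x))
      (h.map_mem_level q hf') (μ := μ)]
    congr 1
    ext y
    rw [h.inner_same (m + 1) (hX x) (hX y), h.inner_succ m _ (hX y)]
    ring
  have hinner : ∀ x, ∫ y, commutatorKernel k p q (ρ x v) (ρ y v) * ⟪K m (ρ y v), f'⟫_ℂ ∂μ =
      a * ⟪K m (ρ x v), S q ((S p).adjoint f')⟫_ℂ
        - ⟪q, ρ x v⟫_ℂ * ⟪ρ x v, p⟫_ℂ * (a * ⟪K m (ρ x v), f'⟫_ℂ)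
        - a' * ⟪K m (ρ x v), (S p).adjoint (S q f')⟫_ℂ
        + ⟪ρ x v, p⟫_ℂ * (a' * (⟪q, ρ x v⟫_ℂ * ⟪K m (ρ x v), f'⟫_ℂ)) := by
    intro x
    rw [← e1, ← e2, ← e3, ← e4, ← integral_const_mul, ← integral_const_mul, ← integral_sub,
      ← integral_sub, ← integral_add]
    · congr 1
      ext y
      simp only [commutatorKernel, inner_sub_left, inner_sub_right, inner_smul_left,
        inner_smul_right, inner_conj_symm, hm]
      ring
    all_goals exact hint (by simp only [hw, hκ]; fun_prop)
  have e5 : ∫ x, ⟪f, K m (ρ x v)⟫_ℂ * (⟪q, ρ x v⟫_ℂ * ⟪ρ x v, p⟫_ℂ * ⟪K m (ρ x v), f'⟫_ℂ) ∂μ =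
      a' * ⟪f, (S p).adjoint (S q f')⟫_ℂ := by
    rw [ContinuousLinearMap.adjoint_inner_right, ← h.integral_inner_mul_inner ho
      (h.map_mem_level p hf) (h.map_mem_level q hf') (μ := μ)]
    congr 1
    ext x
    rw [← ContinuousLinearMap.adjoint_inner_right, h.adjoint_kernel_succ p m (hX x),
      inner_smul_right, h.inner_succ m _ (hX x)]
    ring
  have e6 := h.integral_inner_mul_inner ho hf hR (μ := μ)
  have e7 := h.integral_inner_mul_inner ho hf hW (μ := μ)
  have hfin : ∀ x, ∫ y, ⟪f, K m (ρ x v)⟫_ℂ * (commutatorKernel k p q (ρ x v) (ρ y v) *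
        ⟪K m (ρ y v), f'⟫_ℂ) ∂μ =
      a * (⟪f, K m (ρ x v)⟫_ℂ * ⟪K m (ρ x v), S q ((S p).adjoint f')⟫_ℂ)
        + (a' - a) * (⟪f, K m (ρ x v)⟫_ℂ *
          (⟪q, ρ x v⟫_ℂ * ⟪ρ x v, p⟫_ℂ * ⟪K m (ρ x v), f'⟫_ℂ))
        - a' * (⟪f, K m (ρ x v)⟫_ℂ * ⟪K m (ρ x v), (S p).adjoint (S q f')⟫_ℂ) := by
    intro x
    rw [integral_const_mul, hinner]
    ring
  simp_rw [hfin]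
  rw [integral_sub, integral_add, integral_const_mul, integral_const_mul, integral_const_mul,
    e5, e6, e7]
  · ring
  all_goals exact hint (by simp only [hw, hκ]; fun_prop)

/-- Left translation by `x` brings the base point back to `v`, so the integral does not depend on
`x`. -/
theorem integral_transition_kernel (ho : IsKahlerOrbit ρ v T φ r) (j : ℕ) (x : Γ) :
    ∫ y, (‖⟪ρ y v, ρ x v⟫_ℂ‖ ^ 2) ^ j * (1 - ‖⟪ρ y v, ρ x v⟫_ℂ‖ ^ 2) ∂μ =
      moment ρ v μ j - moment ρ v μ (j + 1) := by
  rw [← integral_mul_left_eq_self _ x, IsKahlerOrbit.moment_eq, IsKahlerOrbit.moment_eq,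
    ← integral_sub (ho.integrable_transition_pow j) (ho.integrable_transition_pow (j + 1))]
  congr 1
  ext y
  have h1 : ‖⟪ρ (x * y) v, ρ x v⟫_ℂ‖ ^ 2 = transition ρ v y := by
    rw [transition, norm_inner_symm, map_mul]
    exact congrArg (‖·‖ ^ 2) ((ρ x).inner_map_map v (ρ y v))
  rw [h1]
  ring

/-- Schur's test: the majorant `ζ` is symmetric with constant marginal `a_j - a_{j+1}`, and the
product of the two coefficient functions is split by the arithmetic-geometric inequality. -/
theorem norm_integral_commutatorKernel_le (h : IsFockSystem (orbitConeOf ρ v) K S)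
    (ho : IsKahlerOrbit ρ v T φ r) {j k m : ℕ} (hj : 2 * j ≤ k) (p q : E) {f f' : H}
    (hf : f ∈ level (orbitConeOf ρ v) K m) (hf' : f' ∈ level (orbitConeOf ρ v) K m) :
    ‖∫ x, ∫ y, ⟪f, K m (ρ x v)⟫_ℂ * (commutatorKernel k p q (ρ x v) (ρ y v) *
        ⟪K m (ρ y v), f'⟫_ℂ) ∂μ ∂μ‖ ≤
      ‖p‖ * ‖q‖ * (moment ρ v μ j - moment ρ v μ (j + 1)) *
        (moment ρ v μ m * ((‖f‖ ^ 2 + ‖f'‖ ^ 2) / 2)) := by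
  have hK := ho.continuous v
  have hKm := h.continuous_kernel ho m
  obtain ⟨ζ, hζd⟩ : ∃ ζ : Γ → Γ → ℝ, ∀ x y,
      (‖⟪ρ y v, ρ x v⟫_ℂ‖ ^ 2) ^ j * (1 - ‖⟪ρ y v, ρ x v⟫_ℂ‖ ^ 2) = ζ x y := ⟨_, fun _ _ => rfl⟩
  have hζ : ∀ x y, ζ x y = ζ y x := fun x y => by
    rw [← hζd, ← hζd, norm_inner_symm]
  have hζc : Continuous fun z : Γ × Γ => ζ z.1 z.2 := by
    have h1 : Continuous fun z : Γ × Γ => ρ z.1 v := hK.comp continuous_fst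
    have h2 : Continuous fun z : Γ × Γ => ρ z.2 v := hK.comp continuous_snd
    simp only [← hζd]
    have h3 : Continuous fun z : Γ × Γ => ‖⟪ρ z.2 v, ρ z.1 v⟫_ℂ‖ ^ 2 := (h2.inner h1).norm.pow 2
    exact (h3.pow j).mul (continuous_const.sub h3)
  have hζ1 : ∀ x, Continuous fun y => ζ x y := fun x => hζc.comp (Continuous.prodMk_right x)
  have hζI : ∀ x, ∫ y, ζ x y ∂μ = moment ρ v μ j - moment ρ v μ (j + 1) := by
    intro x
    simp only [← hζd]
    exact integral_transition_kernel ho j x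
  set κ := moment ρ v μ j - moment ρ v μ (j + 1)
  obtain ⟨A, hAd⟩ : ∃ A : Γ → ℝ, ∀ x, ‖⟪K m (ρ x v), f⟫_ℂ‖ ^ 2 = A x := ⟨_, fun _ => rfl⟩
  obtain ⟨B, hBd⟩ : ∃ B : Γ → ℝ, ∀ x, ‖⟪K m (ρ x v), f'⟫_ℂ‖ ^ 2 = B x := ⟨_, fun _ => rfl⟩
  have hA : Continuous A := by
    simp only [← funext hAd]
    exact (hKm.inner continuous_const).norm.pow 2
  have hB : Continuous B := by
    simp only [← funext hBd]
    exact (hKm.inner continuous_const).norm.pow 2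
  have hAI : ∫ x, A x ∂μ = moment ρ v μ m * ‖f‖ ^ 2 := by
    simp only [← hAd]
    exact h.integral_norm_inner_sq ho hf
  have hBI : ∫ x, B x ∂μ = moment ρ v μ m * ‖f'‖ ^ 2 := by
    simp only [← hBd]
    exact h.integral_norm_inner_sq ho hf'
  have hint : ∀ {F : Γ → ℝ}, Continuous F → Integrable F μ := fun hF =>
    hF.integrable_of_compactSpace μ
  have hpt : ∀ x y, ‖⟪f, K m (ρ x v)⟫_ℂ * (commutatorKernel k p q (ρ x v) (ρ y v) *
        ⟪K m (ρ y v), f'⟫_ℂ)‖ ≤ ‖p‖ * ‖q‖ / 2 * (A x * ζ x y + ζ x y * B y) := by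
    intro x y
    have h1 := norm_commutatorKernel_le hj p q (ho.norm_apply x) (ho.norm_apply y)
    rw [norm_mul, norm_mul, norm_inner_symm f]
    rw [hζd] at h1
    have h2 := two_mul_le_add_sq ‖⟪K m (ρ x v), f⟫_ℂ‖ ‖⟪K m (ρ y v), f'⟫_ℂ‖
    have h3 : 0 ≤ ‖p‖ * ‖q‖ * ζ x y := (norm_nonneg _).trans h1
    calc _ ≤ ‖⟪K m (ρ x v), f⟫_ℂ‖ * (‖p‖ * ‖q‖ * ζ x y * ‖⟪K m (ρ y v), f'⟫_ℂ‖) := by gcongr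
      _ = ‖p‖ * ‖q‖ * ζ x y / 2 *
          (2 * ‖⟪K m (ρ x v), f⟫_ℂ‖ * ‖⟪K m (ρ y v), f'⟫_ℂ‖) := by ring
      _ ≤ ‖p‖ * ‖q‖ * ζ x y / 2 * (A x + B y) := by
        rw [← hAd, ← hBd]
        gcongr
      _ = _ := by ring
  have hsw : ∫ x, ∫ y, ζ x y * B y ∂μ ∂μ = ∫ y, ∫ x, ζ x y * B y ∂μ ∂μ := by
    refine integral_integral_swap_of_hasCompactSupport (f := fun x y => ζ x y * B y) ?_
      (HasCompactSupport.of_compactSpace _)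
    exact hζc.mul (hB.comp continuous_snd)
  have hI2 : ∫ x, ∫ y, ζ x y * B y ∂μ ∂μ = κ * (moment ρ v μ m * ‖f'‖ ^ 2) := by
    rw [hsw, ← hBI, ← integral_const_mul]
    congr 1
    ext y
    rw [integral_mul_const]
    simp_rw [hζ _ y]
    rw [hζI]
  have hcζB : Continuous fun x => ∫ y, ζ x y * B y ∂μ := by
    refine continuousOn_univ.1 (continuousOn_integral_of_compact_support (k := univ)
      isCompact_univ (hζc.mul (hB.comp continuous_snd)).continuousOn fun _ x _ hx => ?_)
    exact absurd (mem_univ x) hx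
  have hbound : ∀ x, ‖∫ y, ⟪f, K m (ρ x v)⟫_ℂ * (commutatorKernel k p q (ρ x v) (ρ y v) *
        ⟪K m (ρ y v), f'⟫_ℂ) ∂μ‖ ≤ ‖p‖ * ‖q‖ / 2 * (A x * κ + ∫ y, ζ x y * B y ∂μ) := by
    intro x
    have h1 : Continuous fun y => ζ x y * B y := (hζ1 x).mul hB
    rw [← hζI x, ← integral_const_mul, ← integral_add (hint ((hζ1 x).const_mul _)) (hint h1),
      ← integral_const_mul]
    refine norm_integral_le_of_norm_le (hint ?_) (Eventually.of_forall (hpt x))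
    exact (((hζ1 x).const_mul _).add h1).const_mul _
  refine (norm_integral_le_of_norm_le (hint ?_) (Eventually.of_forall hbound)).trans ?_
  · exact ((hA.mul_const _).add hcζB).const_mul _
  · rw [integral_const_mul, integral_add (hint (hA.mul_const _)) (hint hcζB), integral_mul_const,
      hI2, hAI]
    apply le_of_eq
    ring

/-- The cross-commutators are of order `1 / m` on the component of degree `m`. -/
theorem exists_norm_mulCommutator_le [μ.IsOpenPosMeasure]
    (h : IsFockSystem (orbitConeOf ρ v) K S) (ho : IsKahlerOrbit ρ v T φ r)
    {d : ℕ} {C : ℝ} (ha : IsMomentSequence (moment ρ v μ) d C) (p q : E) :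
    ∃ A, 0 ≤ A ∧ ∀ (m : ℕ), ∀ f ∈ level (orbitConeOf ρ v) K m,
      ‖mulCommutator S p q f‖ ≤ A / (m + 1) * ‖f‖ := by
  obtain ⟨B, hB, hBm⟩ := ha.exists_mul_decrement_le
  -- The factor 3 comes from `k + 2 ≤ 3 (k / 2 + 1)`: the Schur bound is taken at `j = k / 2`, and
  -- doubling returns to the moment of degree `k + 1`.
  obtain ⟨D, hD, hDm⟩ := ha.exists_le_mul 3
  -- The three summands pay for the term `(a - a')²`, for the integral operator, and for degree 0,
  -- to which the integral formula does not apply.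
  set A := B * (‖S p‖ * ‖S q‖) + ‖p‖ * ‖q‖ * (3 * B * D) + ‖mulCommutator S p q‖ with hA
  have hA0 : 0 ≤ A := by positivity
  have hsub : ∀ m : ℕ, moment ρ v μ m - moment ρ v μ (m + 1) ≤
      B / (m + 1) * moment ρ v μ (m + 1) := by
    intro m
    have h1 := hBm m
    have h2 := ha.pos (m + 1)
    unfold IsMomentSequence.decrement at h1
    rw [← mul_div_assoc, div_le_iff₀ h2] at h1
    rw [div_mul_eq_mul_div, le_div_iff₀ (by positivity)]
    linarith
  have hanti : ∀ m, moment ρ v μ (m + 1) ≤ moment ρ v μ m := fun m => by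
    have h1 := ha.le_sub m
    have h2 := ha.pos (m + 1)
    have h3 : 0 ≤ d * moment ρ v μ (m + 1) / (m + 1) := by positivity
    linarith
  have key : ∀ k : ℕ, ∀ f ∈ level (orbitConeOf ρ v) K (k + 1),
      ∀ f' ∈ level (orbitConeOf ρ v) K (k + 1), ‖f‖ = 1 → ‖f'‖ = 1 →
      ‖⟪f, mulCommutator S p q f'⟫_ℂ‖ ≤ A / ((k + 1 : ℕ) + 1) := by
    intro k f hf f' hf' hf1 hf1'
    have h1 := h.integral_commutatorKernel ho k p q hf hf' (μ := μ)
    have h2 := h.norm_integral_commutatorKernel_le ho (j := k / 2) (k := k) (by omega) p q hf hf'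
      (μ := μ)
    rw [h1, hf1, hf1'] at h2
    set a := moment ρ v μ (k + 1)
    set a' := moment ρ v μ (k + 2)
    have ha0 : 0 < a := ha.pos _
    have ha0' : 0 < a' := ha.pos _
    have e1 : (a : ℂ) ^ 2 * ⟪f, mulCommutator S p q f'⟫_ℂ =
        (((a - a') ^ 2 : ℝ) : ℂ) * ⟪f, (S p).adjoint (S q f')⟫_ℂ -
        ((a : ℂ) ^ 2 * ⟪f, S q ((S p).adjoint f')⟫_ℂ + ((a' : ℂ) ^ 2 - 2 * a * a') *
          ⟪f, (S p).adjoint (S q f')⟫_ℂ) := by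
      have : mulCommutator S p q f' = (S p).adjoint (S q f') - S q ((S p).adjoint f') := rfl
      rw [this, inner_sub_right]
      push_cast
      ring
    have e2 : a ^ 2 * ‖⟪f, mulCommutator S p q f'⟫_ℂ‖ ≤
        (a - a') ^ 2 * (‖S p‖ * ‖S q‖) +
          ‖p‖ * ‖q‖ * (moment ρ v μ (k / 2) - moment ρ v μ (k / 2 + 1)) * a := by
      have e3 : ‖(a : ℂ) ^ 2 * ⟪f, mulCommutator S p q f'⟫_ℂ‖ =
          a ^ 2 * ‖⟪f, mulCommutator S p q f'⟫_ℂ‖ := by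
        rw [norm_mul, norm_pow, Complex.norm_real, Real.norm_of_nonneg ha0.le]
      rw [← e3, e1]
      refine (norm_sub_le _ _).trans (add_le_add ?_ (h2.trans (le_of_eq (by ring))))
      rw [norm_mul, Complex.norm_real, Real.norm_of_nonneg (sq_nonneg _),
        ContinuousLinearMap.adjoint_inner_right]
      gcongr
      refine (norm_inner_le_norm _ _).trans ?_
      have e4 := (S p).le_opNorm f
      have e5 := (S q).le_opNorm f'
      rw [hf1, mul_one] at e4
      rw [hf1', mul_one] at e5
      gcongr
    have hk : (0 : ℝ) < (k + 1 : ℕ) + 1 := by positivity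
    have e6 : (a - a') ^ 2 ≤ a ^ 2 * (B / ((k + 1 : ℕ) + 1)) := by
      have e7 : a - a' ≤ B / ((k + 1 : ℕ) + 1) * a' := hsub (k + 1)
      have e8 : a' ≤ a := hanti (k + 1)
      have e9 : a - a' ≤ a := by linarith
      have e10 : B / ((k + 1 : ℕ) + 1) * a' ≤ B / ((k + 1 : ℕ) + 1) * a := by gcongr
      calc (a - a') ^ 2 = (a - a') * (a - a') := by ring
        _ ≤ a * (B / ((k + 1 : ℕ) + 1) * a) :=
          mul_le_mul e9 (e7.trans e10) (by linarith) ha0.le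
        _ = _ := by ring
    have e11 : moment ρ v μ (k / 2) - moment ρ v μ (k / 2 + 1) ≤
        3 * B * D / ((k + 1 : ℕ) + 1) * a := by
      have e12 := hsub (k / 2)
      have e13 : moment ρ v μ (k / 2 + 1) ≤ D * a :=
        (hanti (k / 2)).trans (hDm (k / 2) (k + 1) (by omega))
      have e14 : B / ((k / 2 : ℕ) + 1) ≤ 3 * B / ((k + 1 : ℕ) + 1) := by
        rw [div_le_div_iff₀ (by positivity) hk]
        have : ((k + 1 : ℕ) : ℝ) + 1 ≤ 3 * ((k / 2 : ℕ) + 1) := by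
          have : (k + 1) + 1 ≤ 3 * (k / 2 + 1) := by omega
          exact_mod_cast this
        nlinarith
      calc _ ≤ B / ((k / 2 : ℕ) + 1) * moment ρ v μ (k / 2 + 1) := e12
        _ ≤ 3 * B / ((k + 1 : ℕ) + 1) * (D * a) :=
          mul_le_mul e14 e13 (ha.pos _).le (by positivity)
        _ = _ := by ring
    have e15 : a ^ 2 * ‖⟪f, mulCommutator S p q f'⟫_ℂ‖ ≤ a ^ 2 * (A / ((k + 1 : ℕ) + 1)) := by
      refine e2.trans ?_
      have e16 := mul_le_mul_of_nonneg_right e6 (show 0 ≤ ‖S p‖ * ‖S q‖ by positivity)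
      have e17 := mul_le_mul_of_nonneg_right (mul_le_mul_of_nonneg_left e11
        (show 0 ≤ ‖p‖ * ‖q‖ by positivity)) ha0.le
      have e18 : 0 ≤ a ^ 2 * (‖mulCommutator S p q‖ / ((k + 1 : ℕ) + 1)) := by positivity
      calc _ ≤ _ := add_le_add e16 e17
        _ ≤ a ^ 2 * (B / ((k + 1 : ℕ) + 1)) * (‖S p‖ * ‖S q‖) +
            ‖p‖ * ‖q‖ * (3 * B * D / ((k + 1 : ℕ) + 1) * a) * a +
            a ^ 2 * (‖mulCommutator S p q‖ / ((k + 1 : ℕ) + 1)) := by linarith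
        _ = _ := by rw [hA]; ring
    exact le_of_mul_le_mul_left e15 (by positivity)
  refine ⟨A, hA0, fun m f hf => ?_⟩
  rcases m with _ | k
  · have h1 := (mulCommutator S p q).le_opNorm f
    refine h1.trans ?_
    have : ‖mulCommutator S p q‖ ≤ A := by rw [hA]; linarith [show
      0 ≤ B * (‖S p‖ * ‖S q‖) + ‖p‖ * ‖q‖ * (3 * B * D) by positivity]
    simp only [Nat.cast_zero, zero_add, div_one]
    gcongr
  · by_cases hf0 : f = 0
    · simp [hf0]
    by_cases hTf : mulCommutator S p q f = 0
    · rw [hTf, norm_zero]; positivity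
    have hn := norm_ne_zero_iff.2 hf0
    have hn' := norm_ne_zero_iff.2 hTf
    -- The norm is read off by pairing with the normalized image, which lies in the same level.
    have h1 := key k (((‖mulCommutator S p q f‖⁻¹ : ℝ) : ℂ) • mulCommutator S p q f)
      (Submodule.smul_mem _ _ (h.mulCommutator_mem_level p q hf))
      (((‖f‖⁻¹ : ℝ) : ℂ) • f) (Submodule.smul_mem _ _ hf)
      (by rw [norm_smul, Complex.norm_real, norm_inv, norm_norm, inv_mul_cancel₀ hn'])
      (by rw [norm_smul, Complex.norm_real, norm_inv, norm_norm, inv_mul_cancel₀ hn])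
    rw [map_smul, inner_smul_left, inner_smul_right, inner_self_eq_ofReal, norm_mul, norm_mul,
      Complex.conj_ofReal, Complex.norm_real, Complex.norm_real, Complex.norm_real, norm_inv,
      norm_inv, norm_norm, norm_norm, norm_pow, norm_norm] at h1
    have e : ‖mulCommutator S p q f‖⁻¹ * (‖f‖⁻¹ * ‖mulCommutator S p q f‖ ^ 2) =
        ‖mulCommutator S p q f‖ / ‖f‖ := by field_simp
    rw [e, div_le_iff₀ (by positivity)] at h1
    exact h1

end IsFockSystem

end Orbit

/-! ### The leading symbol and the lower bound. -/

section Orbit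

variable {Γ E H : Type*} [Group Γ] [NormedAddCommGroup E] [InnerProductSpace ℂ E]
  [NormedAddCommGroup H] [InnerProductSpace ℂ H] [CompleteSpace H]
  [TopologicalSpace Γ] [IsTopologicalGroup Γ] [CompactSpace Γ] [MeasurableSpace Γ] [BorelSpace Γ]
  [FiniteDimensional ℂ E] {ρ : Γ →* (E ≃ₗᵢ[ℂ] E)} {v : E} {T : Submodule ℂ E} {φ : E → E}
  {r : ℝ} {μ : Measure Γ} [IsProbabilityMeasure μ] [μ.IsMulLeftInvariant]
  {K : ℕ → E → H} {S : E → H →L[ℂ] H}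

/-- The leading symbol of a cross-commutator at the point `ρ g v` of the orbit. -/
noncomputable def commutatorSymbol (ρ : Γ →* (E ≃ₗᵢ[ℂ] E)) (v : E) (T : Submodule ℂ E) (p q : E)
    (g : Γ) : ℂ :=
  ⟪ρ g⁻¹ q, T.starProjection (ρ g⁻¹ p)⟫_ℂ - ⟪v, ρ g⁻¹ p⟫_ℂ * ⟪ρ g⁻¹ q, v⟫_ℂ

/-- Each of the `j + 1` terms of the geometric sum is at least `t ^ j`, and the sum times `1 - t` is
at most 1. -/
theorem pow_mul_one_sub_le {t : ℝ} (h0 : 0 ≤ t) (h1 : t ≤ 1) (j : ℕ) :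
    t ^ j * (1 - t) ≤ 1 / (j + 1) := by
  rw [le_div_iff₀ (by positivity)]
  have e1 : (∑ i ∈ Finset.range (j + 1), t ^ i) * (1 - t) = 1 - t ^ (j + 1) := by
    have := geom_sum_mul t (j + 1)
    linarith
  have e2 : ((j : ℝ) + 1) * t ^ j ≤ ∑ i ∈ Finset.range (j + 1), t ^ i := by
    have := Finset.card_nsmul_le_sum (Finset.range (j + 1)) (fun i => t ^ i) (t ^ j)
      fun i hi => pow_le_pow_of_le_one h0 h1 (Nat.lt_succ_iff.1 (Finset.mem_range.1 hi))
    simpa using this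
  have e3 := mul_le_mul_of_nonneg_right e2 (sub_nonneg.2 h1)
  have e4 : 0 ≤ t ^ (j + 1) := by positivity
  linarith

namespace IsKahlerOrbit

theorem continuous_commutatorSymbol (ho : IsKahlerOrbit ρ v T φ r) (p q : E) :
    Continuous (commutatorSymbol ρ v T p q) := by
  have hc : ∀ u, Continuous fun g => ρ g⁻¹ u := fun u => (ho.continuous u).comp continuous_inv
  exact ((hc q).inner (T.starProjection.continuous.comp (hc p))).sub
    ((continuous_const.inner (hc p)).mul ((hc q).inner continuous_const))

/-- The second difference is `∫ t^m (1 - t)²`; sacrificing `t^{2j}` bounds `(t^j (1 - t))²` by `1 /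
(j + 1)²`. -/
theorem second_difference_le (ho : IsKahlerOrbit ρ v T φ r) {j m : ℕ} (hj : 2 * j ≤ m) :
    moment ρ v μ m - 2 * moment ρ v μ (m + 1) + moment ρ v μ (m + 2) ≤
      (1 / (j + 1)) ^ 2 * moment ρ v μ (m - 2 * j) := by
  have e1 : moment ρ v μ m - 2 * moment ρ v μ (m + 1) + moment ρ v μ (m + 2) =
      ∫ g, transition ρ v g ^ m * (1 - transition ρ v g) ^ 2 ∂μ := by
    rw [ho.integral_transition_sq]; ring
  rw [e1, moment_eq, ← integral_const_mul]
  have hc := ho.continuous_transition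
  refine integral_mono (Continuous.integrable_of_compactSpace (by fun_prop) μ)
    ((ho.integrable_transition_pow _).const_mul _) fun g => ?_
  have h0 := transition_nonneg (ρ := ρ) (v := v) g
  have h1 := pow_mul_one_sub_le h0 (ho.transition_le_one g) j
  have h2 : 0 ≤ 1 - transition ρ v g := sub_nonneg.2 (ho.transition_le_one g)
  have h3 : transition ρ v g ^ m = transition ρ v g ^ (m - 2 * j) * transition ρ v g ^ (2 * j) := by
    rw [← pow_add]; congr 1; omega
  calc transition ρ v g ^ m * (1 - transition ρ v g) ^ 2
      = (transition ρ v g ^ j * (1 - transition ρ v g)) ^ 2 * transition ρ v g ^ (m - 2 * j) := by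
        rw [h3]; ring
    _ ≤ _ := by gcongr

/-- With `j = m / 4` the remaining degree is still at least `m / 2`, so doubling recovers the moment
of degree `m + 1` while two powers of `1 / m` are gained. -/
theorem exists_second_difference_le (ho : IsKahlerOrbit ρ v T φ r) {d : ℕ} {C : ℝ}
    (ha : IsMomentSequence (moment ρ v μ) d C) :
    ∃ D, 0 ≤ D ∧ ∀ m : ℕ, moment ρ v μ m - 2 * moment ρ v μ (m + 1) + moment ρ v μ (m + 2) ≤
      D / (m + 1) ^ 2 * moment ρ v μ (m + 1) := by
  obtain ⟨D, hD, hDm⟩ := ha.exists_le_mul 4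
  refine ⟨16 * D, by positivity, fun m => ?_⟩
  have h1 : (1 / ((m / 4 : ℕ) + 1 : ℝ)) ≤ 4 / (m + 1) := by
    rw [div_le_div_iff₀ (by positivity) (by positivity)]
    have : m + 1 ≤ 4 * (m / 4 + 1) := by omega
    have : (m : ℝ) + 1 ≤ 4 * ((m / 4 : ℕ) + 1) := by exact_mod_cast this
    linarith
  have h2 := hDm (m - 2 * (m / 4)) (m + 1) (by omega)
  have h3 := (ha.pos (m + 1)).le
  calc _ ≤ (1 / ((m / 4 : ℕ) + 1 : ℝ)) ^ 2 * moment ρ v μ (m - 2 * (m / 4)) :=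
        ho.second_difference_le (by omega)
    _ ≤ (4 / (m + 1)) ^ 2 * (D * moment ρ v μ (m + 1)) := by
        have := (ha.pos (m - 2 * (m / 4))).le
        gcongr
    _ = _ := by rw [div_pow]; ring

end IsKahlerOrbit

namespace IsFockSystem

/-- After translation to `v`, the term `S_p^* S_q` is a second moment and `S_q S_p^*` is an explicit
product. The tangential part in `secondMoment_eq` minus that product is the symbol over `m + 1 = k +
2`, so only the normal second moment is left. -/
theorem inner_kernel_mulCommutator (h : IsFockSystem (orbitConeOf ρ v) K S)
    (ho : IsKahlerOrbit ρ v T φ r) (k : ℕ) (p q : E) (g : Γ) :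
    moment ρ v μ (k + 2) *
        (⟪K (k + 1) (ρ g v), mulCommutator S p q (K (k + 1) (ρ g v))⟫_ℂ -
          commutatorSymbol ρ v T p q g / (k + 2)) =
      secondMoment ρ v μ (k + 1) (ρ g⁻¹ p - T.starProjection (ρ g⁻¹ p))
        (ρ g⁻¹ q - T.starProjection (ρ g⁻¹ q)) := by
  have hX : ∀ g : Γ, ρ g v ∈ orbitConeOf ρ v := apply_mem_orbitConeOf
  set m := k + 1 with hm
  have e1 : moment ρ v μ (m + 1) * ⟪S p (K m (ρ g v)), S q (K m (ρ g v))⟫_ℂ =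
      secondMoment ρ v μ m (ρ g⁻¹ p) (ρ g⁻¹ q) := by
    rw [← h.integral_inner_mul_inner ho (h.map_mem_level p (kernel_mem m (hX g)))
      (h.map_mem_level q (kernel_mem m (hX g))) (μ := μ), secondMoment,
      ← integral_mul_left_eq_self _ g]
    congr 1
    ext w
    rw [← inner_conj_symm, h.inner_succ m _ (hX _), h.inner_succ m _ (hX _),
      h.inner_same m (hX _) (hX _), map_mul ρ]
    change conj (⟪p, ρ g (ρ w v)⟫_ℂ * ⟪ρ g v, ρ g (ρ w v)⟫_ℂ ^ m) *
      (⟪q, ρ g (ρ w v)⟫_ℂ * ⟪ρ g v, ρ g (ρ w v)⟫_ℂ ^ m) = _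
    rw [(ρ g).inner_map_map, inner_apply_right g p, inner_apply_right g q, map_mul, map_pow,
      inner_conj_symm, inner_conj_symm]
    ring
  have e2 : ⟪K m (ρ g v), S q ((S p).adjoint (K m (ρ g v)))⟫_ℂ =
      ⟪v, ρ g⁻¹ p⟫_ℂ * ⟪ρ g⁻¹ q, v⟫_ℂ := by
    rw [← ContinuousLinearMap.adjoint_inner_left, h.adjoint_kernel_succ q k (hX g),
      h.adjoint_kernel_succ p k (hX g), inner_smul_left, inner_smul_right, inner_conj_symm,
      inner_self_eq_ofReal, h.norm_kernel k (hX g) (ho.norm_apply g), inner_apply_left,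
      inner_apply_right]
    simp [mul_comm]
  have e3 : ⟪K m (ρ g v), mulCommutator S p q (K m (ρ g v))⟫_ℂ =
      ⟪S p (K m (ρ g v)), S q (K m (ρ g v))⟫_ℂ - ⟪v, ρ g⁻¹ p⟫_ℂ * ⟪ρ g⁻¹ q, v⟫_ℂ := by
    rw [← e2, ← ContinuousLinearMap.adjoint_inner_right, ← inner_sub_right]
    rfl
  rw [e3, mul_sub, mul_sub]
  change ((moment ρ v μ (m + 1) : ℝ) : ℂ) * _ - _ - _ = _
  rw [e1, h.secondMoment_eq ho, commutatorSymbol]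
  have : ((k : ℂ) + 2) ≠ 0 := by exact_mod_cast (show k + 2 ≠ 0 by omega)
  have e4 : ((m : ℕ) : ℂ) + 1 = k + 2 := by rw [hm]; push_cast; ring
  have e5 : ((m : ℕ) : ℂ) = k + 1 := by rw [hm]; push_cast; ring
  rw [e4, e5]
  change _ + _ - ((moment ρ v μ (m + 1) : ℝ) : ℂ) * _ - ((moment ρ v μ (m + 1) : ℝ) : ℂ) * _ = _
  field_simp
  ring

theorem exists_norm_inner_kernel_mulCommutator_sub_le (h : IsFockSystem (orbitConeOf ρ v) K S)
    (ho : IsKahlerOrbit ρ v T φ r) {d : ℕ} {C : ℝ} (ha : IsMomentSequence (moment ρ v μ) d C)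
    (hC : ∀ g, ‖ρ g v - T.starProjection (ρ g v)‖ ^ 2 ≤ C * (1 - transition ρ v g) ^ 2)
    (p q : E) : ∃ D, 0 ≤ D ∧ ∀ (k : ℕ) (g : Γ),
      ‖⟪K (k + 1) (ρ g v), mulCommutator S p q (K (k + 1) (ρ g v))⟫_ℂ -
          commutatorSymbol ρ v T p q g / (k + 2)‖ ≤ D / (k + 2) ^ 2 := by
  obtain ⟨D, hD, hDm⟩ := ho.exists_second_difference_le ha
  have hC0 := ha.nonneg
  refine ⟨C * ‖p‖ * ‖q‖ * D, by positivity, fun k g => ?_⟩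
  have h1 := h.inner_kernel_mulCommutator ho k p q g (μ := μ)
  have h2 := ho.norm_secondMoment_normal_le hC (k + 1) (ρ g⁻¹ p) (ρ g⁻¹ q) (μ := μ)
  have h3 := hDm (k + 1)
  have ha0 := ha.pos (k + 2)
  rw [← h1, norm_mul, Complex.norm_real, Real.norm_of_nonneg ha0.le, LinearIsometryEquiv.norm_map,
    LinearIsometryEquiv.norm_map] at h2
  refine le_of_mul_le_mul_left (h2.trans ?_) ha0
  calc _ ≤ C * ‖p‖ * ‖q‖ * (D / ((k + 1 : ℕ) + 1) ^ 2 * moment ρ v μ (k + 2)) := by gcongr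
    _ = _ := by
      rw [show ((k + 1 : ℕ) : ℝ) + 1 = k + 2 by push_cast; ring]
      ring

/-- The resolution of the identity turns the right side into `∫ ‖B^* K‖²`, with `B` the commutator
and `K` the unit kernel at `gv`; Cauchy–Schwarz gives `|⟨K, B K⟩| ≤ ‖B^* K‖`. -/
theorem sum_norm_mulCommutator_sq_ge (h : IsFockSystem (orbitConeOf ρ v) K S)
    (ho : IsKahlerOrbit ρ v T φ r) (p q : E) (m : ℕ) {ι : Type*} [Fintype ι]
    (b : OrthonormalBasis ι ℂ (level (orbitConeOf ρ v) K m)) :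
    ∫ g, ‖⟪K m (ρ g v), mulCommutator S p q (K m (ρ g v))⟫_ℂ‖ ^ 2 ∂μ ≤
      moment ρ v μ m * ∑ i, ‖mulCommutator S p q (b i)‖ ^ 2 := by
  have hX : ∀ g : Γ, ρ g v ∈ orbitConeOf ρ v := apply_mem_orbitConeOf
  have hc := h.continuous_kernel ho m
  have e1 : moment ρ v μ m * ∑ i, ‖mulCommutator S p q (b i)‖ ^ 2 =
      ∫ g, ∑ i, ‖⟪K m (ρ g v), mulCommutator S p q (b i)⟫_ℂ‖ ^ 2 ∂μ := by
    rw [integral_finsetSum, Finset.mul_sum]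
    · refine Finset.sum_congr rfl fun i _ => ?_
      rw [h.integral_norm_inner_sq ho (h.mulCommutator_mem_level p q (b i).2)]
    · intro i _
      exact Continuous.integrable_of_compactSpace ((hc.inner continuous_const).norm.pow 2) μ
  rw [e1]
  refine integral_mono (Continuous.integrable_of_compactSpace ((hc.inner
    ((mulCommutator S p q).continuous.comp hc)).norm.pow 2) μ)
    (Continuous.integrable_of_compactSpace (continuous_finsetSum _ fun i _ =>
      (hc.inner continuous_const).norm.pow 2) μ) fun g => ?_
  have h1 : mulCommutator S q p (K m (ρ g v)) ∈ level (orbitConeOf ρ v) K m :=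
    h.mulCommutator_mem_level q p (kernel_mem m (hX g))
  have h2 := b.sum_sq_norm_inner_right ⟨_, h1⟩
  have h3 : ∀ i, ‖⟪b i, (⟨_, h1⟩ : level (orbitConeOf ρ v) K m)⟫_ℂ‖ =
      ‖⟪K m (ρ g v), mulCommutator S p q (b i)⟫_ℂ‖ := fun i => by
    rw [Submodule.coe_inner, norm_inner_symm, ← ContinuousLinearMap.adjoint_inner_left,
      adjoint_mulCommutator]
  simp only [h3] at h2
  change ‖_‖ ^ 2 ≤ _
  rw [h2, ← ContinuousLinearMap.adjoint_inner_left, adjoint_mulCommutator]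
  refine pow_le_pow_left₀ (norm_nonneg _) ((norm_inner_le_norm _ _).trans ?_) 2
  rw [h.norm_kernel m (hX g) (ho.norm_apply g), mul_one]
  rfl

/-- The Hilbert–Schmidt norm of a cross-commutator on the component of degree `m` is at least of
the order of `√(dim) / m`. -/
theorem exists_le_sum_norm_mulCommutator_sq [μ.IsOpenPosMeasure]
    (h : IsFockSystem (orbitConeOf ρ v) K S)
    (ho : IsKahlerOrbit ρ v T φ r) {d : ℕ} {C : ℝ} (ha : IsMomentSequence (moment ρ v μ) d C)
    (hC : ∀ g, ‖ρ g v - T.starProjection (ρ g v)‖ ^ 2 ≤ C * (1 - transition ρ v g) ^ 2)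
    {p q : E} {g₀ : Γ} (hg₀ : commutatorSymbol ρ v T p q g₀ ≠ 0) :
    ∃ c > 0, ∃ M : ℕ, ∀ m, M ≤ m → ∀ {ι : Type} [Fintype ι]
      (b : OrthonormalBasis ι ℂ (level (orbitConeOf ρ v) K m)),
      c / (m + 1) ^ 2 * Module.finrank ℂ (level (orbitConeOf ρ v) K m) ≤
        ∑ i, ‖mulCommutator S p q (b i)‖ ^ 2 := by
  obtain ⟨D, hD, hDm⟩ := h.exists_norm_inner_kernel_mulCommutator_sub_le ho ha hC p q
  have hσ := ho.continuous_commutatorSymbol p q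
  set σ := commutatorSymbol ρ v T p q
  set s := ∫ g, ‖σ g‖ ^ 2 ∂μ
  have hs : 0 < s := by
    refine (hσ.norm.pow 2).integral_pos_of_hasCompactSupport_nonneg_nonzero
      (HasCompactSupport.of_compactSpace _) (fun g => by positivity) (x := g₀) ?_
    exact pow_ne_zero 2 (norm_ne_zero_iff.2 hg₀)
  -- From this degree on, the squared error `D² / (k + 2)⁴` is at most half of the main term `s / (2
  -- (k + 2)²)`, which leaves the constant `s / 4`.
  obtain ⟨M, hM⟩ := exists_nat_ge (4 * D ^ 2 / s)
  refine ⟨s / 4, by positivity, M + 1, fun m hm ι _ b => ?_⟩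
  obtain ⟨k, rfl⟩ : ∃ k, m = k + 1 := ⟨m - 1, by omega⟩
  have hc := h.continuous_kernel ho (k + 1)
  have h1 := h.sum_norm_mulCommutator_sq_ge ho p q (k + 1) b (μ := μ)
  have hN := h.finrank_mul_moment ho (k + 1) (μ := μ)
  have ha0 := ha.pos (k + 1)
  have hpt : ∀ g, ‖σ g‖ ^ 2 / (2 * (k + 2) ^ 2) - (D / (k + 2) ^ 2) ^ 2 ≤
      ‖⟪K (k + 1) (ρ g v), mulCommutator S p q (K (k + 1) (ρ g v))⟫_ℂ‖ ^ 2 := by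
    intro g
    have h2 := hDm k g
    set β := ⟪K (k + 1) (ρ g v), mulCommutator S p q (K (k + 1) (ρ g v))⟫_ℂ
    have h3 : ‖σ g / (k + 2)‖ = ‖σ g‖ / (k + 2) := by
      rw [norm_div]
      congr 1
      have : ((k : ℂ) + 2) = ((k + 2 : ℝ) : ℂ) := by push_cast; rfl
      rw [this, Complex.norm_real, Real.norm_of_nonneg (by positivity)]
    have h4 : ‖σ g‖ / (k + 2) ≤ ‖β‖ + D / (k + 2) ^ 2 := by
      rw [← h3]
      have := norm_sub_norm_le (σ g / (k + 2)) β
      rw [norm_sub_rev] at this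
      linarith
    have h5 : (‖σ g‖ / (k + 2)) ^ 2 ≤ (‖β‖ + D / (k + 2) ^ 2) ^ 2 := by gcongr
    have h6 : ‖σ g‖ ^ 2 / (2 * (k + 2) ^ 2) = (‖σ g‖ / (k + 2)) ^ 2 / 2 := by
      field_simp
    rw [h6]
    nlinarith [sq_nonneg (‖β‖ - D / (k + 2) ^ 2)]
  have h7 : s / (2 * (k + 2) ^ 2) - (D / (k + 2) ^ 2) ^ 2 ≤
      ∫ g, ‖⟪K (k + 1) (ρ g v), mulCommutator S p q (K (k + 1) (ρ g v))⟫_ℂ‖ ^ 2 ∂μ := by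
    have h8 : s / (2 * (k + 2) ^ 2) - (D / (k + 2) ^ 2) ^ 2 =
        ∫ g, (‖σ g‖ ^ 2 / (2 * (k + 2) ^ 2) - (D / (k + 2) ^ 2) ^ 2) ∂μ := by
      rw [integral_sub (f := fun g => ‖σ g‖ ^ 2 / (2 * ((k : ℝ) + 2) ^ 2)) (Integrable.div_const
        (Continuous.integrable_of_compactSpace (hσ.norm.pow 2) μ) _) (integrable_const _), integral_div]
      simp [s]
    rw [h8]
    exact integral_mono (Continuous.integrable_of_compactSpace
      (((hσ.norm.pow 2).div_const _).sub continuous_const) μ)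
      (Continuous.integrable_of_compactSpace ((hc.inner
        ((mulCommutator S p q).continuous.comp hc)).norm.pow 2) μ) hpt
  have h9 : (D / ((k : ℝ) + 2) ^ 2) ^ 2 ≤ s / (4 * (k + 2) ^ 2) := by
    have hk : (M : ℝ) ≤ k := by exact_mod_cast (by omega : M ≤ k)
    have h10 : 4 * D ^ 2 ≤ s * (k + 2) ^ 2 := by
      rw [div_le_iff₀ hs] at hM
      have : (k : ℝ) ≤ (k + 2) ^ 2 := by nlinarith [Nat.cast_nonneg (α := ℝ) k]
      nlinarith
    rw [div_pow, div_le_div_iff₀ (by positivity) (by positivity)]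
    have : (0 : ℝ) ≤ (k + 2) ^ 2 := by positivity
    nlinarith
  have h11 : s / 4 / ((k + 1 : ℕ) + 1) ^ 2 ≤
      moment ρ v μ (k + 1) * ∑ i, ‖mulCommutator S p q (b i)‖ ^ 2 := by
    refine le_trans ?_ (h7.trans h1)
    have e : s / 4 / (((k + 1 : ℕ) : ℝ) + 1) ^ 2 =
      s / (2 * ((k : ℝ) + 2) ^ 2) - s / (4 * (k + 2) ^ 2) := by
      push_cast
      have : (k : ℝ) + 2 ≠ 0 := by positivity
      rw [show (k : ℝ) + 1 + 1 = k + 2 by ring]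
      field_simp
      ring
    rw [e]
    linarith
  calc _ ≤ moment ρ v μ (k + 1) * (∑ i, ‖mulCommutator S p q (b i)‖ ^ 2) *
        Module.finrank ℂ (level (orbitConeOf ρ v) K (k + 1)) := by gcongr
    _ = (∑ i, ‖mulCommutator S p q (b i)‖ ^ 2) *
        (Module.finrank ℂ (level (orbitConeOf ρ v) K (k + 1)) * moment ρ v μ (k + 1)) := by ring
    _ = _ := by rw [hN, mul_one]

end IsFockSystem

end Orbit

/-! ### Nonvanishing of the symbol. -/

theorem DifferentiableOn.matrix_det {F ι : Type*} [NormedAddCommGroup F] [NormedSpace ℂ F]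
    [Fintype ι] [DecidableEq ι] {A : F → Matrix ι ι ℂ} {U : Set F}
    (hA : ∀ i j, DifferentiableOn ℂ (fun x => A x i j) U) :
    DifferentiableOn ℂ (fun x => (A x).det) U := by
  simp only [Matrix.det_apply']
  refine DifferentiableOn.fun_sum fun σ _ => ?_
  refine DifferentiableOn.const_mul ?_ _
  intro x hx
  refine (HasFDerivWithinAt.finsetProd fun i _ =>
    ((hA (σ i) i) x hx).hasFDerivWithinAt).differentiableWithinAt

section Orbit

variable {Γ E : Type*} [Group Γ] [NormedAddCommGroup E] [InnerProductSpace ℂ E]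
  [TopologicalSpace Γ] [IsTopologicalGroup Γ] [CompactSpace Γ]
  [FiniteDimensional ℂ E] {ρ : Γ →* (E ≃ₗᵢ[ℂ] E)} {v : E} {T : Submodule ℂ E} {φ : E → E}
  {r : ℝ}

theorem commutatorSymbol_translate (p q : E) (h g : Γ) :
    commutatorSymbol ρ v T (ρ h⁻¹ p) (ρ h⁻¹ q) g = commutatorSymbol ρ v T p q (h * g) := by
  simp [commutatorSymbol]

/-- The vanishing of the symbol at a point, in terms of a frame of the tangent space. -/
theorem sum_cramer_gram {ι : Type*} [Fintype ι] [DecidableEq ι] (b : OrthonormalBasis ι ℂ T)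
    {p q x : E} {g : Γ} {c : ℂ} (hx : x = c • ρ g v) (hv : ‖v‖ = 1)
    (h0 : commutatorSymbol ρ v T p q g = 0) {e : ι → E} (heT : ∀ i, ρ g⁻¹ (e i) ∈ T)
    (hPe : ∀ i, T.starProjection (e i) = b i) :
    (∑ i, ⟪q, e i⟫_ℂ * (Matrix.of fun j i => ⟪e j, e i⟫_ℂ).cramer (fun j => ⟪e j, p⟫_ℂ) i) *
        ⟪x, x⟫_ℂ =
      (Matrix.of fun j i => ⟪e j, e i⟫_ℂ).det * (⟪x, p⟫_ℂ * ⟪q, x⟫_ℂ) := by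
  set M : Matrix ι ι ℂ := Matrix.of fun j i => ⟪e j, e i⟫_ℂ
  let e' : ι → T := fun i => ⟨ρ g⁻¹ (e i), heT i⟩
  -- The frame is independent because its vectors project to the orthonormal basis `b` of `T`.
  have hli : LinearIndependent ℂ e' := by
    rw [Fintype.linearIndependent_iff]
    intro a ha
    have h1 : ∑ i, a i • e i = 0 := by
      have h2 := congrArg (fun y : T => ρ g (y : E)) ha
      simpa [e', apply_inv_apply] using h2
    have h3 := congrArg (fun y => T.starProjection y) h1
    simp only [map_sum, map_smul, hPe, map_zero] at h3
    have h4 : ∑ i, a i • b i = 0 := Subtype.ext (by simpa using h3)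
    exact Fintype.linearIndependent_iff.1 b.toBasis.linearIndependent a (by simpa using h4)
  have hcard : Fintype.card ι = Module.finrank ℂ T :=
    (Module.finrank_eq_card_basis b.toBasis).symm
  rcases isEmpty_or_nonempty ι with hι | hι
  · have hT : Module.finrank ℂ T = 0 := by rw [← hcard]; exact Fintype.card_eq_zero
    have hT' : T = ⊥ := Submodule.finrank_eq_zero.1 hT
    have h1 : ⟪v, ρ g⁻¹ p⟫_ℂ * ⟪ρ g⁻¹ q, v⟫_ℂ = 0 := by
      rw [commutatorSymbol, hT'] at h0
      simpa using h0
    have h2 : ⟪x, p⟫_ℂ * ⟪q, x⟫_ℂ = 0 := by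
      rw [hx, inner_smul_left, inner_smul_right, inner_apply_left g v p,
        inner_apply_right g q v, show ∀ a b c d : ℂ, a * b * (c * d) = a * c * (b * d) by intros; ring, h1, mul_zero]
    rw [h2]
    simp
  let B := basisOfLinearIndependentOfCardEqFinrank hli hcard
  have hB : ∀ i, B i = e' i := fun i => by
    simp [B]
  set P : T := T.orthogonalProjectionOnto (ρ g⁻¹ p)
  set a : ι → ℂ := fun i => B.repr P i
  have hP : ∑ i, a i • ρ g⁻¹ (e i) = T.starProjection (ρ g⁻¹ p) := by
    have h1 := congrArg Subtype.val (B.sum_repr P)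
    simp only [hB, e', Submodule.coe_sum, Submodule.coe_smul] at h1
    exact h1
  -- The coordinates `a` of the tangential projection of `p` solve the Gram system. Cramer's rule
  -- gives `det M • a` without division, so the resulting identity is polynomial in inner products
  -- of the frame and can be polarized.
  have hM : M.mulVec a = fun j => ⟪e j, p⟫_ℂ := by
    ext j
    have h1 : ⟪e j, p⟫_ℂ = ⟪ρ g⁻¹ (e j), T.starProjection (ρ g⁻¹ p)⟫_ℂ := by
      rw [← Submodule.inner_starProjection_left_eq_right,
        Submodule.starProjection_eq_self_iff.2 (heT j), (ρ g⁻¹).inner_map_map]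
    rw [h1, ← hP, inner_sum]
    simp only [Matrix.mulVec, dotProduct, M, Matrix.of_apply, inner_smul_right,
      LinearIsometryEquiv.inner_map_map]
    exact Finset.sum_congr rfl fun i _ => mul_comm _ _
  have hcr : M.cramer (fun j => ⟪e j, p⟫_ℂ) = M.det • a := by
    rw [Matrix.cramer_eq_adjugate_mulVec, ← hM, Matrix.mulVec_mulVec, Matrix.adjugate_mul,
      Matrix.smul_mulVec, Matrix.one_mulVec]
  have h1 : ∑ i, ⟪q, e i⟫_ℂ * a i = ⟪v, ρ g⁻¹ p⟫_ℂ * ⟪ρ g⁻¹ q, v⟫_ℂ := by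
    rw [← sub_eq_zero.1 h0, ← hP, inner_sum]
    refine Finset.sum_congr rfl fun i _ => ?_
    rw [inner_smul_right, LinearIsometryEquiv.inner_map_map, mul_comm]
  rw [hcr]
  have h2 : ∑ i, ⟪q, e i⟫_ℂ * (M.det • a) i = M.det * ∑ i, ⟪q, e i⟫_ℂ * a i := by
    rw [Finset.mul_sum]
    refine Finset.sum_congr rfl fun i _ => ?_
    simp only [Pi.smul_apply, smul_eq_mul]
    ring
  rw [h2, h1, hx, inner_smul_left, inner_smul_left, inner_smul_right, inner_smul_right,
    (ρ g).inner_map_map, inner_self_eq_ofReal, hv, inner_apply_left g v p, inner_apply_right g q v]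
  push_cast
  ring

namespace IsKahlerOrbit

/-- The derivative of the local retraction along the orbit is tangent to the orbit. -/
theorem fderiv_mem_tangent (ho : IsKahlerOrbit ρ v T φ r) {τ : E} (hτ : τ ∈ ball v r) {g : Γ}
    {c : ℂ} (hc : c ≠ 0) (hx : φ τ = c • ρ g v) (η : E) : ρ g⁻¹ (fderiv ℂ φ τ η) ∈ T := by
  -- `A` is a symmetry of the cone carrying `φ τ` to `v`. Near `τ` the values of `A ∘ φ` lie in the
  -- cone and are fixed by `φ`, so the derivative of `A ∘ φ` lies in the range of `fderiv ℂ φ v`,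
  -- that is in `T`.
  let A : E →L[ℂ] E := c⁻¹ • ((ρ g⁻¹).toContinuousLinearEquiv : E →L[ℂ] E)
  have hA : ∀ y, A y = c⁻¹ • ρ g⁻¹ y := fun y => rfl
  have hAv : A (φ τ) = v := by
    rw [hA, hx, map_smul, inv_apply_apply, smul_smul, inv_mul_cancel₀ hc, one_smul]
  have h1 : HasFDerivAt (fun y => A (φ y)) (A ∘L fderiv ℂ φ τ) τ :=
    A.hasFDerivAt.comp τ (ho.retraction.hasFDerivAt hτ)
  have h2 : HasFDerivAt (fun y => φ (A (φ y))) (fderiv ℂ φ v ∘L (A ∘L fderiv ℂ φ τ)) τ := by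
    refine HasFDerivAt.comp (g := φ) τ ?_ h1
    rw [hAv]
    exact ho.retraction.hasFDerivAt (mem_ball_self ho.retraction.pos)
  have h3 : (fun y => φ (A (φ y))) =ᶠ[𝓝 τ] fun y => A (φ y) := by
    have h4 : ∀ᶠ y in 𝓝 τ, A (φ y) ∈ ball v r :=
      h1.continuousAt.eventually (by
        change ball v r ∈ 𝓝 (A (φ τ))
        rw [hAv]
        exact ball_mem_nhds v ho.retraction.pos)
    filter_upwards [h4, isOpen_ball.mem_nhds hτ] with y hy hyb
    exact ho.retraction.fixes _ hy (smul_mem_orbitConeOf (inv_ne_zero hc)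
      (map_mem_orbitConeOf _ (ho.retraction.mapsTo y hyb)))
  have h5 := DFunLike.congr_fun ((h1.congr_of_eventuallyEq h3).unique h2) η
  have h6 : A (fderiv ℂ φ τ η) ∈ T := by
    have : A (fderiv ℂ φ τ η) = fderiv ℂ φ v (A (fderiv ℂ φ τ η)) := h5
    rw [this]
    exact ho.retraction.tangent _
  have h7 : ρ g⁻¹ (fderiv ℂ φ τ η) = c • A (fderiv ℂ φ τ η) := by
    rw [hA, smul_smul, mul_inv_cancel₀ hc, one_smul]
  rw [h7]
  exact T.smul_mem c h6

theorem inner_apply_retraction (ho : IsKahlerOrbit ρ v T φ r) {τ : E} (hτ : τ ∈ ball v r) :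
    ⟪v, φ τ⟫_ℂ = ⟪v, τ⟫_ℂ := by
  have hTv : T.starProjection v = v := Submodule.starProjection_eq_self_iff.2 ho.retraction.mem
  rw [← hTv, Submodule.inner_starProjection_left_eq_right, ho.retraction.proj τ hτ,
    ← Submodule.inner_starProjection_left_eq_right]

/-- Polarization of the vanishing of the symbol. -/
theorem inner_fderiv_mul_inner (ho : IsKahlerOrbit ρ v T φ r) {p q : E}
    (h0 : ∀ g, commutatorSymbol ρ v T p q g = 0) (hp : T.starProjection p = ⟪v, p⟫_ℂ • v)
    (hvp : ⟪v, p⟫_ℂ ≠ 0) {τ : E} (hτ : τ ∈ ball v (r / 4)) :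
    ⟪q, fderiv ℂ φ τ v⟫_ℂ * ⟪v, τ⟫_ℂ = ⟪q, φ τ⟫_ℂ := by
  let b := stdOrthonormalBasis ℂ T
  -- Since `τ` is within `r / 4` of `v`, the disc of radius 4 stays in `ball v r`; the half-radius
  -- disc, where polarization gives vanishing, contains the parameter 1 of `τ`.
  let y : ℂ → E := fun s => v + s • (τ - v)
  have hr := ho.retraction.pos
  have hy : ∀ s ∈ ball (0 : ℂ) 4, y s ∈ ball v r := fun s hs => by
    rw [mem_ball_zero_iff] at hs
    rw [mem_ball_iff_norm] at hτ ⊢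
    simp only [y, add_sub_cancel_left, norm_smul]
    nlinarith [norm_nonneg (τ - v), norm_nonneg s]
  have hyd : Differentiable ℂ y := by fun_prop
  have hconj : ∀ t ∈ ball (0 : ℂ) 4, conj t ∈ ball (0 : ℂ) 4 := fun t ht => by
    simpa using ht
  let x : ℂ → E := fun s => φ (y s)
  let e : Fin (Module.finrank ℂ T) → ℂ → E := fun i s => fderiv ℂ φ (y s) (b i)
  have hxd : ∀ s ∈ ball (0 : ℂ) 4, DifferentiableAt ℂ x s := fun s hs =>
    (ho.retraction.hasFDerivAt (hy s hs)).differentiableAt.comp s (hyd s)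
  have hed : ∀ i, ∀ s ∈ ball (0 : ℂ) 4, DifferentiableAt ℂ (e i) s := fun i s hs => by
    have h1 : ContDiffAt ℂ 1 (fderiv ℂ φ) (y s) :=
      (ho.retraction.contDiffAt (hy s hs)).fderiv_right (by norm_num)
    exact ((h1.differentiableAt one_ne_zero).comp s (hyd s)).clm_apply
      (differentiableAt_const _)
  have hdiff : ∀ {γ δ : ℂ → E}, (∀ s ∈ ball (0 : ℂ) 4, DifferentiableAt ℂ γ s) →
      (∀ s ∈ ball (0 : ℂ) 4, DifferentiableAt ℂ δ s) →
      DifferentiableOn ℂ (fun z : ℂ × ℂ => ⟪δ (conj z.2), γ z.1⟫_ℂ)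
        (ball 0 4 ×ˢ ball 0 4) := fun hγ hδ =>
    differentiableOn_inner_conj (fun s hs => (hγ s hs).differentiableWithinAt)
      fun t ht => hδ _ (hconj t ht)
  let M : ℂ × ℂ → Matrix (Fin (Module.finrank ℂ T)) (Fin (Module.finrank ℂ T)) ℂ := fun z =>
    Matrix.of fun j i => ⟪e j (conj z.2), e i z.1⟫_ℂ
  let β : ℂ × ℂ → Fin (Module.finrank ℂ T) → ℂ := fun z j => ⟪e j (conj z.2), p⟫_ℂ
  -- The division-free form of `σ = 0`, with unconjugated vectors taken at `s` and conjugated ones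
  -- at `conj t`.
  let F : ℂ × ℂ → ℂ := fun z =>
    (∑ i, ⟪q, e i z.1⟫_ℂ * (M z).cramer (β z) i) * ⟪x (conj z.2), x z.1⟫_ℂ -
      (M z).det * (⟪x (conj z.2), p⟫_ℂ * ⟪q, x z.1⟫_ℂ)
  have hMd : ∀ i j, DifferentiableOn ℂ (fun z => M z i j) (ball 0 4 ×ˢ ball 0 4) := fun i j =>
    hdiff (hed j) (hed i)
  have hβd : ∀ j, DifferentiableOn ℂ (fun z => β z j) (ball 0 4 ×ˢ ball 0 4) := fun j =>
    hdiff (γ := fun _ => p) (fun _ _ => differentiableAt_const _) (hed j)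
  have hFd : DifferentiableOn ℂ F (ball 0 4 ×ˢ ball 0 4) := by
    refine DifferentiableOn.sub (DifferentiableOn.mul (DifferentiableOn.fun_sum fun i _ => ?_)
      (hdiff hxd hxd)) (DifferentiableOn.mul (DifferentiableOn.matrix_det hMd) ?_)
    · refine DifferentiableOn.mul (hdiff (δ := fun _ => q) (hed i) fun _ _ =>
        differentiableAt_const _) ?_
      simp only [Matrix.cramer_apply]
      refine DifferentiableOn.matrix_det fun k l => ?_
      simp only [Matrix.updateCol_apply]
      split_ifs
      · exact hβd k
      · exact hMd k l
    · exact (hdiff (γ := fun _ => p) (fun _ _ => differentiableAt_const _) hxd).mul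
        (hdiff (δ := fun _ => q) hxd fun _ _ => differentiableAt_const _)
  have hdiag : ∀ s ∈ ball (0 : ℂ) 4, F (s, conj s) = 0 := by
    intro s hs
    obtain ⟨g, c, hc, hxs⟩ := ho.retraction.mapsTo _ (hy s hs)
    have h1 := sum_cramer_gram b (x := x s) (e := fun i => e i s) hxs ho.norm_eq (h0 g)
      (fun i => ho.fderiv_mem_tangent (hy s hs) hc hxs _) (fun i => by
        rw [ho.retraction.starProjection_fderiv (hy s hs)]
        exact Submodule.starProjection_eq_self_iff.2 (b i).2)
    simp only [F, M, β, Complex.conj_conj]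
    rw [h1, sub_self]
  -- At `(1, 0)` the frame at `φ τ` is paired with the orthonormal basis at `v`. The Gram matrix
  -- becomes the identity, and Cramer's rule disappears.
  have h1 := eq_zero_of_eq_zero_on_conj hFd hdiag 1 (by simp; norm_num) 0 (by simp)
  have hy0 : y 0 = v := by simp [y]
  have hy1 : y 1 = τ := by simp [y]
  have he0 : ∀ i, e i 0 = b i := fun i => by
    simp only [e, hy0]
    exact ho.retraction.fderiv_self (b i).2
  have hτr : τ ∈ ball v r := by
    have := hy 1 (by simp)
    rwa [hy1] at this
  have hM1 : M (1, 0) = 1 := by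
    ext j i
    have h2 : ⟪(b j : E), fderiv ℂ φ τ (b i)⟫_ℂ = ⟪(b j : E), (b i : E)⟫_ℂ := by
      have h3 : T.starProjection (b j : E) = b j := Submodule.starProjection_eq_self_iff.2 (b j).2
      rw [← h3, Submodule.inner_starProjection_left_eq_right,
        ho.retraction.starProjection_fderiv hτr, ← Submodule.inner_starProjection_left_eq_right]
    simp only [M, Matrix.of_apply, map_zero, he0]
    simp only [e, hy1]
    rw [h2, ← Submodule.coe_inner, Matrix.one_apply]
    exact orthonormal_iff_ite.1 b.orthonormal j i
  have hx0 : x 0 = v := by simp only [x, hy0, ho.retraction.apply_self]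
  have h4 : ∑ i, ⟪q, e i 1⟫_ℂ * β (1, 0) i = ⟪v, p⟫_ℂ * ⟪q, fderiv ℂ φ τ v⟫_ℂ := by
    have h5 : ∑ i, ⟪(b i : E), p⟫_ℂ • (b i : E) = T.starProjection p := by
      have := congrArg Subtype.val (b.sum_repr' (T.orthogonalProjectionOnto p))
      rw [Submodule.starProjection_apply, ← this]
      simp only [Submodule.coe_sum, Submodule.coe_smul, Submodule.coe_inner]
      refine Finset.sum_congr rfl fun i _ => ?_
      rw [← Submodule.starProjection_apply, ← Submodule.inner_starProjection_left_eq_right,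
        Submodule.starProjection_eq_self_iff.2 (b i).2]
    have h6 : ⟪v, p⟫_ℂ • fderiv ℂ φ τ v = ∑ i, ⟪(b i : E), p⟫_ℂ • fderiv ℂ φ τ (b i) := by
      rw [← map_smul, ← hp, ← h5, map_sum]
      simp only [map_smul]
    rw [← inner_smul_right, h6, inner_sum]
    refine Finset.sum_congr rfl fun i _ => ?_
    simp only [β, map_zero, he0, e, hy1]
    rw [inner_smul_right, mul_comm]
  simp only [F, hM1, Matrix.cramer_one, Module.End.one_apply, Matrix.det_one, map_zero, hx0, h4,
    one_mul] at h1
  have hx1 : x 1 = φ τ := by simp only [x, hy1]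
  rw [hx1, ho.inner_apply_retraction hτr] at h1
  have h7 : ⟪v, p⟫_ℂ * (⟪q, fderiv ℂ φ τ v⟫_ℂ * ⟪v, τ⟫_ℂ - ⟪q, φ τ⟫_ℂ) = 0 := by
    rw [← h1]; ring
  exact sub_eq_zero.1 ((mul_eq_zero.1 h7).resolve_left hvp)

/-- Euler's identity for the local retraction to the cone. -/
theorem fderiv_retraction_self (ho : IsKahlerOrbit ρ v T φ r) {τ : E} (hτ : τ ∈ ball v r)
    (hφτ : φ τ ∈ ball v r) : fderiv ℂ φ τ τ = φ τ := by
  have h1 : HasDerivAt (fun u : ℂ => φ (u • τ)) (fderiv ℂ φ τ τ) 1 := by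
    have h2 : HasDerivAt (fun u : ℂ => u • τ) τ 1 := by
      simpa using (hasDerivAt_id (1 : ℂ)).smul_const τ
    have h3 : HasFDerivAt φ (fderiv ℂ φ τ) ((1 : ℂ) • τ) := by
      rw [one_smul]; exact ho.retraction.hasFDerivAt hτ
    exact h3.comp_hasDerivAt 1 h2
  have h4 : HasDerivAt (fun u : ℂ => u • φ τ) (φ τ) 1 := by
    simpa using (hasDerivAt_id (1 : ℂ)).smul_const (φ τ)
  refine (h1.congr_of_eventuallyEq ?_).unique h4 |>.symm ▸ rfl
  have h5 : ∀ᶠ u : ℂ in 𝓝 1, u • φ τ ∈ ball v r := by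
    have : ContinuousAt (fun u : ℂ => u • φ τ) 1 := by fun_prop
    exact this.eventually (by beta_reduce; rw [one_smul]; exact isOpen_ball.mem_nhds hφτ)
  filter_upwards [h5, isOpen_ne.mem_nhds (one_ne_zero (α := ℂ))] with u hu hu0
  -- `φ` depends only on the tangential projection, and `u • φ τ` lies in the cone above that of `u
  -- • τ`; hence `φ (u • τ) = u • φ τ` for `u` near 1.
  rw [← ho.retraction.fixes _ hu (smul_mem_orbitConeOf hu0 (ho.retraction.mapsTo τ hτ)),
    ← ho.retraction.apply_proj (u • φ τ), ← ho.retraction.apply_proj (u • τ), map_smul, map_smul,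
    ho.retraction.proj τ hτ]

theorem eq_zero_of_inner (ho : IsKahlerOrbit ρ v T φ r) {u : E}
    (hu : ∀ x ∈ orbitConeOf ρ v, ⟪u, x⟫_ℂ = 0) : u = 0 := by
  have h1 : Submodule.span ℂ (orbitConeOf ρ v) ≤ LinearMap.ker (innerSL ℂ u).toLinearMap :=
    Submodule.span_le.2 fun x hx => hu x hx
  rw [ho.span_eq] at h1
  exact inner_self_eq_zero.1 (h1 (Submodule.mem_top (x := u)))

theorem eq_zero_of_inner_of_eventually (ho : IsKahlerOrbit ρ v T φ r) {u x₀ : E}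
    (hx₀ : x₀ ∈ orbitConeOf ρ v)
    (hu : ∀ᶠ x in 𝓝 x₀, x ∈ orbitConeOf ρ v → ⟪u, x⟫_ℂ = 0) : u = 0 :=
  ho.eq_zero_of_inner (ho.eq_zero_of_eventually (f := fun x => ⟪u, x⟫_ℂ)
    (innerSL ℂ u).differentiable hx₀ hu)

/-- On the slice `⟨v, y⟩ = 1` the polarized identity reads `⟨q, dφ_y v⟩ = ⟨q, φ y⟩`, and Euler's
identity reads `φ y = dφ_y y`. Their difference is `s ⟨q, dφ_y η⟩ = 0` at `y = v + s • η`, so `⟨q, φ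
y⟩` is constant along the line; the value `s = 0` follows by continuity. -/
theorem inner_retraction_eq (ho : IsKahlerOrbit ρ v T φ r) {p q : E}
    (h0 : ∀ g, commutatorSymbol ρ v T p q g = 0) (hp : T.starProjection p = ⟪v, p⟫_ℂ • v)
    (hvp : ⟪v, p⟫_ℂ ≠ 0) {r₁ : ℝ} (hr₁ : r₁ ≤ r / 4) (hφ : ∀ τ ∈ ball v r₁, φ τ ∈ ball v r)
    {η : E} (hη : v + η ∈ ball v r₁) (hvη : ⟪v, η⟫_ℂ = 0) : ⟪q, φ (v + η)⟫_ℂ = ⟪q, v⟫_ℂ := by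
  have hr := ho.retraction.pos
  have hrr : ball v r₁ ⊆ ball v r := ball_subset_ball (by linarith)
  let y : ℂ → E := fun s => v + s • η
  have hyd : Differentiable ℂ y := by fun_prop
  have hy' : ∀ s, HasDerivAt y η s := fun s => by
    have := ((hasDerivAt_id s).smul_const η).const_add v
    rwa [one_smul] at this
  set U : Set ℂ := y ⁻¹' ball v r₁
  have hUo : IsOpen U := isOpen_ball.preimage hyd.continuous
  have hUc : Convex ℝ U := by
    intro s hs t ht a b ha hb hab
    have h1 : y (a • s + b • t) = a • y s + b • y t := by
      have e1 : v = a • v + b • v := by rw [← add_smul, hab, one_smul]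
      simp only [y]
      rw [add_smul, smul_add, smul_add, smul_assoc, smul_assoc]
      nth_rewrite 1 [e1]
      abel
    change y _ ∈ ball v r₁
    rw [h1]
    exact convex_ball v r₁ hs ht ha hb hab
  have hr₁0 : 0 < r₁ := pos_of_mem_ball hη
  have h0U : (0 : ℂ) ∈ U := by simp [U, y, hr₁0]
  have h1U : (1 : ℂ) ∈ U := by simpa [U, y] using hη
  let κ : ℂ → ℂ := fun s => ⟪q, fderiv ℂ φ (y s) η⟫_ℂ
  have hk : ∀ s ∈ U, HasDerivAt (fun s => ⟪q, φ (y s)⟫_ℂ) (κ s) s := fun s hs =>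
    ((innerSL ℂ q).hasFDerivAt.comp_hasDerivAt s
      ((ho.retraction.hasFDerivAt (hrr hs)).comp_hasDerivAt s (hy' s)))
  have hκne : ∀ s ∈ U, s ≠ 0 → κ s = 0 := by
    intro s hs hs0
    have h1 := ho.inner_fderiv_mul_inner h0 hp hvp (τ := y s) (ball_subset_ball hr₁ hs)
    have h2 := ho.fderiv_retraction_self (hrr hs) (hφ _ hs)
    have h3 : ⟪v, y s⟫_ℂ = 1 := by
      simp only [y]
      rw [inner_add_right, inner_smul_right, hvη, inner_self_eq_ofReal, ho.norm_eq]
      simp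
    rw [h3, mul_one, ← h2] at h1
    have h4 : fderiv ℂ φ (y s) (y s) = fderiv ℂ φ (y s) v + s • fderiv ℂ φ (y s) η := by
      rw [← map_smul, ← map_add]
    rw [h4, inner_add_right, inner_smul_right, left_eq_add] at h1
    exact (mul_eq_zero.1 h1).resolve_left hs0
  have hκ0 : κ 0 = 0 := by
    have hc : ContinuousAt κ 0 := by
      have h1 : ContDiffAt ℂ 1 (fderiv ℂ φ) (y 0) :=
        (ho.retraction.contDiffAt (hrr h0U)).fderiv_right (by norm_num)
      have h2 : ContinuousAt (fun s => fderiv ℂ φ (y s)) 0 :=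
        ContinuousAt.comp (g := fderiv ℂ φ) h1.continuousAt hyd.continuous.continuousAt
      exact continuousAt_const.inner (h2.clm_apply continuousAt_const)
    refine tendsto_nhds_unique (hc.tendsto.mono_left (nhdsWithin_le_nhds (s := {0}ᶜ))) ?_
    refine tendsto_const_nhds.congr' ?_
    filter_upwards [self_mem_nhdsWithin, nhdsWithin_le_nhds (hUo.mem_nhds h0U)] with s hs hsU
    exact (hκne s hsU hs).symm
  have h1 := hUo.is_const_of_deriv_eq_zero hUc.isPreconnected
    (fun s hs => (hk s hs).differentiableAt.differentiableWithinAt) (fun s hs => by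
      rw [(hk s hs).deriv]
      by_cases hs0 : s = 0
      · rw [hs0]; exact hκ0
      · exact hκne s hs hs0) h1U h0U
  simpa [y, ho.retraction.apply_self] using h1

/-- If the symbol vanishes and `p` is normal to the orbit up to its component along `v`, then
`q` is a multiple of `v`. -/
theorem eq_smul_of_commutatorSymbol_eq_zero (ho : IsKahlerOrbit ρ v T φ r) {p q : E}
    (h0 : ∀ g, commutatorSymbol ρ v T p q g = 0) (hp : T.starProjection p = ⟪v, p⟫_ℂ • v)
    (hvp : ⟪v, p⟫_ℂ ≠ 0) : q = ⟪v, q⟫_ℂ • v := by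
  have hr := ho.retraction.pos
  have hvr : v ∈ ball v r := mem_ball_self hr
  have hc := (ho.retraction.hasFDerivAt hvr).continuousAt
  obtain ⟨r₂, hr₂, hr₂φ⟩ := Metric.eventually_nhds_iff_ball.1 (hc.eventually (by
    rw [ho.retraction.apply_self]; exact ball_mem_nhds v hr) : ∀ᶠ x in 𝓝 v, φ x ∈ ball v r)
  set r₁ := min r₂ (r / 4)
  have hr₁ : 0 < r₁ := by positivity
  rw [← sub_eq_zero]
  refine ho.eq_zero_of_inner_of_eventually self_mem_orbitConeOf ?_
  have hvv : ⟪v, v⟫_ℂ = 1 := by rw [inner_self_eq_ofReal, ho.norm_eq]; simp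
  have h1 : ∀ᶠ x in 𝓝 v, ⟪v, x⟫_ℂ ≠ 0 := by
    have : ContinuousAt (fun x => ⟪v, x⟫_ℂ) v := by fun_prop
    exact this.eventually_ne (by rw [hvv]; exact one_ne_zero)
  have h2 : ∀ᶠ x in 𝓝 v, (⟪v, x⟫_ℂ)⁻¹ • x ∈ ball v r₁ := by
    have : ContinuousAt (fun x => (⟪v, x⟫_ℂ)⁻¹ • x) v := by
      refine ContinuousAt.smul (ContinuousAt.inv₀ (by fun_prop) ?_) continuousAt_id
      rw [hvv]; exact one_ne_zero
    exact this.eventually (by beta_reduce; rw [hvv, inv_one, one_smul]; exact ball_mem_nhds v hr₁)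
  filter_upwards [h1, h2] with x hx hxb hxX
  -- Rescaling `x` into the slice gives `⟨q, x⟩ = ⟨q, v⟩ ⟨v, x⟩` on the cone near `v`. So `q - ⟨v,
  -- q⟩ v` annihilates an open piece of a spanning cone.
  set y := (⟪v, x⟫_ℂ)⁻¹ • x with hy
  have h3 := ho.inner_retraction_eq h0 hp hvp (min_le_right _ _)
    (fun τ hτ => hr₂φ τ (ball_subset_ball (min_le_left _ _) hτ)) (η := y - v)
    (by rw [add_sub_cancel]; exact hxb)
    (by rw [inner_sub_right, hvv, hy, inner_smul_right, inv_mul_cancel₀ hx, sub_self])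
  have hyr : y ∈ ball v r := ball_subset_ball ((min_le_right _ _).trans (by linarith)) hxb
  rw [add_sub_cancel, ho.retraction.fixes y hyr (smul_mem_orbitConeOf (inv_ne_zero hx) hxX), hy,
    inner_smul_right, inv_mul_eq_iff_eq_mul₀ hx] at h3
  rw [inner_sub_left, inner_smul_left, inner_conj_symm, h3]
  ring

/-- First-order condition at a maximum of `|⟨p, x⟩| / ‖x‖` over the cone, along the curve `φ (v + t
• η')`. -/
theorem inner_eq_zero_of_max (ho : IsKahlerOrbit ρ v T φ r) {p η : E}
    (hmax : ∀ x ∈ orbitConeOf ρ v, ‖⟪p, x⟫_ℂ‖ ≤ ‖⟪p, v⟫_ℂ‖ * ‖x‖) (hvp : ⟪p, v⟫_ℂ ≠ 0)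
    (hη : η ∈ T) (hvη : ⟪v, η⟫_ℂ = 0) : ⟪p, η⟫_ℂ = 0 := by
  set z := ⟪v, p⟫_ℂ * ⟪p, η⟫_ℂ with hz
  -- The phase of `conj z` makes the first variation equal to `-2 ‖z‖²`, so its vanishing gives `z =
  -- 0`.
  let η' : E := conj z • η
  have hη' : fderiv ℂ φ v η' = η' := ho.retraction.fderiv_self (T.smul_mem _ hη)
  let γ : ℝ → E := fun t => φ (v + t • η')
  have hγ0 : γ 0 = v := by simp [γ, ho.retraction.apply_self]
  have hγ : HasDerivAt γ η' 0 := by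
    have h1 : HasDerivAt (fun t : ℝ => v + t • η') η' 0 := by
      simpa using ((hasDerivAt_id (0 : ℝ)).smul_const η').const_add v
    have h2 : HasFDerivAt φ ((fderiv ℂ φ v).restrictScalars ℝ) (v + (0 : ℝ) • η') := by
      rw [zero_smul, add_zero]
      exact (ho.retraction.hasFDerivAt (mem_ball_self ho.retraction.pos)).restrictScalars ℝ
    have h3 := h2.comp_hasDerivAt 0 h1
    rw [ContinuousLinearMap.coe_restrictScalars', hη'] at h3
    exact h3
  let N := ‖⟪p, v⟫_ℂ‖
  let F : ℝ → ℂ := fun t => (N ^ 2 : ℝ) * ⟪γ t, γ t⟫_ℂ - ⟪γ t, p⟫_ℂ * ⟪p, γ t⟫_ℂ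
  have hFd : HasDerivAt F ((N ^ 2 : ℝ) * (⟪γ 0, η'⟫_ℂ + ⟪η', γ 0⟫_ℂ) -
      ((⟪γ 0, (0 : E)⟫_ℂ + ⟪η', p⟫_ℂ) * ⟪p, γ 0⟫_ℂ +
        ⟪γ 0, p⟫_ℂ * (⟪p, η'⟫_ℂ + ⟪(0 : E), γ 0⟫_ℂ))) 0 :=
    ((hγ.inner ℂ hγ).const_mul _).sub
      ((hγ.inner ℂ (hasDerivAt_const 0 p)).mul ((hasDerivAt_const 0 p).inner ℂ hγ))
  have hFre : ∀ t, (F t).re = N ^ 2 * ‖γ t‖ ^ 2 - ‖⟪p, γ t⟫_ℂ‖ ^ 2 := by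
    intro t
    have h1 : F t = ((N ^ 2 * ‖γ t‖ ^ 2 - ‖⟪p, γ t⟫_ℂ‖ ^ 2 : ℝ) : ℂ) := by
      simp only [F]
      rw [inner_self_eq_ofReal, ← inner_conj_symm (γ t) p, mul_comm (conj _), Complex.mul_conj,
        Complex.normSq_eq_norm_sq]
      push_cast
      ring
    rw [h1, Complex.ofReal_re]
  have hmin : IsLocalMin (fun t => (F t).re) 0 := by
    have h1 : (F 0).re = 0 := by
      rw [hFre, hγ0, ho.norm_eq]
      simp [N]
    have h2 : ∀ᶠ t : ℝ in 𝓝 0, v + t • η' ∈ ball v r := by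
      have : ContinuousAt (fun t : ℝ => v + t • η') 0 := by fun_prop
      exact this.eventually (by
        beta_reduce; rw [zero_smul, add_zero]; exact ball_mem_nhds v ho.retraction.pos)
    filter_upwards [h2] with t ht
    rw [h1, hFre, sub_nonneg, ← mul_pow]
    exact pow_le_pow_left₀ (norm_nonneg _) (hmax _ (ho.retraction.mapsTo _ ht)) 2
  have hre := hmin.hasDerivAt_eq_zero (Complex.reCLM.hasFDerivAt.comp_hasDerivAt 0 hFd)
  have e1 : ⟪v, η'⟫_ℂ = 0 := by rw [inner_smul_right, hvη, mul_zero]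
  have e2 : ⟪v, p⟫_ℂ * ⟪p, η'⟫_ℂ = ((‖z‖ ^ 2 : ℝ) : ℂ) := by
    rw [inner_smul_right, mul_left_comm, ← hz, mul_comm, Complex.mul_conj,
      Complex.normSq_eq_norm_sq]
  have e3 : ⟪η', p⟫_ℂ * ⟪p, v⟫_ℂ = ((‖z‖ ^ 2 : ℝ) : ℂ) := by
    rw [← inner_conj_symm η', ← inner_conj_symm p v, ← map_mul, mul_comm, e2, Complex.conj_ofReal]
  rw [hγ0, inner_zero_right, inner_zero_left, add_zero, zero_add, e3, e2, e1,
    ← inner_conj_symm η', e1, map_zero, add_zero, mul_zero, zero_sub, Complex.reCLM_apply,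
    Complex.neg_re, ← Complex.ofReal_add, Complex.ofReal_re] at hre
  have hz0 : z = 0 := by
    have : ‖z‖ ^ 2 = 0 := by linarith
    simpa using this
  refine (mul_eq_zero.1 hz0).resolve_left fun h => hvp ?_
  rw [← inner_conj_symm, h, map_zero]

/-- By compactness `|⟨p, gv⟩|` attains its maximum, and there the tangential part of `p` is
orthogonal to the orbit directions. The maximum is positive because the cone spans. -/
theorem exists_starProjection_eq_smul (ho : IsKahlerOrbit ρ v T φ r) {p : E} (hp : p ≠ 0) :
    ∃ g, ⟪v, ρ g⁻¹ p⟫_ℂ ≠ 0 ∧ T.starProjection (ρ g⁻¹ p) = ⟪v, ρ g⁻¹ p⟫_ℂ • v := by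
  have hc : Continuous fun g => ‖⟪ρ g⁻¹ p, v⟫_ℂ‖ :=
    (((ho.continuous p).comp continuous_inv).inner continuous_const).norm
  obtain ⟨g₀, -, hg₀⟩ := isCompact_univ.exists_isMaxOn univ_nonempty hc.continuousOn
  set u := ρ g₀⁻¹ p with hu
  have hmax : ∀ x ∈ orbitConeOf ρ v, ‖⟪u, x⟫_ℂ‖ ≤ ‖⟪u, v⟫_ℂ‖ * ‖x‖ := by
    rintro x ⟨g, c, -, rfl⟩
    have h1 : ‖⟪ρ (g₀ * g)⁻¹ p, v⟫_ℂ‖ ≤ ‖⟪u, v⟫_ℂ‖ := hg₀ (mem_univ (g₀ * g))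
    have h2 : ρ (g₀ * g)⁻¹ p = ρ g⁻¹ u := by rw [hu, mul_inv_rev, map_mul]; rfl
    rw [inner_smul_right, norm_mul, norm_smul, inner_apply_right,
      LinearIsometryEquiv.norm_map, ho.norm_eq, mul_one, mul_comm]
    rw [h2] at h1
    gcongr
  have huv : ⟪u, v⟫_ℂ ≠ 0 := by
    intro h0
    have hu0 : u = 0 := ho.eq_zero_of_inner fun x hx => by
      have := hmax x hx
      rw [h0, norm_zero, zero_mul] at this
      exact norm_le_zero_iff.1 this
    apply hp
    rw [← apply_inv_apply g₀ p, ← hu, hu0, map_zero]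
  have hTv : T.starProjection v = v := Submodule.starProjection_eq_self_iff.2 ho.retraction.mem
  have hvv : ⟪v, v⟫_ℂ = 1 := by rw [inner_self_eq_ofReal, ho.norm_eq]; simp
  refine ⟨g₀, fun h => huv ?_, ?_⟩
  · rw [← inner_conj_symm, h, map_zero]
  · rw [← sub_eq_zero]
    set w := T.starProjection u - ⟪v, u⟫_ℂ • v with hw
    have hwT : w ∈ T := T.sub_mem (Submodule.starProjection_apply_mem _ _)
      (T.smul_mem _ ho.retraction.mem)
    have hvw : ⟪v, w⟫_ℂ = 0 := by
      rw [hw, inner_sub_right, inner_smul_right, hvv, ← Submodule.inner_starProjection_left_eq_right,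
        hTv, mul_one, sub_self]
    have h1 := ho.inner_eq_zero_of_max hmax huv hwT hvw
    rw [← inner_self_eq_zero (𝕜 := ℂ)]
    nth_rewrite 1 [hw]
    rw [inner_sub_left, inner_smul_left, hvw, mul_zero, sub_zero,
      Submodule.inner_starProjection_left_eq_right, Submodule.starProjection_eq_self_iff.2 hwT, h1]

/-- Otherwise, after translation to a maximum point, `q` would be a multiple of `v` while `p` has a
nonzero component along `v`, so `p ⟂ q` would force `q = 0`. -/
theorem exists_commutatorSymbol_ne_zero_of_inner_eq_zero (ho : IsKahlerOrbit ρ v T φ r) {p q : E}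
    (hp : p ≠ 0) (hq : q ≠ 0) (hpq : ⟪p, q⟫_ℂ = 0) : ∃ g, commutatorSymbol ρ v T p q g ≠ 0 := by
  by_contra! h0
  obtain ⟨g, hg, hgP⟩ := ho.exists_starProjection_eq_smul hp
  have h1 := ho.eq_smul_of_commutatorSymbol_eq_zero
    (fun h => (commutatorSymbol_translate p q g h).trans (h0 _)) hgP hg
  have h2 : ⟪ρ g⁻¹ p, ρ g⁻¹ q⟫_ℂ = 0 := by rw [LinearIsometryEquiv.inner_map_map, hpq]
  rw [h1, inner_smul_right] at h2
  rcases mul_eq_zero.1 h2 with h3 | h3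
  · rw [h3, zero_smul] at h1
    apply hq
    rw [← apply_inv_apply g q, h1, map_zero]
  · apply hg
    rw [← inner_conj_symm, h3, map_zero]

/-- For `p = q` and `u = g⁻¹ p` the symbol is `‖P_T u - ⟨v, u⟩ v‖²`. Were it zero for all `g`, then
`gv` would be proportional to `p` whenever `⟨gv, p⟩ ≠ 0`. An open piece of the cone would lie in the
line of `p`, and the identity theorem with spanning would make `E` one-dimensional. -/
theorem exists_commutatorSymbol_self_ne_zero (ho : IsKahlerOrbit ρ v T φ r) {p : E}
    (hp : p ≠ 0) (hE : 2 ≤ Module.finrank ℂ E) : ∃ g, commutatorSymbol ρ v T p p g ≠ 0 := by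
  by_contra! h0
  have hvv : ⟪v, v⟫_ℂ = 1 := by rw [inner_self_eq_ofReal, ho.norm_eq]; simp
  have hTv : T.starProjection v = v := Submodule.starProjection_eq_self_iff.2 ho.retraction.mem
  have hproj : ∀ g, T.starProjection (ρ g⁻¹ p) = ⟪v, ρ g⁻¹ p⟫_ℂ • v := by
    intro g
    have h1 := h0 g
    rw [commutatorSymbol] at h1
    set u := ρ g⁻¹ p
    set w := T.starProjection u - ⟪v, u⟫_ℂ • v with hw
    have hwT : w ∈ T := T.sub_mem (Submodule.starProjection_apply_mem _ _)
      (T.smul_mem _ ho.retraction.mem)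
    have hvw : ⟪v, w⟫_ℂ = 0 := by
      rw [hw, inner_sub_right, inner_smul_right, hvv, ← Submodule.inner_starProjection_left_eq_right,
        hTv, mul_one, sub_self]
    have h2 : ⟪u, w⟫_ℂ = 0 := by
      rw [hw, inner_sub_right, inner_smul_right, h1]
    rw [← sub_eq_zero, ← hw, ← inner_self_eq_zero (𝕜 := ℂ)]
    nth_rewrite 1 [hw]
    rw [inner_sub_left, inner_smul_left, hvw, mul_zero, sub_zero,
      Submodule.inner_starProjection_left_eq_right, Submodule.starProjection_eq_self_iff.2 hwT, h2]
  have hpar : ∀ g, ⟪v, ρ g⁻¹ p⟫_ℂ ≠ 0 → ρ g⁻¹ p = ⟪v, ρ g⁻¹ p⟫_ℂ • v := fun g hg =>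
    ho.eq_smul_of_commutatorSymbol_eq_zero
      (fun h => (commutatorSymbol_translate p p g h).trans (h0 _)) (hproj g) hg
  obtain ⟨g₀, hg₀, -⟩ := ho.exists_starProjection_eq_smul hp
  -- every point of the cone near `ρ g₀ v` is a multiple of `p`
  have hall : ∀ w, ⟪p, w⟫_ℂ = 0 → w = 0 := by
    intro w hw
    refine ho.eq_zero_of_inner_of_eventually (apply_mem_orbitConeOf g₀) ?_
    have h1 : ∀ᶠ x in 𝓝 (ρ g₀ v), ⟪x, p⟫_ℂ ≠ 0 := by
      have : ContinuousAt (fun x => ⟪x, p⟫_ℂ) (ρ g₀ v) := by fun_prop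
      exact this.eventually_ne (by rw [inner_apply_left]; exact hg₀)
    filter_upwards [h1] with x hx hxX
    obtain ⟨g, c, hc, rfl⟩ := hxX
    rw [inner_smul_left, inner_apply_left] at hx
    have hg := right_ne_zero_of_mul hx
    have h2 := congrArg (ρ g) (hpar g hg)
    rw [apply_inv_apply, map_smul] at h2
    have h3 : ⟪v, ρ g⁻¹ p⟫_ℂ * ⟪w, ρ g v⟫_ℂ = 0 := by
      rw [← inner_smul_right, ← h2, ← inner_conj_symm, hw, map_zero]
    rw [inner_smul_right, (mul_eq_zero.1 h3).resolve_left hg, mul_zero]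
  have h1 : LinearMap.ker (innerSL ℂ p).toLinearMap = ⊥ :=
    (LinearMap.ker_eq_bot').2 fun w hw => hall w hw
  have h2 := LinearMap.finrank_le_finrank_of_injective (LinearMap.ker_eq_bot.1 h1)
  rw [Module.finrank_self] at h2
  omega

end IsKahlerOrbit

end Orbit

/-! ### Traces of positive operators and scalar inequalities for powers. -/

section Trace

variable {H : Type*} [NormedAddCommGroup H] [InnerProductSpace ℂ H]

theorem HilbertBasis.hasSum_norm_inner_sq {ι : Type*} (b : HilbertBasis ι ℂ H) (x : H) :
    HasSum (fun i => ‖⟪b i, x⟫_ℂ‖ ^ 2) (‖x‖ ^ 2) := by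
  have h1 := Complex.hasSum_re (b.hasSum_inner_mul_inner x x)
  have h2 : ∀ i, (⟪x, b i⟫_ℂ * ⟪b i, x⟫_ℂ).re = ‖⟪b i, x⟫_ℂ‖ ^ 2 := fun i => by
    rw [← inner_conj_symm x, mul_comm, Complex.mul_conj, Complex.ofReal_re,
      Complex.normSq_eq_norm_sq]
  rw [inner_self_eq_ofReal, Complex.ofReal_re] at h1
  simpa only [h2] using h1

variable [CompleteSpace H]

/-- Parseval in `b`, exchange of the two sums, then Bessel for `e`; extended nonnegative values
avoid any summability question. -/
theorem Orthonormal.tsum_norm_map_sq_le {ι κ : Type*} {e : κ → H} (he : Orthonormal ℂ e)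
    (b : HilbertBasis ι ℂ H) (R : H →L[ℂ] H) :
    ∑' k, ENNReal.ofReal (‖R (e k)‖ ^ 2) ≤ ∑' i, ENNReal.ofReal (‖R.adjoint (b i)‖ ^ 2) := by
  calc ∑' k, ENNReal.ofReal (‖R (e k)‖ ^ 2)
      = ∑' k, ∑' i, ENNReal.ofReal (‖⟪b i, R (e k)⟫_ℂ‖ ^ 2) := by
        congr 1
        ext k
        rw [← (b.hasSum_norm_inner_sq (R (e k))).tsum_eq]
        exact ENNReal.ofReal_tsum_of_nonneg (fun i => by positivity)
          (b.hasSum_norm_inner_sq (R (e k))).summable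
    _ = ∑' i, ∑' k, ENNReal.ofReal (‖⟪b i, R (e k)⟫_ℂ‖ ^ 2) := ENNReal.tsum_comm
    _ ≤ _ := by
        refine ENNReal.tsum_le_tsum fun i => ?_
        have h1 : ∀ k, ‖⟪b i, R (e k)⟫_ℂ‖ = ‖⟪e k, R.adjoint (b i)⟫_ℂ‖ := fun k => by
          rw [← ContinuousLinearMap.adjoint_inner_left, norm_inner_symm]
        simp only [h1]
        rw [← ENNReal.ofReal_tsum_of_nonneg (fun i => by positivity)
          (he.inner_products_summable _)]
        exact ENNReal.ofReal_le_ofReal (he.tsum_inner_products_le _)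

theorem ContinuousLinearMap.reApplyInnerSelf_eq_norm_sqrt_sq {A : H →L[ℂ] H} (hA : 0 ≤ A) (x : H) :
    A.reApplyInnerSelf x = ‖CFC.sqrt A x‖ ^ 2 := by
  have h1 : (CFC.sqrt A).adjoint = CFC.sqrt A :=
    (CFC.sqrt_nonneg A).isSelfAdjoint
  have h2 : A x = CFC.sqrt A (CFC.sqrt A x) :=
    (DFunLike.congr_fun (CFC.sqrt_mul_sqrt_self A hA) x).symm
  rw [ContinuousLinearMap.reApplyInnerSelf_apply, h2, ← ContinuousLinearMap.adjoint_inner_right,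
    h1, inner_self_eq_norm_sq]

/-- The trace of a nonnegative operator over an orthonormal family is at most that over a
Hilbert basis. -/
theorem Orthonormal.summable_reApplyInnerSelf {ι κ : Type*} {e : κ → H} (he : Orthonormal ℂ e)
    (b : HilbertBasis ι ℂ H) {A : H →L[ℂ] H} (hA : 0 ≤ A)
    (hs : Summable fun i => A.reApplyInnerSelf (b i)) :
    Summable fun k => A.reApplyInnerSelf (e k) := by
  simp only [ContinuousLinearMap.reApplyInnerSelf_eq_norm_sqrt_sq hA] at hs ⊢
  have h1 : (CFC.sqrt A).adjoint = CFC.sqrt A :=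
    (CFC.sqrt_nonneg A).isSelfAdjoint
  have h2 := he.tsum_norm_map_sq_le b (CFC.sqrt A)
  rw [h1] at h2
  have h3 := ENNReal.summable_toReal (ne_top_of_le_ne_top hs.tsum_ofReal_ne_top h2)
  refine h3.congr fun k => ENNReal.toReal_ofReal (by positivity)

theorem ContinuousLinearMap.reApplyInnerSelf_mono {A B : H →L[ℂ] H} (h : A ≤ B) (x : H) :
    A.reApplyInnerSelf x ≤ B.reApplyInnerSelf x := by
  have h1 := ((ContinuousLinearMap.le_def A B).1 h).re_inner_nonneg_left x
  rw [sub_apply, inner_sub_left, map_sub, sub_nonneg] at h1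
  exact h1

theorem exists_spectrum_abs_bound (T : H →L[ℂ] H) :
    ∃ R > 0, ∀ x ∈ spectrum ℝ (CFC.abs T), 0 ≤ x ∧ x ≤ R := by
  refine ⟨‖CFC.abs T‖ * ‖(1 : H →L[ℂ] H)‖ + 1, by positivity, fun x hx => ⟨?_, ?_⟩⟩
  · exact spectrum_nonneg_of_nonneg (CFC.abs_nonneg T) hx
  · have h1 := spectrum.norm_le_norm_mul_of_mem hx
    have h2 := Real.le_norm_self x
    linarith

theorem reApplyInnerSelf_smul_pow_add (B : H →L[ℂ] H) (k : ℕ) (α β : ℝ) (f : H)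
    (hB : 0 ≤ B) :
    (cfc (fun x : ℝ => α * x ^ k + β) B).reApplyInnerSelf f =
      α * (B ^ k).reApplyInnerSelf f + β * ‖f‖ ^ 2 := by
  have hBs : IsSelfAdjoint B := hB.isSelfAdjoint
  have h1 : cfc (fun x : ℝ => α * x ^ k + β) B = α • B ^ k + algebraMap ℝ (H →L[ℂ] H) β := by
    rw [cfc_add_const β (fun x : ℝ => α * x ^ k) B, cfc_const_mul α (fun x : ℝ => x ^ k) B,
      cfc_pow_id B k]
  rw [h1, ContinuousLinearMap.reApplyInnerSelf_apply, ContinuousLinearMap.reApplyInnerSelf_apply,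
    Algebra.algebraMap_eq_smul_one]
  simp only [add_apply, smul_apply,
    one_apply_eq_self, inner_add_left, map_add]
  have h2 : ∀ (t : ℝ) (y z : H), RCLike.re ⟪t • y, z⟫_ℂ = t * RCLike.re ⟪y, z⟫_ℂ := by
    intro t y z
    rw [← Complex.coe_smul, inner_smul_left, Complex.conj_ofReal]
    simp
  rw [h2, h2, inner_self_eq_norm_sq]

/-- The functional calculus carries a scalar inequality on the spectrum to quadratic forms. It
trades fractional powers of `|T|` for integer powers, whose expectations are computable. -/
theorem le_reApplyInnerSelf_abs_rpow (T : H →L[ℂ] H) {s : ℝ} (hs : 0 < s) {k : ℕ} {α β : ℝ}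
    (h : ∀ x ∈ spectrum ℝ (CFC.abs T), α * x ^ k + β ≤ x ^ s) (f : H) :
    α * (CFC.abs T ^ k).reApplyInnerSelf f + β * ‖f‖ ^ 2 ≤
      (CFC.abs T ^ s).reApplyInnerSelf f := by
  rw [← reApplyInnerSelf_smul_pow_add _ _ _ _ _ (CFC.abs_nonneg T),
    CFC.rpow_eq_cfc_real (CFC.abs_nonneg T)]
  refine ContinuousLinearMap.reApplyInnerSelf_mono (cfc_mono h (by fun_prop) ?_) f
  exact (Real.continuous_rpow_const hs.le).continuousOn

theorem reApplyInnerSelf_abs_rpow_le (T : H →L[ℂ] H) {s : ℝ} (hs : 0 < s) {k : ℕ} {α β : ℝ}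
    (h : ∀ x ∈ spectrum ℝ (CFC.abs T), x ^ s ≤ α * x ^ k + β) (f : H) :
    (CFC.abs T ^ s).reApplyInnerSelf f ≤
      α * (CFC.abs T ^ k).reApplyInnerSelf f + β * ‖f‖ ^ 2 := by
  rw [← reApplyInnerSelf_smul_pow_add _ _ _ _ _ (CFC.abs_nonneg T),
    CFC.rpow_eq_cfc_real (CFC.abs_nonneg T)]
  refine ContinuousLinearMap.reApplyInnerSelf_mono (cfc_mono h ?_ (by fun_prop)) f
  exact (Real.continuous_rpow_const hs.le).continuousOn

theorem reApplyInnerSelf_abs_sq (T : H →L[ℂ] H) (f : H) :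
    (CFC.abs T ^ 2).reApplyInnerSelf f = ‖T f‖ ^ 2 := by
  rw [CFC.abs_sq, ContinuousLinearMap.reApplyInnerSelf_apply]
  change RCLike.re ⟪T.adjoint (T f), f⟫_ℂ = _
  rw [ContinuousLinearMap.adjoint_inner_left, inner_self_eq_norm_sq]

/-- The graph of the convex function `y ↦ y^{s/2}` lies above its tangent at `y = t²`; this is
Bernoulli's inequality for `(x / t)²`. -/
theorem rpow_tangent_le {x t s : ℝ} (hx : 0 ≤ x) (ht : 0 < t) (hs : 2 ≤ s) :
    s / 2 * t ^ (s - 2) * x ^ 2 + -((s / 2 - 1) * t ^ s) ≤ x ^ s := by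
  have h1 := one_add_mul_self_le_rpow_one_add (s := (x / t) ^ 2 - 1)
    (by have := sq_nonneg (x / t); linarith) (p := s / 2) (by linarith)
  have e1 : ((x / t) ^ 2) ^ (s / 2) = x ^ s / t ^ s := by
    rw [← Real.rpow_natCast (x / t), ← Real.rpow_mul (by positivity), ← Real.div_rpow hx ht.le]
    congr 1
    push_cast
    ring
  rw [add_sub_cancel, e1, le_div_iff₀ (by positivity)] at h1
  refine le_trans (le_of_eq ?_) h1
  rw [Real.rpow_sub ht, Real.rpow_ofNat]
  field_simp
  ring

/-- The concave counterpart: `y ↦ y^{s/(2j)}` lies below its tangent at `y = t^{2j}`. -/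
theorem rpow_le_pow_add {x t s : ℝ} (hx : 0 ≤ x) (ht : 0 < t) (hs : 0 < s) {j : ℕ}
    (hj : s ≤ 2 * j) :
    x ^ s ≤ s / (2 * j) * t ^ s / t ^ (2 * j) * x ^ (2 * j) + (1 - s / (2 * j)) * t ^ s := by
  have hj0 : (0 : ℝ) < 2 * j := hs.trans_le hj
  have h1 := rpow_one_add_le_one_add_mul_self (s := (x / t) ^ (2 * j) - 1)
    (by have : 0 ≤ (x / t) ^ (2 * j) := by positivity
        linarith) (p := s / (2 * j)) (by positivity) ((div_le_one hj0).2 hj)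
  have e1 : ((x / t) ^ (2 * j)) ^ (s / (2 * j)) = x ^ s / t ^ s := by
    rw [← Real.rpow_natCast (x / t), ← Real.rpow_mul (by positivity), ← Real.div_rpow hx ht.le]
    congr 1
    push_cast
    exact mul_div_cancel₀ s hj0.ne'
  rw [add_sub_cancel, e1, div_le_iff₀ (by positivity)] at h1
  refine h1.trans (le_of_eq ?_)
  rw [div_pow]
  field_simp
  ring

end Trace

/-! ### Schatten membership of graded operators. -/

section Graded

variable {H : Type*} [NormedAddCommGroup H] [InnerProductSpace ℂ H] [CompleteSpace H]

/-- `‖T^* f‖² = ⟨T T^* f, f⟩`, and `T^* f` again lies in `V`, so the bound for `T` applies to it. -/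
theorem norm_adjoint_le_of_norm_le {V : Submodule ℂ H} {T : H →L[ℂ] H} {c : ℝ}
    (hT' : ∀ f ∈ V, T.adjoint f ∈ V) (hc : ∀ f ∈ V, ‖T f‖ ≤ c * ‖f‖) {f : H} (hf : f ∈ V) :
    ‖T.adjoint f‖ ≤ c * ‖f‖ := by
  by_cases h0 : ‖T.adjoint f‖ = 0
  · have h1 := (norm_nonneg _).trans (hc f hf)
    rwa [h0]
  have h1 : ‖T.adjoint f‖ ^ 2 ≤ ‖T (T.adjoint f)‖ * ‖f‖ := by
    have h2 : ⟪T (T.adjoint f), f⟫_ℂ = ((‖T.adjoint f‖ ^ 2 : ℝ) : ℂ) := by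
      rw [← ContinuousLinearMap.adjoint_inner_right, inner_self_eq_ofReal]
    have h3 := norm_inner_le_norm (𝕜 := ℂ) (T (T.adjoint f)) f
    rwa [h2, Complex.norm_real, Real.norm_of_nonneg (sq_nonneg _)] at h3
  have h2 := mul_le_mul_of_nonneg_right (hc _ (hT' f hf)) (norm_nonneg f)
  have h3 : 0 < ‖T.adjoint f‖ := (norm_nonneg _).lt_of_ne' h0
  refine le_of_mul_le_mul_left ?_ h3
  calc ‖T.adjoint f‖ * ‖T.adjoint f‖ = ‖T.adjoint f‖ ^ 2 := by ring
    _ ≤ c * ‖T.adjoint f‖ * ‖f‖ := h1.trans h2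
    _ = _ := by ring

theorem reApplyInnerSelf_abs_pow_le {V : Submodule ℂ H} {T : H →L[ℂ] H} {c : ℝ} (hc0 : 0 ≤ c)
    (hT : ∀ f ∈ V, T f ∈ V) (hT' : ∀ f ∈ V, T.adjoint f ∈ V) (hc : ∀ f ∈ V, ‖T f‖ ≤ c * ‖f‖)
    (j : ℕ) {f : H} (hf : f ∈ V) :
    (CFC.abs T ^ (2 * j)).reApplyInnerSelf f ≤ c ^ (2 * j) * ‖f‖ ^ 2 := by
  have h1 : ∀ j : ℕ, ((star T * T) ^ j) f ∈ V ∧ ‖((star T * T) ^ j) f‖ ≤ c ^ (2 * j) * ‖f‖ := by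
    intro j
    induction j with
    | zero => simpa using hf
    | succ j ih =>
      rw [pow_succ']
      change T.adjoint (T (((star T * T) ^ j) f)) ∈ V ∧
        ‖T.adjoint (T (((star T * T) ^ j) f))‖ ≤ _
      refine ⟨hT' _ (hT _ ih.1), (norm_adjoint_le_of_norm_le hT' hc (hT _ ih.1)).trans ?_⟩
      calc c * ‖T (((star T * T) ^ j) f)‖ ≤ c * (c * (c ^ (2 * j) * ‖f‖)) := by
            have := hc _ ih.1
            have := ih.2
            gcongr
            exact (hc _ ih.1).trans (by gcongr)
        _ = _ := by ring
  rw [pow_mul, CFC.abs_sq, ContinuousLinearMap.reApplyInnerSelf_apply]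
  calc _ ≤ ‖⟪((star T * T) ^ j) f, f⟫_ℂ‖ := RCLike.re_le_norm _
    _ ≤ ‖((star T * T) ^ j) f‖ * ‖f‖ := norm_inner_le_norm _ _
    _ ≤ c ^ (2 * j) * ‖f‖ * ‖f‖ := by gcongr; exact (h1 j).2
    _ = _ := by ring

/-- Turns a Hilbert–Schmidt bound into one for `|T| ^ p`. For `p ≥ 2` the tangent inequality at the
mean size loses nothing essential and `q = p`. For `p ≤ 2` boundedness of the spectrum gives `x ^ p
≥ R ^ (p - 2) * x ^ 2` and `q = 2`, which is at most `d + 1` because `d ≥ 1`. -/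
theorem exists_le_sum_reApplyInnerSelf (T : H →L[ℂ] H) {p : ℝ} (hp : 0 < p) {d : ℕ} (hd : 1 ≤ d)
    (hpd : p ≤ d + 1) {c : ℝ} (hc : 0 < c) :
    ∃ c' > 0, ∃ q : ℝ, q ≤ d + 1 ∧ ∀ {ι : Type} [Fintype ι] {w : ℝ}, 0 < w → ∀ e : ι → H,
      (∀ i, ‖e i‖ = 1) → c / w ^ 2 * Fintype.card ι ≤ ∑ i, ‖T (e i)‖ ^ 2 →
      c' * Fintype.card ι / w ^ q ≤ ∑ i, (CFC.abs T ^ p).reApplyInnerSelf (e i) := by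
  rcases le_total 2 p with h2 | h2
  · refine ⟨c ^ (p / 2), by positivity, p, hpd, fun {ι} _ {w} hw e he hL => ?_⟩
    -- The tangent point is the guaranteed root mean square of `‖T (e i)‖`; there the linear and
    -- constant parts of the tangent add up to exactly `t ^ p` per vector.
    set t := Real.sqrt c / w with ht
    have ht0 : 0 < t := by positivity
    have h3 : ∀ i, p / 2 * t ^ (p - 2) * ‖T (e i)‖ ^ 2 + -((p / 2 - 1) * t ^ p) ≤
        (CFC.abs T ^ p).reApplyInnerSelf (e i) := fun i => by
      have h4 := le_reApplyInnerSelf_abs_rpow T hp (fun x hx =>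
        rpow_tangent_le (spectrum_nonneg_of_nonneg (CFC.abs_nonneg T) hx) ht0 h2) (e i)
      rwa [reApplyInnerSelf_abs_sq, he, one_pow, mul_one] at h4
    refine le_trans ?_ (Finset.sum_le_sum fun i _ => h3 i)
    rw [Finset.sum_add_distrib, ← Finset.mul_sum, Finset.sum_const, Finset.card_univ,
      nsmul_eq_mul]
    have h5 : t ^ 2 = c / w ^ 2 := by rw [ht, div_pow, Real.sq_sqrt hc.le]
    have h6 : t ^ p = c ^ (p / 2) / w ^ p := by
      rw [ht, Real.div_rpow (Real.sqrt_nonneg c) hw.le, Real.sqrt_eq_rpow, ← Real.rpow_mul hc.le]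
      congr 2
      ring
    have h7 : t ^ (p - 2) * t ^ 2 = t ^ p := by
      rw [← Real.rpow_natCast t 2, ← Real.rpow_add ht0]
      congr 1
      push_cast
      ring
    have h8 : p / 2 * t ^ (p - 2) * (t ^ 2 * Fintype.card ι) ≤
        p / 2 * t ^ (p - 2) * ∑ i, ‖T (e i)‖ ^ 2 := by
      rw [h5]
      gcongr
    refine le_trans (le_of_eq ?_) (add_le_add_left h8 _)
    rw [mul_div_right_comm, ← h6, ← h7]
    ring
  · obtain ⟨R, hR, hRs⟩ := exists_spectrum_abs_bound T
    have hd' : (1 : ℝ) ≤ d := by exact_mod_cast hd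
    refine ⟨R ^ (p - 2) * c, by positivity, 2, by linarith, fun {ι} _ {w} hw e he hL => ?_⟩
    have h3 : ∀ i, R ^ (p - 2) * ‖T (e i)‖ ^ 2 ≤
        (CFC.abs T ^ p).reApplyInnerSelf (e i) := fun i => by
      have h4 := le_reApplyInnerSelf_abs_rpow T hp (k := 2) (α := R ^ (p - 2)) (β := 0)
        (fun x hx => ?_) (e i)
      · rwa [reApplyInnerSelf_abs_sq, zero_mul, add_zero] at h4
      · obtain ⟨hx0, hxR⟩ := hRs x hx
        rcases hx0.eq_or_lt with h5 | h5
        · rw [← h5, Real.zero_rpow hp.ne']; simp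
        · have h6 : x ^ p = x ^ (p - 2) * x ^ 2 := by
            rw [← Real.rpow_natCast x 2, ← Real.rpow_add h5]
            congr 1
            push_cast
            ring
          rw [h6, add_zero]
          gcongr ?_ * _
          exact Real.rpow_le_rpow_of_nonpos h5 hxR (by linarith)
    refine le_trans ?_ (Finset.sum_le_sum fun i _ => h3 i)
    rw [← Finset.mul_sum, Real.rpow_ofNat]
    calc _ = R ^ (p - 2) * (c / w ^ 2 * Fintype.card ι) := by ring
      _ ≤ _ := by gcongr

/-- An even power `2j ≥ p` of `|T|` is controlled by the norm on `V`. The concave tangent inequality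
at `t` descends to the exponent `p`, its two terms summing to `t ^ p`. -/
theorem reApplyInnerSelf_abs_rpow_le_rpow {V : Submodule ℂ H} {T : H →L[ℂ] H} {t : ℝ} (ht : 0 < t)
    (hT : ∀ f ∈ V, T f ∈ V) (hT' : ∀ f ∈ V, T.adjoint f ∈ V) (hc : ∀ f ∈ V, ‖T f‖ ≤ t * ‖f‖)
    {p : ℝ} (hp : 0 < p) {f : H} (hf : f ∈ V) (hf1 : ‖f‖ = 1) :
    (CFC.abs T ^ p).reApplyInnerSelf f ≤ t ^ p := by
  obtain ⟨j, hj⟩ := exists_nat_ge (p / 2)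
  have hj' : p ≤ 2 * j := by linarith
  have hj0 : (0 : ℝ) < 2 * j := hp.trans_le hj'
  have h1 := reApplyInnerSelf_abs_rpow_le T hp (fun x hx =>
    rpow_le_pow_add (spectrum_nonneg_of_nonneg (CFC.abs_nonneg T) hx) ht hp hj') f
  have h2 := reApplyInnerSelf_abs_pow_le ht.le hT hT' hc j hf
  rw [hf1, one_pow, mul_one] at h1 h2
  refine h1.trans ?_
  have h3 : 0 ≤ p / (2 * j) * t ^ p / t ^ (2 * j) := by positivity
  calc _ ≤ p / (2 * j) * t ^ p / t ^ (2 * j) * t ^ (2 * j) + (1 - p / (2 * j)) * t ^ p :=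
        add_le_add_left (mul_le_mul_of_nonneg_left h2 h3) _
    _ = t ^ p := by
        rw [div_mul_cancel₀ _ (pow_pos ht _).ne']
        ring

/-- An operator of order `1 / m` on the component of degree `m` of a graded Hilbert space with
components of dimension of the order of `m ^ d` lies in `L^p` if and only if `p > d + 1`. -/
theorem isSchatten_iff_of_graded {V : ℕ → Submodule ℂ H} [∀ m, FiniteDimensional ℂ (V m)]
    (horth : OrthogonalFamily ℂ (fun m => V m) fun m => (V m).subtypeₗᵢ)
    (htot : ∀ x, (∀ m, ∀ f ∈ V m, ⟪f, x⟫_ℂ = 0) → x = 0) {T : H →L[ℂ] H}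
    (hT : ∀ m, ∀ f ∈ V m, T f ∈ V m) (hT' : ∀ m, ∀ f ∈ V m, T.adjoint f ∈ V m)
    {d : ℕ} (hd : 1 ≤ d) {A : ℝ} (hA : 0 < A)
    (hU : ∀ (m : ℕ), ∀ f ∈ V m, ‖T f‖ ≤ A / (m + 1) * ‖f‖)
    {c : ℝ} (hc : 0 < c) {M : ℕ} (hL : ∀ m, M ≤ m → c / (m + 1) ^ 2 * Module.finrank ℂ (V m) ≤
      ∑ i, ‖T (stdOrthonormalBasis ℂ (V m) i)‖ ^ 2)
    {N N' : ℝ} (hN : 0 < N) (hNm : ∀ m : ℕ, N * (m + 1) ^ d ≤ Module.finrank ℂ (V m))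
    (hNm' : ∀ m : ℕ, Module.finrank ℂ (V m) ≤ N' * (m + 1) ^ d) {p : ℝ} (hp : 0 < p) :
    IsSchatten p T ↔ (d : ℝ) + 1 < p := by
  let e : (Σ m, Fin (Module.finrank ℂ (V m))) → H := fun a => stdOrthonormalBasis ℂ (V a.1) a.2
  have he : Orthonormal ℂ e :=
    horth.orthonormal_sigma_orthonormal fun m => (stdOrthonormalBasis ℂ (V m)).orthonormal
  have heb : (Submodule.span ℂ (range e))ᗮ = ⊥ := by
    refine (Submodule.eq_bot_iff _).2 fun x hx => htot x fun m f hf => ?_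
    have h1 := congrArg Subtype.val ((stdOrthonormalBasis ℂ (V m)).sum_repr ⟨f, hf⟩)
    simp only [Submodule.coe_sum, Submodule.coe_smul] at h1
    rw [← h1]
    exact Submodule.inner_right_of_mem_orthogonal (Submodule.sum_mem _ fun i _ =>
      Submodule.smul_mem _ _ (Submodule.subset_span (mem_range_self (f := e) ⟨m, i⟩))) hx
  let b := HilbertBasis.mkOfOrthogonalEqBot he heb
  have hb : ∀ a, b a = e a := fun a => by
    simp only [b, HilbertBasis.coe_mkOfOrthogonalEqBot]
  have hpos : 0 ≤ CFC.abs T ^ p := CFC.rpow_nonneg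
  have hre : ∀ x, 0 ≤ (CFC.abs T ^ p).reApplyInnerSelf x := fun x => by
    rw [ContinuousLinearMap.reApplyInnerSelf_eq_norm_sqrt_sq hpos]
    positivity
  -- Summability of the diagonal of a positive operator does not depend on the orthonormal basis, so
  -- it may be tested on one adapted to the grading.
  have key : IsSchatten p T ↔ Summable fun a => (CFC.abs T ^ p).reApplyInnerSelf (e a) := by
    constructor
    · rintro ⟨s, b', hb'⟩
      exact he.summable_reApplyInnerSelf b' hpos hb'
    · intro h
      obtain ⟨s, b', -⟩ := exists_hilbertBasis ℂ H
      refine ⟨s, b', b'.orthonormal.summable_reApplyInnerSelf b hpos ?_⟩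
      simpa only [hb] using h
  rw [key, summable_sigma_of_nonneg fun a => hre _]
  simp only [tsum_fintype]
  have hnorm : ∀ m i, ‖(stdOrthonormalBasis ℂ (V m) i : H)‖ = 1 := fun m i =>
    (stdOrthonormalBasis ℂ (V m)).orthonormal.1 i
  constructor
  · rintro ⟨-, hs⟩
    by_contra! hpd
    obtain ⟨c', hc', q, hq, hlow'⟩ := exists_le_sum_reApplyInnerSelf T hp hd hpd hc
    have hlow : ∀ m, M ≤ m → c' * Module.finrank ℂ (V m) / ((m : ℝ) + 1) ^ q ≤
        ∑ i, (CFC.abs T ^ p).reApplyInnerSelf (e ⟨m, i⟩) := fun m hm => by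
      have h1 := hlow' (w := (m : ℝ) + 1) (by positivity) (fun i => e ⟨m, i⟩) (hnorm m)
        (by rw [Fintype.card_fin]; exact hL m hm)
      rwa [Fintype.card_fin] at h1
    -- Level `m` contributes at least a multiple of `(m + 1)^d / (m + 1)^q` with `q ≤ d + 1`, hence
    -- of `1 / (m + 1)`, and the harmonic series diverges.
    have hs' : Summable fun m : ℕ => c' * N * (1 / (((m + M : ℕ) + 1 : ℕ) : ℝ)) := by
      refine Summable.of_nonneg_of_le (fun m => by positivity) (fun m => ?_)
        ((summable_nat_add_iff M).2 hs)
      refine le_trans ?_ (hlow (m + M) (by omega))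
      have h1 := hNm (m + M)
      have h2 : (1 : ℝ) ≤ ((m + M : ℕ) : ℝ) + 1 := by
        have : (0 : ℝ) ≤ ((m + M : ℕ) : ℝ) := Nat.cast_nonneg _
        linarith
      have h3 : (((m + M : ℕ) : ℝ) + 1) ^ q ≤ (((m + M : ℕ) : ℝ) + 1) ^ (d + 1) := by
        rw [← Real.rpow_natCast]
        exact Real.rpow_le_rpow_of_exponent_le h2 (by push_cast; exact hq)
      rw [le_div_iff₀ (by positivity)]
      calc c' * N * (1 / (((m + M : ℕ) + 1 : ℕ) : ℝ)) * (((m + M : ℕ) : ℝ) + 1) ^ q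
          ≤ c' * N * (1 / (((m + M : ℕ) + 1 : ℕ) : ℝ)) * (((m + M : ℕ) : ℝ) + 1) ^ (d + 1) := by
            gcongr
        _ = c' * (N * (((m + M : ℕ) : ℝ) + 1) ^ d) := by
            rw [pow_succ]
            push_cast
            have : ((m : ℝ) + M + 1) ≠ 0 := by positivity
            field_simp
        _ ≤ _ := by gcongr
    have hs2 := (summable_mul_left_iff (by positivity : c' * N ≠ 0)).1 hs'
    have hs3 : Summable fun m : ℕ => 1 / ((m : ℕ) : ℝ) := by
      refine (summable_nat_add_iff (M + 1)).1 (hs2.congr fun m => ?_)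
      rw [add_assoc]
    exact Real.not_summable_one_div_natCast hs3
  · intro hpd
    refine ⟨fun m => (hasSum_fintype _).summable, ?_⟩
    have hone : ∀ m i, (CFC.abs T ^ p).reApplyInnerSelf (e ⟨m, i⟩) ≤ (A / (m + 1)) ^ p :=
      fun m i => reApplyInnerSelf_abs_rpow_le_rpow (by positivity) (hT m) (hT' m) (hU m) hp
        (Submodule.coe_mem _) (hnorm m i)
    -- About `(m + 1)^d` vectors contribute `O((m + 1)^{-p})` each, and `p - d > 1`.
    have hsum : Summable fun m : ℕ => N' * A ^ p * (1 / ((m + 1 : ℕ) : ℝ) ^ (p - d)) := by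
      refine Summable.mul_left _ ?_
      exact (summable_nat_add_iff 1).2 (Real.summable_one_div_nat_rpow.2 (by linarith))
    refine Summable.of_nonneg_of_le (fun m => Finset.sum_nonneg fun i _ => hre _) (fun m => ?_) hsum
    calc _ ≤ ∑ _ : Fin (Module.finrank ℂ (V m)), (A / (m + 1)) ^ p :=
          Finset.sum_le_sum fun i _ => hone m i
      _ = Module.finrank ℂ (V m) * (A / (m + 1)) ^ p := by
          rw [Finset.sum_const, Finset.card_univ, Fintype.card_fin, nsmul_eq_mul]
      _ ≤ N' * (m + 1) ^ d * (A / (m + 1)) ^ p := by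
          have := hNm' m
          gcongr
      _ = _ := by
          have hm : (0 : ℝ) < (m : ℝ) + 1 := by positivity
          rw [Real.div_rpow hA.le hm.le]
          push_cast
          rw [Real.rpow_sub hm, Real.rpow_natCast]
          field_simp

end Graded

/-! ### The Drury–Arveson quotient modules as graded function spaces. -/

namespace DruryArveson

variable {n : ℕ}

/-- The multi-indices of degree `m`. -/
def multiIndices (n m : ℕ) : Finset (Fin n →₀ ℕ) := Finset.univ.finsuppAntidiag m

theorem mem_multiIndices {m : ℕ} {k : Fin n →₀ ℕ} : k ∈ multiIndices n m ↔ k.degree = m := by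
  simp [multiIndices, Finset.mem_finsuppAntidiag, Finsupp.degree_eq_sum]

theorem monomialNormSq_pos (k : Fin n →₀ ℕ) : 0 < monomialNormSq k := by
  unfold monomialNormSq
  have : 0 < ∏ i, (k i).factorial := Finset.prod_pos fun i _ => Nat.factorial_pos _
  positivity

/-- The squared norms are reciprocal multinomial coefficients, which is why powers of linear forms
are the reproducing kernels. -/
theorem monomialNormSq_mul_multinomial (k : Fin n →₀ ℕ) :
    monomialNormSq k * k.multinomial = 1 := by
  have h1 := Nat.multinomial_spec Finset.univ k
  rw [Finsupp.multinomial_of_support_subset (Finset.subset_univ _)] at h1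
  have h2 : (((∏ i, (k i).factorial : ℕ) : ℝ)) * k.multinomial = (k.degree.factorial : ℕ) := by
    rw [Finsupp.degree_eq_sum]
    exact_mod_cast h1
  have h3 : ((k.degree.factorial : ℕ) : ℝ) ≠ 0 := by positivity
  rw [monomialNormSq, div_mul_eq_mul_div, h2, div_self h3]

theorem monomialNormSq_add_single (α : Fin n) (l : Fin n →₀ ℕ) :
    monomialNormSq (l + Finsupp.single α 1) =
      ((l α : ℝ) + 1) / ((l.degree : ℝ) + 1) * monomialNormSq l := by
  have hprod : ∏ i, ((l + Finsupp.single α 1 : Fin n →₀ ℕ) i).factorial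
      = (l α + 1) * ∏ i, (l i).factorial := by
    rw [← Finset.mul_prod_erase Finset.univ _ (Finset.mem_univ α),
      ← Finset.mul_prod_erase Finset.univ (fun i => (l i).factorial) (Finset.mem_univ α),
      ← mul_assoc]
    congr 1
    · simp [Nat.factorial_succ]
    · refine Finset.prod_congr rfl fun i hi => ?_
      have : α ≠ i := fun e => (Finset.mem_erase.1 hi).1 e.symm
      simp [this]
  have hdeg : (l + Finsupp.single α 1).degree = l.degree + 1 := by simp
  unfold monomialNormSq
  rw [hprod, hdeg, Nat.factorial_succ]
  push_cast
  rw [mul_div_mul_comm]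

/-- The homogeneous component of degree `m` of the reproducing kernel of `H²_n` at the point `x`. -/
noncomputable def kernel (m : ℕ) (x : Fin n → ℂ) : Space n :=
  ofPoly ((∑ i, conj (x i) • MvPolynomial.X i) ^ m)

theorem kernel_apply (m : ℕ) (x : Fin n → ℂ) (k : Fin n →₀ ℕ) :
    kernel m x k = if k ∈ multiIndices n m then
      (((Real.sqrt (monomialNormSq k))⁻¹ : ℝ) : ℂ) * conj (∏ i, x i ^ k i) else 0 := by
  change (Real.sqrt (monomialNormSq k) : ℂ) *
    MvPolynomial.coeff k ((∑ i, conj (x i) • MvPolynomial.X i) ^ m) = _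
  rw [MvPolynomial.coeff_linearCombination_X_pow_of_fintype]
  have h1 : (k.sum fun _ m => m) = k.degree := rfl
  rw [h1]
  simp only [mem_multiIndices]
  split_ifs with h
  · have h2 : (k.prod fun i j => conj (x i) ^ j) = conj (∏ i, x i ^ k i) := by
      rw [Finsupp.prod_fintype _ _ fun i => pow_zero _, map_prod]
      simp only [map_pow]
    rw [h2, ← mul_assoc]
    congr 1
    have h3 := monomialNormSq_mul_multinomial k
    have h4 := Real.mul_self_sqrt (monomialNormSq_pos k).le
    have h5 := (Real.sqrt_pos.2 (monomialNormSq_pos k)).ne'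
    have h6 : Real.sqrt (monomialNormSq k) * k.multinomial = (Real.sqrt (monomialNormSq k))⁻¹ := by
      refine eq_inv_of_mul_eq_one_left ?_
      rw [mul_right_comm, h4, h3]
    rw [← h6]
    push_cast
    rfl
  · rw [mul_zero]

theorem inner_kernel (m : ℕ) (x : Fin n → ℂ) (f : Space n) :
    ⟪kernel m x, f⟫_ℂ = ∑ k ∈ multiIndices n m,
      (((Real.sqrt (monomialNormSq k))⁻¹ : ℝ) : ℂ) * (∏ i, x i ^ k i) * f k := by
  rw [lp.inner_eq_tsum, tsum_eq_sum (s := multiIndices n m)]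
  · refine Finset.sum_congr rfl fun k hk => ?_
    rw [kernel_apply, if_pos hk, RCLike.inner_apply, map_mul, Complex.conj_ofReal,
      Complex.conj_conj, mul_comm]
  · intro k hk
    rw [kernel_apply, if_neg hk, inner_zero_left]

theorem eval_homogeneousComponent (m : ℕ) (x : Fin n → ℂ) (q : MvPolynomial (Fin n) ℂ) :
    MvPolynomial.eval x (MvPolynomial.homogeneousComponent m q) =
      ∑ k ∈ multiIndices n m, q.coeff k * ∏ i, x i ^ k i := by
  rw [MvPolynomial.eval_eq', Finset.sum_subset (s₂ := multiIndices n m)]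
  · refine Finset.sum_congr rfl fun k hk => ?_
    rw [MvPolynomial.coeff_homogeneousComponent, if_pos (mem_multiIndices.1 hk)]
  · intro k hk
    rw [MvPolynomial.mem_support_iff, MvPolynomial.coeff_homogeneousComponent] at hk
    rw [mem_multiIndices]
    by_contra h
    exact hk (if_neg h)
  · intro k _ hk
    rw [MvPolynomial.notMem_support_iff.1 hk, zero_mul]

theorem inner_kernel_ofPoly (m : ℕ) (x : Fin n → ℂ) (q : MvPolynomial (Fin n) ℂ) :
    ⟪kernel m x, ofPoly q⟫_ℂ = MvPolynomial.eval x (MvPolynomial.homogeneousComponent m q) := by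
  rw [inner_kernel, eval_homogeneousComponent]
  refine Finset.sum_congr rfl fun k _ => ?_
  change _ * _ * ((Real.sqrt (monomialNormSq k) : ℂ) * q.coeff k) = _
  have h5 : ((Real.sqrt (monomialNormSq k) : ℝ) : ℂ) ≠ 0 :=
    Complex.ofReal_ne_zero.2 (Real.sqrt_pos.2 (monomialNormSq_pos k)).ne'
  rw [Complex.ofReal_inv]
  field_simp

theorem inner_kernel_kernel (m m' : ℕ) (x y : Fin n → ℂ) :
    ⟪kernel m x, kernel m' y⟫_ℂ = if m = m' then (∑ i, x i * conj (y i)) ^ m else 0 := by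
  have h1 : ((∑ i, conj (y i) • MvPolynomial.X i : MvPolynomial (Fin n) ℂ) ^ m').IsHomogeneous
      m' := by
    have h2 : (∑ i, conj (y i) • MvPolynomial.X i : MvPolynomial (Fin n) ℂ).IsHomogeneous 1 :=
      MvPolynomial.IsHomogeneous.sum _ _ _ fun i _ => by
        rw [MvPolynomial.smul_eq_C_mul]
        exact MvPolynomial.isHomogeneous_C_mul_X _ _
    simpa using h2.pow m'
  rw [show kernel m' y = ofPoly _ from rfl, inner_kernel_ofPoly,
    MvPolynomial.homogeneousComponent_of_mem h1]
  split_ifs with h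
  · subst h
    simp [MvPolynomial.smul_eval, mul_comm]
  · simp

/-- Reindexing by `k = l + e_α`: the square-root weight of the shift cancels against the quotient of
the two monomial norms, and the indices with `k α = 0` contribute nothing. -/
theorem inner_kernel_succ_shift (m : ℕ) (x : Fin n → ℂ) (α : Fin n) (f : Space n) :
    ⟪kernel (m + 1) x, shift α f⟫_ℂ = x α * ⟪kernel m x, f⟫_ℂ := by
  rw [inner_kernel, inner_kernel, Finset.mul_sum]
  symm
  refine Finset.sum_of_injOn (fun l => l + Finsupp.single α 1)
    ((add_left_injective (Finsupp.single α 1)).injOn) ?_ ?_ ?_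
  · intro l hl
    rw [Finset.mem_coe, mem_multiIndices] at hl ⊢
    simp [hl]
  · intro k _ hk
    change _ * shiftFun α f k = 0
    rw [shiftFun, if_pos, mul_zero]
    by_contra h
    refine hk ⟨k - Finsupp.single α 1, ?_, ?_⟩
    all_goals have h1 : k - Finsupp.single α 1 + Finsupp.single α 1 = k :=
      tsub_add_cancel_of_le (by rw [Finsupp.single_le_iff]; omega)
    · rw [Finset.mem_coe, mem_multiIndices]
      have h2 := congrArg Finsupp.degree h1
      rw [map_add, Finsupp.degree_single] at h2
      rename_i h3
      rw [mem_multiIndices] at h3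
      omega
    · exact h1
  · intro l hl
    change _ = _ * shiftFun α f (l + Finsupp.single α 1)
    have h1 : (l + Finsupp.single α 1 : Fin n →₀ ℕ) α ≠ 0 := by simp
    rw [shiftFun, if_neg h1, add_tsub_cancel_right, monomialNormSq_add_single]
    have h2 : ∏ i, x i ^ (l + Finsupp.single α 1 : Fin n →₀ ℕ) i = x α * ∏ i, x i ^ l i := by
      simp only [Finsupp.add_apply, pow_add, Finset.prod_mul_distrib]
      rw [mul_comm]
      congr 1
      rw [Finset.prod_eq_single α] <;> simp +contextual
    have h3 : (((l + Finsupp.single α 1 : Fin n →₀ ℕ) α : ℕ) : ℝ) = l α + 1 := by simp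
    have h4 : (((l + Finsupp.single α 1).degree : ℕ) : ℝ) = l.degree + 1 := by simp
    rw [h2, h3, h4]
    set u : ℝ := ((l α : ℝ) + 1) / ((l.degree : ℝ) + 1)
    have hu : 0 < u := by positivity
    rw [Real.sqrt_mul hu.le]
    have h5 : ((Real.sqrt u : ℝ) : ℂ) ≠ 0 := Complex.ofReal_ne_zero.2 (Real.sqrt_pos.2 hu).ne'
    rw [mul_inv, Complex.ofReal_mul, Complex.ofReal_inv (Real.sqrt u)]
    field_simp

theorem inner_kernel_zero_shift (x : Fin n → ℂ) (α : Fin n) (f : Space n) :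
    ⟪kernel 0 x, shift α f⟫_ℂ = 0 := by
  rw [inner_kernel]
  refine Finset.sum_eq_zero fun k hk => ?_
  rw [mem_multiIndices] at hk
  change _ * shiftFun α f k = 0
  have h1 : k α = 0 := by
    have := Finsupp.le_degree α k
    omega
  rw [shiftFun, if_pos h1, mul_zero]

/-- Along the punctured line through `x`, `q` is a polynomial in the scalar with infinitely many
zeros, and its coefficients are the values of the homogeneous components. -/
theorem eval_homogeneousComponent_eq_zero {C : Set (Fin n → ℂ)}
    (hC : ∀ x ∈ C, ∀ c : ℂ, c ≠ 0 → c • x ∈ C) {q : MvPolynomial (Fin n) ℂ}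
    (hq : q ∈ vanishingPolys C) (m : ℕ) {x : Fin n → ℂ} (hx : x ∈ C) :
    MvPolynomial.eval x (MvPolynomial.homogeneousComponent m q) = 0 := by
  let P : Polynomial ℂ := ∑ j ∈ Finset.range (q.totalDegree + 1),
    Polynomial.C (MvPolynomial.eval x (MvPolynomial.homogeneousComponent j q)) * Polynomial.X ^ j
  have hP : P = 0 := by
    refine Polynomial.eq_zero_of_infinite_isRoot P ?_
    refine Set.Infinite.mono (s := {0}ᶜ) ?_ (Set.finite_singleton (0 : ℂ)).infinite_compl
    intro t ht
    have h1 := hq (t • x) (hC x hx t ht)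
    rw [← MvPolynomial.sum_homogeneousComponent q, map_sum] at h1
    change P.eval t = 0
    rw [Polynomial.eval_finsetSum, ← h1]
    refine Finset.sum_congr rfl fun j _ => ?_
    rw [Polynomial.eval_mul, Polynomial.eval_C, Polynomial.eval_pow, Polynomial.eval_X,
      eval_homogeneousComponent, eval_homogeneousComponent, Finset.sum_mul]
    refine Finset.sum_congr rfl fun k hk => ?_
    have h2 : ∏ i, (t • x) i ^ k i = t ^ j * ∏ i, x i ^ k i := by
      simp only [Pi.smul_apply, smul_eq_mul, mul_pow, Finset.prod_mul_distrib]
      rw [Finset.prod_pow_eq_pow_sum, ← Finsupp.degree_eq_sum, mem_multiIndices.1 hk]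
    rw [h2]
    ring
  have h3 := congrArg (fun Q => Polynomial.coeff Q m) hP
  simp only [P, Polynomial.finsetSum_coeff, Polynomial.coeff_C_mul_X_pow, Polynomial.coeff_zero]
    at h3
  rw [Finset.sum_ite_eq] at h3
  by_cases hm : m ∈ Finset.range (q.totalDegree + 1)
  · rwa [if_pos hm] at h3
  · rw [MvPolynomial.homogeneousComponent_eq_zero, map_zero]
    simpa [Nat.lt_succ_iff] using hm

theorem kernel_mem_quotientModule {C : Set (Fin n → ℂ)}
    (hC : ∀ x ∈ C, ∀ c : ℂ, c ≠ 0 → c • x ∈ C) (m : ℕ) {x : Fin n → ℂ} (hx : x ∈ C) :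
    kernel m x ∈ quotientModule C := by
  rw [Submodule.mem_orthogonal']
  intro u hu
  induction hu using Submodule.span_induction with
  | mem u hu =>
    obtain ⟨q, hq, rfl⟩ := hu
    rw [inner_kernel_ofPoly, eval_homogeneousComponent_eq_zero hC hq m hx]
  | zero => exact inner_zero_right _
  | add u w _ _ hu hw => rw [inner_add_right, hu, hw, add_zero]
  | smul c u _ hu => rw [inner_smul_right, hu, mul_zero]

/-- The degree-`m` part of `f` is itself a polynomial vanishing on `C`, so `f` is orthogonal to it;
but this inner product is the sum of the `‖f l‖²` over degree `m`. -/
theorem eq_zero_of_inner_kernel {C : Set (Fin n → ℂ)} {f : Space n} (hf : f ∈ quotientModule C)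
    (h0 : ∀ m, ∀ x ∈ C, ⟪kernel m x, f⟫_ℂ = 0) : f = 0 := by
  ext k
  set m := k.degree with hm
  let q : MvPolynomial (Fin n) ℂ := ∑ l ∈ multiIndices n m,
    MvPolynomial.monomial l ((((Real.sqrt (monomialNormSq l))⁻¹ : ℝ) : ℂ) * f l)
  have hqv : q ∈ vanishingPolys C := by
    intro x hx
    rw [← h0 m x hx, inner_kernel, map_sum]
    refine Finset.sum_congr rfl fun l _ => ?_
    rw [MvPolynomial.eval_monomial, Finsupp.prod_fintype _ _ fun i => pow_zero _]
    ring
  have hqc : ∀ l, ofPoly q l = if l ∈ multiIndices n m then f l else 0 := by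
    intro l
    change (Real.sqrt (monomialNormSq l) : ℂ) * q.coeff l = _
    have h1 : q.coeff l = if l ∈ multiIndices n m then
        (((Real.sqrt (monomialNormSq l))⁻¹ : ℝ) : ℂ) * f l else 0 := by
      simp only [q, MvPolynomial.coeff_sum, MvPolynomial.coeff_monomial]
      rw [Finset.sum_ite_eq']
    rw [h1]
    split_ifs
    · have h5 : ((Real.sqrt (monomialNormSq l) : ℝ) : ℂ) ≠ 0 :=
        Complex.ofReal_ne_zero.2 (Real.sqrt_pos.2 (monomialNormSq_pos l)).ne'
      rw [Complex.ofReal_inv, mul_inv_cancel_left₀ h5]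
    · rw [mul_zero]
  have h1 : ⟪ofPoly q, f⟫_ℂ = 0 :=
    (Submodule.mem_orthogonal _ _).1 hf _ (Submodule.subset_span ⟨q, hqv, rfl⟩)
  have h2 : ⟪ofPoly q, f⟫_ℂ = ((∑ l ∈ multiIndices n m, ‖f l‖ ^ 2 : ℝ) : ℂ) := by
    rw [lp.inner_eq_tsum, tsum_eq_sum (s := multiIndices n m)]
    · rw [Complex.ofReal_sum]
      refine Finset.sum_congr rfl fun l hl => ?_
      rw [hqc, if_pos hl, inner_self_eq_ofReal]
    · intro l hl
      rw [hqc, if_neg hl, inner_zero_left]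
  rw [h2, Complex.ofReal_eq_zero, Finset.sum_eq_zero_iff_of_nonneg fun l _ => by positivity] at h1
  have h3 := h1 k (mem_multiIndices.2 rfl)
  simpa using h3

/-- The vectors supported on the multi-indices of degree `m` form a finite-dimensional space. -/
theorem finiteDimensional_of_support {V : Submodule ℂ (Space n)} {m : ℕ}
    (hV : ∀ f ∈ V, ∀ k ∉ multiIndices n m, f k = 0) : FiniteDimensional ℂ V := by
  let Φ : V →ₗ[ℂ] (multiIndices n m → ℂ) :=
    { toFun := fun f k => (f : Space n) k
      map_add' := fun f g => rfl
      map_smul' := fun c f => rfl }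
  refine FiniteDimensional.of_injective Φ fun f g hfg => Subtype.ext (lp.ext (funext fun k => ?_))
  by_cases hk : k ∈ multiIndices n m
  · exact congrFun hfg ⟨k, hk⟩
  · rw [hV f f.2 k hk, hV g g.2 k hk]

/-- The kernels of a quotient module, for points of the cone in Euclidean space. -/
noncomputable def quotientKernel (C : Set (Fin n → ℂ)) (m : ℕ) (x : EuclideanSpace ℂ (Fin n)) :
    quotientModule C :=
  (quotientModule C).orthogonalProjectionOnto (kernel m x.ofLp)

/-- Multiplication by a linear functional, compressed to a quotient module. -/
noncomputable def compressedMul (C : Set (Fin n → ℂ)) (q : EuclideanSpace ℂ (Fin n)) :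
    quotientModule C →L[ℂ] quotientModule C :=
  ∑ i, conj (q i) • compressedShift C i

theorem compressedMul_single (C : Set (Fin n → ℂ)) (α : Fin n) :
    compressedMul C (EuclideanSpace.single α 1) = compressedShift C α := by
  rw [compressedMul, Finset.sum_eq_single α]
  · simp
  · intro i _ hi
    rw [PiLp.single_apply, if_neg hi, map_zero]
    exact zero_smul ℂ (compressedShift C i)
  · simp

theorem coe_quotientKernel {C : Set (Fin n → ℂ)}
    (hC : ∀ x ∈ C, ∀ c : ℂ, c ≠ 0 → c • x ∈ C) (m : ℕ) {x : EuclideanSpace ℂ (Fin n)}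
    (hx : x.ofLp ∈ C) : (quotientKernel C m x : Space n) = kernel m x.ofLp :=
  congrArg Subtype.val ((quotientModule C).orthogonalProjectionOnto_mem_subspace_eq_self
    ⟨_, kernel_mem_quotientModule hC m hx⟩)

theorem inner_compressedMul (C : Set (Fin n → ℂ)) (q : EuclideanSpace ℂ (Fin n))
    (u f : quotientModule C) :
    ⟪u, compressedMul C q f⟫_ℂ = ∑ i, conj (q i) * ⟪(u : Space n), shift i (f : Space n)⟫_ℂ := by
  simp only [compressedMul, sum_apply, smul_apply, inner_sum, inner_smul_right]
  refine Finset.sum_congr rfl fun i _ => ?_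
  congr 1
  exact Submodule.inner_orthogonalProjectionOnto_eq_of_mem_left _ _

/-- The quotient module of a cone is a graded Hilbert space of functions on the cone. -/
theorem isFockSystem {C : Set (Fin n → ℂ)} (hC : ∀ x ∈ C, ∀ c : ℂ, c ≠ 0 → c • x ∈ C) :
    IsFockSystem {x : EuclideanSpace ℂ (Fin n) | x.ofLp ∈ C} (quotientKernel C)
      (compressedMul C) where
  inner_kernel m m' x hx y hy := by
    rw [Submodule.coe_inner, coe_quotientKernel hC m hx, coe_quotientKernel hC m' hy,
      inner_kernel_kernel, PiLp.inner_apply]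
    rfl
  total f hf := by
    refine Subtype.ext (eq_zero_of_inner_kernel f.2 fun m x hx => ?_)
    have h1 := hf m (WithLp.toLp 2 x) hx
    rwa [Submodule.coe_inner, coe_quotientKernel hC m (x := WithLp.toLp 2 x) hx] at h1
  inner_succ m x hx q f := by
    rw [inner_compressedMul, Submodule.coe_inner, coe_quotientKernel hC _ hx,
      coe_quotientKernel hC _ hx, PiLp.inner_apply, Finset.sum_mul]
    refine Finset.sum_congr rfl fun i _ => ?_
    rw [inner_kernel_succ_shift, RCLike.inner_apply]
    ring
  inner_zero x hx q f := by
    rw [inner_compressedMul, coe_quotientKernel hC _ hx]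
    refine Finset.sum_eq_zero fun i _ => ?_
    rw [inner_kernel_zero_shift, mul_zero]
  finite m := by
    set W := Submodule.span ℂ (quotientKernel C m '' {x | x.ofLp ∈ C})
    have h1 : FiniteDimensional ℂ (W.map (quotientModule C).subtype) := by
      refine finiteDimensional_of_support (m := m) ?_
      rintro _ ⟨f, hf, rfl⟩ k hk
      induction hf using Submodule.span_induction with
      | mem f hf =>
        obtain ⟨x, hx, rfl⟩ := hf
        rw [Submodule.subtype_apply, coe_quotientKernel hC m hx, kernel_apply, if_neg hk]
      | zero => rfl
      | add f g _ _ hf hg =>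
        rw [map_add, lp.coeFn_add, Pi.add_apply, hf, hg, add_zero]
      | smul c f _ hf =>
        rw [map_smul, lp.coeFn_smul, Pi.smul_apply, hf, smul_zero]
    exact LinearEquiv.finiteDimensional
      (Submodule.equivMapOfInjective (quotientModule C).subtype Subtype.val_injective W).symm

theorem crossCommutator_eq (C : Set (Fin n → ℂ)) (α β : Fin n) :
    crossCommutator C α β = mulCommutator (compressedMul C) (EuclideanSpace.single α 1)
      (EuclideanSpace.single β 1) := by
  rw [mulCommutator, compressedMul_single, compressedMul_single]
  rfl

end DruryArveson

/-! ### The Schatten criterion for orbits. -/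

section Abstract

variable {Γ E H : Type*} [Group Γ] [NormedAddCommGroup E] [InnerProductSpace ℂ E]
  [NormedAddCommGroup H] [InnerProductSpace ℂ H] [CompleteSpace H]
  [TopologicalSpace Γ] [IsTopologicalGroup Γ] [CompactSpace Γ] [FiniteDimensional ℂ E]
  {ρ : Γ →* (E ≃ₗᵢ[ℂ] E)} {v : E} {T : Submodule ℂ E} {φ : E → E} {r : ℝ}
  {K : ℕ → E → H} {S : E → H →L[ℂ] H}

/-- If `T` is the line of `v`, both terms of the symbol coincide. A nonzero symbol therefore forces
`d ≥ 1`, as the graded criterion requires. -/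
theorem IsKahlerOrbit.commutatorSymbol_eq_zero_of_finrank_eq_one (ho : IsKahlerOrbit ρ v T φ r)
    (hT : Module.finrank ℂ T = 1) (p q : E) (g : Γ) : commutatorSymbol ρ v T p q g = 0 := by
  have hv0 : v ≠ 0 := fun h0 => by simpa [h0] using ho.norm_eq
  have hTv : T = Submodule.span ℂ {v} := by
    refine (Submodule.eq_of_le_of_finrank_eq ?_ ?_).symm
    · rw [Submodule.span_singleton_le_iff_mem]
      exact ho.retraction.mem
    · rw [finrank_span_singleton hv0, hT]
  subst hTv
  rw [commutatorSymbol, Submodule.starProjection_unit_singleton ℂ ho.norm_eq, inner_smul_right,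
    sub_self]

theorem IsFockSystem.orthogonalFamily {X : Set E} (h : IsFockSystem X K S) :
    OrthogonalFamily ℂ (fun m => level X K m) fun m => (level X K m).subtypeₗᵢ := by
  rintro m m' hm ⟨f, hf⟩ ⟨g, hg⟩
  change ⟪f, g⟫_ℂ = 0
  induction hf using Submodule.span_induction with
  | mem f hf =>
    obtain ⟨x, hx, rfl⟩ := hf
    exact h.inner_of_ne hm hx hg
  | zero => exact inner_zero_left _
  | add f f' _ _ hf hf' => rw [inner_add_left, hf, hf', add_zero]
  | smul c f _ hf => rw [inner_smul_left, hf, mul_zero]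

variable [MeasurableSpace Γ] [BorelSpace Γ]

/-- A cross-commutator with nonvanishing symbol belongs to the Schatten class of exponent `s`
precisely for `s > d + 1`, where `d` is the dimension of the orbit. -/
theorem IsFockSystem.isSchatten_mulCommutator_iff (μ : Measure Γ) [IsProbabilityMeasure μ]
    [μ.IsMulLeftInvariant] [μ.IsOpenPosMeasure] (h : IsFockSystem (orbitConeOf ρ v) K S)
    (ho : IsKahlerOrbit ρ v T φ r) {d : ℕ} (hd : Module.finrank ℂ T = d + 1) {p q : E}
    (hσ : ∃ g, commutatorSymbol ρ v T p q g ≠ 0) {s : ℝ} (hs : 0 < s) :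
    IsSchatten s (mulCommutator S p q) ↔ (d : ℝ) + 1 < s := by
  obtain ⟨g₀, hg₀⟩ := hσ
  have hd1 : 1 ≤ d := by
    by_contra hd0
    exact hg₀ (ho.commutatorSymbol_eq_zero_of_finrank_eq_one (by omega) p q g₀)
  obtain ⟨C, hC0, hC⟩ := ho.exists_norm_sub_starProjection_sq_le
  have ha := h.isMomentSequence (μ := μ) ho hd hC0 hC
  obtain ⟨A, hA, hAm⟩ := h.exists_norm_mulCommutator_le ho ha p q
  obtain ⟨c, hc, M, hM⟩ := h.exists_le_sum_norm_mulCommutator_sq ho ha hC hg₀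
  obtain ⟨B, hB, hBm⟩ := ha.exists_le_div
  obtain ⟨B', hB', hBm'⟩ := ha.exists_div_le
  have := h.finiteDimensional
  have hdim := fun m => h.finrank_mul_moment ho (μ := μ) m
  -- The dimensions are reciprocals of the moments, so the two-sided bounds on the moments enter
  -- inverted; `A + 1` replaces `A` to be strictly positive.
  refine isSchatten_iff_of_graded (V := level (orbitConeOf ρ v) K) h.orthogonalFamily
    (fun x hx => h.total x fun m y hy => hx m _ (IsFockSystem.kernel_mem m hy))
    (fun m f hf => h.mulCommutator_mem_level p q hf)
    (fun m f hf => ?_) hd1 (A := A + 1) (by positivity) (fun m f hf => ?_) hc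
    (fun m hm => hM m hm _) (N := B⁻¹) (N' := B'⁻¹) (by positivity) (fun m => ?_) (fun m => ?_) hs
  · rw [IsFockSystem.adjoint_mulCommutator]
    exact h.mulCommutator_mem_level q p hf
  · refine (hAm m f hf).trans ?_
    gcongr
    linarith
  · have hx : (0 : ℝ) < (m + 1) ^ d := by positivity
    have h1 := mul_le_mul_of_nonneg_left (hBm m)
      (Nat.cast_nonneg (α := ℝ) (Module.finrank ℂ (level (orbitConeOf ρ v) K m)))
    rw [hdim m, mul_div_assoc', le_div_iff₀ hx, one_mul] at h1
    rw [inv_mul_le_iff₀ hB]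
    linarith
  · have hx : (0 : ℝ) < (m + 1) ^ d := by positivity
    have h1 := mul_le_mul_of_nonneg_left (hBm' m)
      (Nat.cast_nonneg (α := ℝ) (Module.finrank ℂ (level (orbitConeOf ρ v) K m)))
    rw [hdim m, mul_div_assoc', div_le_iff₀ hx, one_mul] at h1
    rw [inv_mul_eq_div, le_div_iff₀ hB']
    linarith

end Abstract

/-! ### Closed groups of unitary matrices acting on Euclidean space. -/

section Unitary

variable {n : ℕ}

theorem isCompact_unitaryGroup :
    IsCompact (Matrix.unitaryGroup (Fin n) ℂ : Set (Matrix (Fin n) (Fin n) ℂ)) := by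
  have h1 : IsCompact (Set.pi univ fun _ : Fin n => Set.pi univ fun _ : Fin n =>
      closedBall (0 : ℂ) 1) :=
    isCompact_univ_pi fun _ => isCompact_univ_pi fun _ => isCompact_closedBall _ _
  have h2 : IsClosed (Matrix.unitaryGroup (Fin n) ℂ : Set (Matrix (Fin n) (Fin n) ℂ)) :=
    isClosed_unitary (R := Matrix (Fin n) (Fin n) ℂ)
  refine h1.of_isClosed_subset h2 fun U hU i _ j _ => ?_
  rw [mem_closedBall_zero_iff]
  exact entry_norm_bound_of_unitary hU i j

theorem compactSpace_of_isClosed {G : Subgroup (Matrix.unitaryGroup (Fin n) ℂ)}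
    (hG : IsClosed (G : Set (Matrix.unitaryGroup (Fin n) ℂ))) : CompactSpace G := by
  have : CompactSpace (Matrix.unitaryGroup (Fin n) ℂ) :=
    isCompact_iff_compactSpace.1 isCompact_unitaryGroup
  exact isCompact_iff_compactSpace.1 hG.isCompact

/-- The natural action of a group of unitary matrices on Euclidean space. -/
noncomputable def unitaryAction (G : Subgroup (Matrix.unitaryGroup (Fin n) ℂ)) :
    G →* (EuclideanSpace ℂ (Fin n) ≃ₗᵢ[ℂ] EuclideanSpace ℂ (Fin n)) :=
  (Unitary.linearIsometryEquiv.toMonoidHom.comp (Unitary.map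
    { toFun := Matrix.toEuclideanCLM (n := Fin n) (𝕜 := ℂ)
      map_one' := map_one _
      map_mul' := map_mul _
      map_star' := map_star _ }).toMonoidHom).comp G.subtype

theorem ofLp_unitaryAction (G : Subgroup (Matrix.unitaryGroup (Fin n) ℂ)) (g : G)
    (x : EuclideanSpace ℂ (Fin n)) :
    (unitaryAction G g x).ofLp = ((g : Matrix.unitaryGroup (Fin n) ℂ) : Matrix (Fin n) (Fin n) ℂ)
      *ᵥ x.ofLp :=
  Matrix.ofLp_toEuclideanCLM _ _

theorem continuous_unitaryAction (G : Subgroup (Matrix.unitaryGroup (Fin n) ℂ))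
    (x : EuclideanSpace ℂ (Fin n)) : Continuous fun g => unitaryAction G g x := by
  have h1 : Continuous fun g : G => ((g : Matrix.unitaryGroup (Fin n) ℂ) :
      Matrix (Fin n) (Fin n) ℂ) *ᵥ x.ofLp := by
    fun_prop
  have h2 := (PiLp.continuous_toLp 2 (fun _ : Fin n => ℂ)).comp h1
  refine h2.congr fun g => ?_
  rw [Function.comp_apply, ← ofLp_unitaryAction]

theorem smul_mem_orbitCone {G : Subgroup (Matrix.unitaryGroup (Fin n) ℂ)} {v : Fin n → ℂ}
    {x : Fin n → ℂ} (hx : x ∈ orbitCone G v) {c : ℂ} (hc : c ≠ 0) : c • x ∈ orbitCone G v := by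
  obtain ⟨g, hg, a, ha, rfl⟩ := hx
  exact ⟨g, hg, c * a, mul_ne_zero hc ha, by rw [mul_smul]⟩

theorem orbitConeOf_unitaryAction (G : Subgroup (Matrix.unitaryGroup (Fin n) ℂ))
    (v : EuclideanSpace ℂ (Fin n)) {c : ℂ} (hc : c ≠ 0) :
    orbitConeOf (unitaryAction G) (c • v) = {x | x.ofLp ∈ orbitCone G v.ofLp} := by
  ext x
  constructor
  · rintro ⟨g, a, ha, rfl⟩
    refine ⟨g, g.2, a * c, mul_ne_zero ha hc, ?_⟩
    rw [map_smul, WithLp.ofLp_smul, WithLp.ofLp_smul, ofLp_unitaryAction, mul_smul]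
  · rintro ⟨g, hg, a, ha, hx⟩
    refine ⟨⟨g, hg⟩, a * c⁻¹, mul_ne_zero ha (inv_ne_zero hc), (WithLp.ofLp_injective 2) ?_⟩
    rw [hx, map_smul, WithLp.ofLp_smul, WithLp.ofLp_smul, ofLp_unitaryAction, mul_smul,
      inv_smul_smul₀ hc]

/-- A coadjoint orbit, seen in Euclidean space from a unit vector. -/
theorem IsCoadjointOrbit.exists_isKahlerOrbit {G : Subgroup (Matrix.unitaryGroup (Fin n) ℂ)}
    {v : Fin n → ℂ} {d : ℕ} (hM : IsCoadjointOrbit G v d) :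
    ∃ (w : EuclideanSpace ℂ (Fin n)) (T : Submodule ℂ (EuclideanSpace ℂ (Fin n)))
      (φ : EuclideanSpace ℂ (Fin n) → EuclideanSpace ℂ (Fin n)) (r : ℝ),
      orbitConeOf (unitaryAction G) w = {x | x.ofLp ∈ orbitCone G v} ∧
      Module.finrank ℂ T = d + 1 ∧ IsKahlerOrbit (unitaryAction G) w T φ r := by
  set u : EuclideanSpace ℂ (Fin n) := WithLp.toLp 2 v with hu
  have hu0 : u ≠ 0 := fun h0 => hM.ne_zero (by simpa [hu] using h0)
  have hc : ((‖u‖⁻¹ : ℝ) : ℂ) ≠ 0 :=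
    Complex.ofReal_ne_zero.2 (inv_ne_zero (norm_ne_zero_iff.2 hu0))
  -- Normalizing the base vector leaves the cone unchanged.
  set w := ((‖u‖⁻¹ : ℝ) : ℂ) • u with hw
  have hX : orbitConeOf (unitaryAction G) w = {x | x.ofLp ∈ orbitCone G v} :=
    orbitConeOf_unitaryAction G u hc
  have hwX : w ∈ orbitConeOf (unitaryAction G) w := by
    simpa using apply_mem_orbitConeOf (ρ := unitaryAction G) (v := w) 1
  let ψ := EuclideanSpace.equiv (Fin n) ℂ
  have hwC : ψ w ∈ orbitCone G v := by rw [hX] at hwX; exact hwX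
  obtain ⟨e, L, hwe, he, hes, hL, heL⟩ := hM.isComplexSubmanifold _ hwC
  obtain ⟨T, φ, r, hT, hret⟩ := exists_isLocalRetraction hwX
    (fun x hx c hc => by
      rw [hX] at hx ⊢
      exact smul_mem_orbitCone hx hc)
    (ψ.toHomeomorph.transOpenPartialHomeomorph e) L hwe
    (he.comp ψ.differentiable.differentiableOn fun x hx => hx)
    (ψ.symm.differentiable.comp_differentiableOn hes)
    (fun y hy => by
      rw [hX]
      exact heL (ψ y) hy)
  refine ⟨w, T, φ, r, hX, hT.trans hL, continuous_unitaryAction G, ?_, hret, ?_, ?_⟩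
  · rw [hw, norm_smul, Complex.norm_real, norm_inv, norm_norm,
      inv_mul_cancel₀ (norm_ne_zero_iff.2 hu0)]
  · rw [hX]
    have h1 := hM.isConnected.isPreconnected.image ψ.symm ψ.symm.continuous.continuousOn
    rwa [ψ.symm.image_eq_preimage_symm] at h1
  · rw [hX]
    have h1 := congrArg (Submodule.map (ψ.symm : (Fin n → ℂ) →ₗ[ℂ] EuclideanSpace ℂ (Fin n)))
      hM.span_eq_top
    rw [Submodule.map_span, Submodule.map_top, LinearMap.range_eq_top.2 ψ.symm.surjective] at h1
    have h2 : {x : EuclideanSpace ℂ (Fin n) | x.ofLp ∈ orbitCone G v} = ψ.symm '' orbitCone G v :=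
      (ψ.symm.image_eq_preimage_symm _).symm
    rw [h2]
    exact h1

end Unitary

/-! ### Conclusion. -/

theorem mainTheorem10 (n d : ℕ) (hn : 2 ≤ n)
    (G : Subgroup (Matrix.unitaryGroup (Fin n) ℂ)) (v : Fin n → ℂ)
    (hM : IsCoadjointOrbit G v d) (α β : Fin n) (p : ℝ) (hp : 0 < p) :
    IsSchatten p (DruryArveson.crossCommutator (orbitCone G v) α β) ↔ (d : ℝ) + 1 < p := by
  obtain ⟨w, T, φ, r, hX, hT, ho⟩ := hM.exists_isKahlerOrbit
  have hF := DruryArveson.isFockSystem fun x (hx : x ∈ orbitCone G v) c hc =>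
    smul_mem_orbitCone hx hc
  rw [← hX] at hF
  have : CompactSpace G := compactSpace_of_isClosed hM.isClosed
  let _ : MeasurableSpace G := borel G
  have : BorelSpace G := ⟨rfl⟩
  -- Haar measure normalized on the whole compact group, hence a probability measure.
  let μ : Measure G := Measure.haarMeasure ⊤
  have : IsProbabilityMeasure μ := ⟨Measure.haarMeasure_self⟩
  have hne : ∀ i : Fin n, EuclideanSpace.single i (1 : ℂ) ≠ 0 := fun i => by simp
  rw [DruryArveson.crossCommutator_eq]
  refine hF.isSchatten_mulCommutator_iff μ ho hT ?_ hp
  -- Two coordinate vectors are equal or orthogonal, the two cases in which the symbol was shown not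
  -- to vanish identically; `2 ≤ n` enters only in the first.
  by_cases h : α = β
  · subst h
    exact ho.exists_commutatorSymbol_self_ne_zero (hne α) (by simpa using hn)
  · refine ho.exists_commutatorSymbol_ne_zero_of_inner_eq_zero (hne α) (hne β) ?_
    rw [EuclideanSpace.inner_single_left]
    simp [h]
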